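/- **Definitions.** All matroids are (possibly infinite) matroids in the sense of the axioms of Bruhn, Diestel, Kriesell, Pendavingh and Wollan. A matroid $M$ on $E$ is *tame* if every intersection of a circuit with a cocircuit is finite, and *connected* if there is no partition of $E$ into nonempty sets $A,B$ with bases $s_A$ of $A$ and $s_B$ of $B$ such that $s_A\cup s_B$ is a base of $M$. A *graph-like space* $G$ with vertex set $V$ and edge set $E$ is a topology on $V\sqcup((0,1)\times E)$ with continuous maps $\iota_e\colon[0,1]\to G$ $(e\in E)$ such that $\iota_e(r)=(r,e)$ for $r\in(0,1)$; $\iota_e(0),\iota_e(1)\in V$; $\iota_e\restriction_{(0,1)}$ is open; and any two distinct vertices lie in two disjoint open sets, one in each, that together cover $V$. A *map of graph-like spaces* $G\to G'$ is a continuous function that sends vertices to vertices and, for each edge $e$, either sends all inner points $(r,e)$ to one vertex, or for some edge $f$ sends every $(r,e)$ to $(r,f)$, or for some edge $f$ sends every $(r,e)$ to $(1-r,f)$. Removing an edge means removing its inner points. A *pseudo-line* is a compact connected graph-like space with vertices $s,t$ such that removing any single edge separates $s$ from $t$ (puts them in different components), and any two distinct vertices are separated by removing some single edge. A *pseudo-arc*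 in $G$ from $v$ to $w$ is an injective map of graph-like spaces from a pseudo-line to $G$ (or its image) with $s\mapsto v$, $t\mapsto w$. A *pseudo-circle* is a compact connected graph-like space with at least one edge such that removing any one edge leaves it connected, removing any two distinct edges disconnects it, and any two distinct vertices are separated by removing some two edges; a pseudo-circle in $G$ is the image of an injective map of graph-like spaces from a pseudo-circle to $G$. A subset $H$ of $G$ is *pseudo-arc connected* if it is a connected set of inner points of one edge, or else any two vertices in $H$ are joined by a pseudo-arc of $G$ included in $H$ and any inner point in $H$ of an edge $e$ can be joined to an end-vertex of $e$ by an arc in $H\cap\iota_e([0,1])$. For $R\subseteq E$, $G\restriction_R$ is the subspace with all vertices of $G$ and the edges in $R$; $\hat G$ is the subspace with all edges of $G$ and those vertices of $G$ that lie on at least one edge or pseudo-circle of $G$. A *graph framework* $\Gamma$ on a tame matroid $M$ consists of functions $c_o\colon o\to\{-1,1\}$ for each circuit $o$, and $d_b\colon b\to\{-1,1\}$ and $\sigma_b\colon E\setminus b\to\{-1,1\}$ for each cocircuit $b$, such that $\sum_{e\in o\cap b}c_o(e)d_b(e)=0$ for all $o,b$; for each circuit $o$ the relation $R_o$ on $o$,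 given by $[e,f,g]_{R_o}$ iff $e,f,g\in o$ are distinct and there is a cocircuit $b$ with $b\cap o=\{e,f\}$ and $\sigma_b(g)=c_o(f)d_b(f)$, is a cyclic order (cyclic, asymmetric, transitive, total); and for all circuits $o$, cocircuits $b$, finite $s$ with $b\cap o\subseteq s\subseteq o$ and distinct $p,q\in s$ that are clockwise adjacent in $R_o\restriction_s$ (that is, $[p,q,g]_{R_o}$ for all $g\in s\setminus\{p,q\}$): (1) if $p,q\in b$ then $c_o(p)d_b(p)=-c_o(q)d_b(q)$; (2) if $p,q\notin b$ then $\sigma_b(p)=\sigma_b(q)$; (3) if $p\in b$, $q\notin b$ then $c_o(p)d_b(p)=\sigma_b(q)$; (4) if $p\notin b$, $q\in b$ then $c_o(q)d_b(q)=-\sigma_b(p)$. The graph-like space $G(M,\Gamma)$ has edge set $E$ and vertex set $V=\{-1,1\}^{\mathcal C^*(M)}$, where $\mathcal C^*(M)$ is the set of cocircuits. If $e\in b$ then $\iota_e(0)(b)=-d_b(e)$ and $\iota_e(1)(b)=d_b(e)$; if $e\notin b$ then $\iota_e(0)(b)=\iota_e(1)(b)=\sigma_b(e)$. Its topology has as subbasis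 the sets $U\times\{e\}$ with $e \in E$ and $U\subseteq(0,1)$ open, and, for $b\in\mathcal C^*(M)$, $i\in\{-1,1\}$ and $\epsilon\colon b\to(0,1)$, the sets $$U_b^i(\epsilon)=\{v\in V: v(b)=i\}\cup\bigcup_{e\notin b,\ \sigma_b(e)=i}(0,1)\times\{e\}\cup\bigcup_{e\in b,\ d_b(e)=i}(1-\epsilon(e),1)\times\{e\}\cup\bigcup_{e\in b,\ d_b(e)=-i}(0,\epsilon(e))\times\{e\}.$$ Write $\hat G(M,\Gamma)$ for $\hat G$ with $G=G(M,\Gamma)$. **Theorem.** Let $M$ be a connected tame matroid with ground set $E$ and let $\Gamma$ be a graph framework on $M$. (The empty space counts as connected; it occurs here only if $E=\varnothing$.) (A) If $s$ is a base of $M$, then any two vertices of $\hat G(M,\Gamma)$ can be joined by a pseudo-arc in $\hat G(M,\Gamma)$ that uses edges from $s$ only. (B) For every $s\subseteq E$ the following are equivalent: (1) $s$ is spanning in $M$; (2) $\hat G(M,\Gamma)\restriction_s$ is connected; (3) $\hat G(M,\Gamma)\restriction_s$ is pseudo-arc connected. (C) For every $s\subseteq E$ the following are equivalent: (1) $s$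 is a base of $M$; (2) $s$ is minimal among the subsets of $E$ with the property that $\hat G(M,\Gamma)\restriction_s$ is connected; (3) $s$ is minimal among the subsets of $E$ with the property that $\hat G(M,\Gamma)\restriction_s$ is pseudo-arc connected. -/

import Mathlib

open Set Topology

universe u

namespace GraphicMatroid

/-! ### Graph-like spaces -/

section GraphLike

/-- The underlying set `V ⊔ ((0,1) × E)` of a graph-like space with vertex set `V` and edge
set `E`. -/
inductive Points (V E : Type u) : Type u
  /-- a vertex, as a point -/
  | vertex (v : V) : Points V E
  /-- the inner point `(r, e)` of the edge `e` -/
  | inner (r : Ioo (0 : ℝ) 1) (e : E) : Points V E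

/-- The map `ι_e : [0,1] → V ⊔ ((0,1) × E)` that is `(r, e)` at each `r ∈ (0,1)` and has the
prescribed vertices `v₀`, `v₁` as its values at `0` and `1`. -/
noncomputable def edgeMap {V E : Type u} (v₀ v₁ : V) (e : E) (r : unitInterval) : Points V E :=
  open Classical in
  if h : (r : ℝ) ∈ Ioo (0 : ℝ) 1 then Points.inner ⟨r, h⟩ e
  else if (r : ℝ) ≤ 0 then Points.vertex v₀ else Points.vertex v₁

/-- A graph-like space with vertex set `V` and edge set `E`: a topology on `V ⊔ ((0,1) × E)`
together with the end-vertices `ι_e(0) = src e` and `ι_e(1) = tgt e` of the edges. (The values of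
`ι_e` on `(0,1)` are forced, so that `ι_e` is determined by its values at `0` and `1`.) -/
structure GraphLikeSpace (V E : Type u) where
  /-- the topology -/
  top : TopologicalSpace (Points V E)
  /-- `ι_e(0)` -/
  src : E → V
  /-- `ι_e(1)` -/
  tgt : E → V
  continuous_edgeMap : ∀ e, Continuous[_, top] (edgeMap (src e) (tgt e) e)
  isOpen_inner : ∀ (e : E) (U : Set (Ioo (0 : ℝ) 1)), IsOpen U →
    IsOpen[top] ((fun r => Points.inner r e) '' U)
  separated : ∀ v w : V, v ≠ w → ∃ U U' : Set (Points V E),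
    IsOpen[top] U ∧ IsOpen[top] U' ∧ Disjoint U U' ∧
    (∀ x : V, Points.vertex x ∈ U ∨ Points.vertex x ∈ U') ∧
    Points.vertex v ∈ U ∧ Points.vertex w ∈ U'

namespace GraphLikeSpace

variable {V E V' E' : Type u}

/-- The set of points of `G`, which carries the topology of `G`. -/
def Pts (_G : GraphLikeSpace V E) : Type u := Points V E

instance (G : GraphLikeSpace V E) : TopologicalSpace G.Pts := G.top

/-- A vertex as a point of `G`. -/
def vert (G : GraphLikeSpace V E) (v : V) : G.Pts := Points.vertex v

/-- An inner point of an edge as a point of `G`. -/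
def inner (G : GraphLikeSpace V E) (r : Ioo (0 : ℝ) 1) (e : E) : G.Pts := Points.inner r e

/-- The map `ι_e : [0,1] → G`. -/
noncomputable def ι (G : GraphLikeSpace V E) (e : E) : unitInterval → G.Pts :=
  edgeMap (G.src e) (G.tgt e) e

/-- The map of point sets induced by a map of vertices and a map of edges. -/
def pointsMap (f : V' → V) (g : E' → E) : Points V' E' → Points V E
  | Points.vertex v => Points.vertex (f v)
  | Points.inner r e => Points.inner r (g e)

/-- The graph-like subspace with vertex set `V'` and edge set `E'`, where `V'` and `E'` are
embedded in the vertex set and the edge set of `G` and `V'` contains the end-vertices of all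
edges in `E'`. It carries the subspace topology. -/
def subspace (G : GraphLikeSpace V E) (f : V' ↪ V) (g : E' ↪ E) (src tgt : E' → V')
    (hsrc : ∀ e, f (src e) = G.src (g e)) (htgt : ∀ e, f (tgt e) = G.tgt (g e)) :
    GraphLikeSpace V' E' where
  top := G.top.induced (pointsMap f g)
  src := src
  tgt := tgt
  continuous_edgeMap := by
    intro e
    refine continuous_induced_rng.2 ?_
    have h : (pointsMap f g) ∘ (edgeMap (src e) (tgt e) e)
        = edgeMap (G.src (g e)) (G.tgt (g e)) (g e) := by
      funext r
      simp only [Function.comp, edgeMap]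
      split_ifs <;> simp [pointsMap, hsrc, htgt]
    rw [h]
    exact G.continuous_edgeMap (g e)
  isOpen_inner := by
    intro e U hU
    refine (@isOpen_induced_iff _ _ G.top _ _).2 ⟨_, G.isOpen_inner (g e) U hU, ?_⟩
    ext x
    rcases x with v | ⟨r, e₁⟩
    · simp [pointsMap]
    · simp [pointsMap]
  separated := by
    intro v w hvw
    obtain ⟨U, U', hU, hU', hd, hcov, hv, hw⟩ := G.separated (f v) (f w) (f.injective.ne hvw)
    exact ⟨pointsMap f g ⁻¹' U, pointsMap f g ⁻¹' U',
      (@isOpen_induced_iff _ _ G.top _ _).2 ⟨U, hU, rfl⟩,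
      (@isOpen_induced_iff _ _ G.top _ _).2 ⟨U', hU', rfl⟩, hd.preimage _, fun x => hcov (f x), hv, hw⟩

/-- The restriction of `G` to the set `R` of edges: the vertices are those of `G`, the edges are
those in `R`, and the topology is the subspace topology. -/
def restrict (G : GraphLikeSpace V E) (R : Set E) : GraphLikeSpace V R :=
  G.subspace (Function.Embedding.refl V) (Function.Embedding.subtype (· ∈ R))
    (fun e => G.src e) (fun e => G.tgt e) (fun _ => rfl) (fun _ => rfl)

/-! ### Maps of graph-like spaces -/

/-- The function on points induced by `φ_V : V → V'` and `φ_E : E → (E' × {+,-}) ⊔ V'`; here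
`true` stands for `+` and `false` for `-`. -/
def inducedFun (φV : V → V') (φE : E → (E' × Bool) ⊕ V') : Points V E → Points V' E'
  | Points.vertex v => Points.vertex (φV v)
  | Points.inner r e =>
    match φE e with
    | Sum.inl (f, true) => Points.inner r f
    | Sum.inl (f, false) =>
        Points.inner ⟨1 - r, by linarith [r.2.2], by linarith [r.2.1]⟩ f
    | Sum.inr v => Points.vertex v

/-- A map of graph-like spaces. -/
structure Hom (G : GraphLikeSpace V E) (G' : GraphLikeSpace V' E') where
  /-- the action on vertices -/
  onV : V → V'
  /-- the action on edges: an edge goes to an edge with a direction, or to a vertex -/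
  onE : E → (E' × Bool) ⊕ V'
  continuous_inducedFun : Continuous[G.top, G'.top] (inducedFun onV onE)

/-- The underlying function of a map of graph-like spaces. -/
def Hom.toFun {G : GraphLikeSpace V E} {G' : GraphLikeSpace V' E'} (φ : Hom G G') :
    G.Pts → G'.Pts :=
  inducedFun φ.onV φ.onE

/-! ### Pseudo-lines, pseudo-arcs and pseudo-circles -/

/-- The subspace of `G` obtained by removing the edges in `F`, that is, their inner points. -/
def minus (G : GraphLikeSpace V E) (F : Set E) : Set G.Pts :=
  {x | ∀ e ∈ F, ∀ r, x ≠ G.inner r e}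

/-- Removing the edges in `F` separates `v` from `w`: they lie in different components of
`G \ F`. -/
def SeparatedBy (G : GraphLikeSpace V E) (F : Set E) (v w : V) : Prop :=
  G.vert w ∉ connectedComponentIn (G.minus F) (G.vert v)

/-- `L` is a pseudo-line with start-vertex `s` and end-vertex `t`. -/
structure IsPseudoLine (L : GraphLikeSpace V E) (s t : V) : Prop where
  compact : CompactSpace L.Pts
  connected : ConnectedSpace L.Pts
  separates_ends : ∀ e : E, L.SeparatedBy {e} s t
  separates_vertices : ∀ v w : V, v ≠ w → ∃ e : E, L.SeparatedBy {e} v w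

/-- `C` is a pseudo-circle. -/
structure IsPseudoCircle (C : GraphLikeSpace V E) : Prop where
  compact : CompactSpace C.Pts
  connected : ConnectedSpace C.Pts
  nonempty_edges : Nonempty E
  minus_one : ∀ e : E, IsConnected (C.minus {e})
  minus_two : ∀ e f : E, e ≠ f → ¬ IsConnected (C.minus {e, f})
  separates_vertices : ∀ v w : V, v ≠ w → ∃ e f : E, e ≠ f ∧ C.SeparatedBy {e, f} v w

/-- A pseudo-arc in `G` from `v` to `w`: an injective map of graph-like spaces from a pseudo-line
to `G` that sends the start-vertex to `v` and the end-vertex to `w`. (Such a map is injective on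
vertices and on edges, so that a pseudo-line in the universe of `G` is no restriction.) -/
structure PseudoArc (G : GraphLikeSpace V E) (v w : V) where
  /-- the vertices of the pseudo-line -/
  LV : Type u
  /-- the edges of the pseudo-line -/
  LE : Type u
  /-- the pseudo-line -/
  line : GraphLikeSpace LV LE
  /-- its start-vertex -/
  s : LV
  /-- its end-vertex -/
  t : LV
  isPseudoLine : line.IsPseudoLine s t
  /-- the map -/
  map : Hom line G
  injective : Function.Injective map.toFun
  map_start : map.onV s = v
  map_end : map.onV t = w

/-- The set of points of a pseudo-arc in `G`. -/
def PseudoArc.image {G : GraphLikeSpace V E} {v w : V} (P : PseudoArc G v w) : Set G.Pts :=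
  range P.map.toFun

/-- The set of edges used by a pseudo-arc in `G`. -/
def PseudoArc.edges {G : GraphLikeSpace V E} {v w : V} (P : PseudoArc G v w) : Set E :=
  {e | ∃ r, G.inner r e ∈ P.image}

/-- The vertex `v` lies on a pseudo-circle of `G`, that is, on the image of an injective map of
graph-like spaces from a pseudo-circle to `G`. -/
def OnPseudoCircle (G : GraphLikeSpace V E) (v : V) : Prop :=
  ∃ (CV CE : Type u) (C : GraphLikeSpace CV CE) (φ : Hom C G),
    C.IsPseudoCircle ∧ Function.Injective φ.toFun ∧ G.vert v ∈ range φ.toFun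

/-- The vertices of `G` that lie on at least one edge or pseudo-circle of `G`. -/
def hatVertices (G : GraphLikeSpace V E) : Set V :=
  {v | (∃ e, v = G.src e ∨ v = G.tgt e) ∨ G.OnPseudoCircle v}

/-- The subspace `Ĝ` of `G`, with the same edges and with the vertices of `G` that lie on at least
one edge or pseudo-circle of `G`. -/
def hat (G : GraphLikeSpace V E) : GraphLikeSpace G.hatVertices E :=
  G.subspace (Function.Embedding.subtype (· ∈ G.hatVertices)) (Function.Embedding.refl E)
    (fun e => ⟨G.src e, Or.inl ⟨e, Or.inl rfl⟩⟩) (fun e => ⟨G.tgt e, Or.inl ⟨e, Or.inr rfl⟩⟩)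
    (fun _ => rfl) (fun _ => rfl)

/-- A subset `H` of a graph-like space is pseudo-arc connected if it is a connected subset of the
set of inner points of some edge, or else any two vertices in `H` can be joined by a pseudo-arc
included in `H` and any inner point in `H` of an edge `e` can be joined to an end-vertex of `e` by
an arc of `H ∩ ι_e[0,1]`. -/
def IsPseudoArcConnected (G : GraphLikeSpace V E) (H : Set G.Pts) : Prop :=
  (∃ e, H ⊆ range (fun r => G.inner r e) ∧ IsConnected H) ∨
  ((∀ v w : V, G.vert v ∈ H → G.vert w ∈ H → ∃ P : PseudoArc G v w, P.image ⊆ H) ∧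
    ∀ (e : E) (r : Ioo (0 : ℝ) 1), G.inner r e ∈ H →
      ∃ γ : unitInterval → G.Pts, Continuous γ ∧ Function.Injective γ ∧
        range γ ⊆ H ∩ range (G.ι e) ∧ γ 0 = G.inner r e ∧
        (γ 1 = G.vert (G.src e) ∨ γ 1 = G.vert (G.tgt e)))

end GraphLikeSpace

end GraphLike

/-! ### Matroids and graph frameworks -/

section Framework

variable {α : Type u}

/-- A matroid is tame if every circuit-cocircuit intersection is finite. -/
def IsTame (M : Matroid α) : Prop :=
  ∀ o b, M.IsCircuit o → M.IsCocircuit b → (o ∩ b).Finite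

/-- A (1-)separation of `M`: a partition of the ground set into two nonempty sets `A`, `B` with
bases `I`, `J` whose union is a base of `M`. -/
def IsSeparation (M : Matroid α) (A B : Set α) : Prop :=
  A ∪ B = M.E ∧ Disjoint A B ∧ A.Nonempty ∧ B.Nonempty ∧
    ∃ I J, M.IsBasis I A ∧ M.IsBasis J B ∧ M.IsBase (I ∪ J)

/-- A matroid is connected if it has no separation. -/
def IsConnectedMatroid (M : Matroid α) : Prop :=
  ∀ A B, ¬ IsSeparation M A B

/-- `R` is a cyclic order on the set `X`. -/
structure IsCyclicOrderOn (X : Set α) (R : α → α → α → Prop) : Prop where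
  mem : ∀ a b c, R a b c → a ∈ X ∧ b ∈ X ∧ c ∈ X
  cyclic : ∀ a b c, R a b c → R b c a
  asymm : ∀ a b c, R a b c → ¬ R c b a
  trans : ∀ a b c d, R a b c → R a c d → R a b d
  total : ∀ a ∈ X, ∀ b ∈ X, ∀ c ∈ X, a ≠ b → b ≠ c → a ≠ c → R a b c ∨ R c b a

/-- The distinct elements `p`, `q` of `s` are clockwise adjacent in the restriction of `R`
to `s`. -/
def ClockwiseAdjacent (R : α → α → α → Prop) (s : Set α) (p q : α) : Prop :=
  p ∈ s ∧ q ∈ s ∧ p ≠ q ∧ ∀ g ∈ s, g ≠ p → g ≠ q → R p q g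

/-- The relation `R_o` determined by sign functions `c`, `d`, `σ`. -/
def circuitRel (M : Matroid α) (c d σ : Set α → α → ℤˣ) (o : Set α) (e f g : α) : Prop :=
  e ≠ f ∧ f ≠ g ∧ e ≠ g ∧ e ∈ o ∧ f ∈ o ∧ g ∈ o ∧
    ∃ b, M.IsCocircuit b ∧ b ∩ o = {e, f} ∧ σ b g = c o f * d b f

/-- A graph framework on a (tame) matroid `M`. The signs `{-1, 1}` are the units of `ℤ`. Only
the values `c o e` for `e` in a circuit `o`, `d b e` for `e` in a cocircuit `b`, and `σ b e` for
`b` a cocircuit and `e ∈ M.E \ b` are meaningful, and only these are used. -/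
structure GraphFramework (M : Matroid α) where
  /-- the function `c_o : o → {-1, 1}` of each circuit `o` -/
  c : Set α → α → ℤˣ
  /-- the function `d_b : b → {-1, 1}` of each cocircuit `b` -/
  d : Set α → α → ℤˣ
  /-- the function `σ_b : E \ b → {-1, 1}` of each cocircuit `b` -/
  σ : Set α → α → ℤˣ
  signing : ∀ o b, M.IsCircuit o → M.IsCocircuit b →
    ∑ᶠ e ∈ o ∩ b, ((c o e : ℤ) * (d b e : ℤ)) = 0
  cyclicOrder : ∀ o, M.IsCircuit o → IsCyclicOrderOn o (circuitRel M c d σ o)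
  adj_mem_mem : ∀ o b s p q, M.IsCircuit o → M.IsCocircuit b → s.Finite → b ∩ o ⊆ s → s ⊆ o →
    ClockwiseAdjacent (circuitRel M c d σ o) s p q → p ∈ b → q ∈ b →
    c o p * d b p = -(c o q * d b q)
  adj_notMem_notMem : ∀ o b s p q, M.IsCircuit o → M.IsCocircuit b → s.Finite → b ∩ o ⊆ s →
    s ⊆ o → ClockwiseAdjacent (circuitRel M c d σ o) s p q → p ∉ b → q ∉ b →
    σ b p = σ b q
  adj_mem_notMem : ∀ o b s p q, M.IsCircuit o → M.IsCocircuit b → s.Finite → b ∩ o ⊆ s →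
    s ⊆ o → ClockwiseAdjacent (circuitRel M c d σ o) s p q → p ∈ b → q ∉ b →
    c o p * d b p = σ b q
  adj_notMem_mem : ∀ o b s p q, M.IsCircuit o → M.IsCocircuit b → s.Finite → b ∩ o ⊆ s →
    s ⊆ o → ClockwiseAdjacent (circuitRel M c d σ o) s p q → p ∉ b → q ∈ b →
    c o q * d b q = -σ b p

/-! ### The graph-like space `G(M, Γ)` -/

/-- The vertex set `{-1, 1}^{C*(M)}`, where `C*(M)` is the set of cocircuits of `M`. -/
abbrev FVertex (M : Matroid α) : Type u := {b : Set α // M.IsCocircuit b} → ℤˣ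

namespace GraphFramework

variable {M : Matroid α}

/-- The subbasic open set `U_b^i(ε)`. -/
def side (Γ : GraphFramework M) (b : {b : Set α // M.IsCocircuit b}) (i : ℤˣ)
    (ε : α → Ioo (0 : ℝ) 1) : Set (Points (FVertex M) M.E)
  | Points.vertex v => v b = i
  | Points.inner r e =>
      ((e : α) ∉ b.1 ∧ Γ.σ b e = i) ∨
      ((e : α) ∈ b.1 ∧ Γ.d b e = i ∧ 1 - (ε e : ℝ) < r) ∨
      ((e : α) ∈ b.1 ∧ Γ.d b e = -i ∧ (r : ℝ) < ε e)

/-- The subbasis of the topology of `G(M, Γ)`. -/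
def subbasis (Γ : GraphFramework M) : Set (Set (Points (FVertex M) M.E)) :=
  {S | ∃ (e : M.E) (U : Set (Ioo (0 : ℝ) 1)), IsOpen U ∧ S = (fun r => Points.inner r e) '' U} ∪
  {S | ∃ b i ε, S = Γ.side b i ε}

open Classical in
/-- The end-vertex `ι_e(0)` in `G(M, Γ)`. -/
noncomputable def srcVertex (Γ : GraphFramework M) (e : M.E) : FVertex M :=
  fun b => if (e : α) ∈ b.1 then -Γ.d b e else Γ.σ b e

open Classical in
/-- The end-vertex `ι_e(1)` in `G(M, Γ)`. -/
noncomputable def tgtVertex (Γ : GraphFramework M) (e : M.E) : FVertex M :=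
  fun b => if (e : α) ∈ b.1 then Γ.d b e else Γ.σ b e

/-- The preimage of a set under `ι_e` is open if, near each end-vertex in the set, it contains
the corresponding end of the edge. -/
theorem isOpen_preimage_edgeMap {V E : Type u} (v₀ v₁ : V) (e : E) (S : Set (Points V E))
    (hin : IsOpen {r : Ioo (0 : ℝ) 1 | Points.inner r e ∈ S})
    (h0 : Points.vertex v₀ ∈ S →
      ∃ δ > (0 : ℝ), ∀ r : Ioo (0 : ℝ) 1, (r : ℝ) < δ → Points.inner r e ∈ S)
    (h1 : Points.vertex v₁ ∈ S →
      ∃ δ < (1 : ℝ), ∀ r : Ioo (0 : ℝ) 1, δ < (r : ℝ) → Points.inner r e ∈ S) :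
    IsOpen (edgeMap v₀ v₁ e ⁻¹' S) := by
  rw [isOpen_iff_mem_nhds]
  intro x hx
  by_cases hxI : (x : ℝ) ∈ Ioo (0 : ℝ) 1
  · obtain ⟨T, hT, hTS⟩ := isOpen_induced_iff.1 hin
    have hxT : (x : ℝ) ∈ T := by
      have : (⟨x, hxI⟩ : Ioo (0 : ℝ) 1) ∈ Subtype.val ⁻¹' T := by
        rw [hTS]
        simpa [edgeMap, hxI.1, hxI.2] using hx
      exact this
    have hnhds : Subtype.val ⁻¹' (T ∩ Ioo (0 : ℝ) 1) ∈ 𝓝 x :=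
      ((hT.inter isOpen_Ioo).preimage continuous_subtype_val).mem_nhds ⟨hxT, hxI⟩
    refine Filter.mem_of_superset hnhds ?_
    rintro y ⟨hyT, hyI⟩
    have hy : (⟨y, hyI⟩ : Ioo (0 : ℝ) 1) ∈ Subtype.val ⁻¹' T := hyT
    rw [hTS] at hy
    rw [mem_preimage, edgeMap, dif_pos hyI]
    exact hy
  · by_cases hx0 : (x : ℝ) ≤ 0
    · have hv : Points.vertex v₀ ∈ S := by
        simpa only [mem_preimage, edgeMap, dif_neg hxI, if_pos hx0] using hx
      obtain ⟨δ, hδ, hS⟩ := h0 hv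
      have hnhds : Subtype.val ⁻¹' (Iio (min δ 1)) ∈ 𝓝 x :=
        (isOpen_Iio.preimage continuous_subtype_val).mem_nhds
          (lt_of_le_of_lt hx0 (lt_min hδ one_pos))
      refine Filter.mem_of_superset hnhds ?_
      intro y hy
      have hy' : (y : ℝ) < min δ 1 := hy
      rw [mem_preimage, edgeMap]
      split_ifs with hyI hy0
      · exact hS ⟨y, hyI⟩ (hy'.trans_le (min_le_left _ _))
      · exact hv
      · exact absurd ⟨lt_of_not_ge hy0, hy'.trans_le (min_le_right _ _)⟩ hyI
    · have hv : Points.vertex v₁ ∈ S := by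
        simpa only [mem_preimage, edgeMap, dif_neg hxI, if_neg hx0] using hx
      obtain ⟨δ, hδ, hS⟩ := h1 hv
      have hx1 : (1 : ℝ) ≤ x := by
        by_contra hlt
        exact hxI ⟨lt_of_not_ge hx0, lt_of_not_ge hlt⟩
      have hnhds : Subtype.val ⁻¹' (Ioi (max δ 0)) ∈ 𝓝 x :=
        (isOpen_Ioi.preimage continuous_subtype_val).mem_nhds
          (lt_of_lt_of_le (max_lt hδ one_pos) hx1)
      refine Filter.mem_of_superset hnhds ?_
      intro y hy
      have hy' : max δ 0 < (y : ℝ) := hy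
      rw [mem_preimage, edgeMap]
      split_ifs with hyI hy0
      · exact hS ⟨y, hyI⟩ ((le_max_left _ _).trans_lt hy')
      · exact absurd ((le_max_right δ 0).trans_lt hy') (not_lt.2 hy0)
      · exact hv

/-- The graph-like space `G(M, Γ)`. -/
noncomputable def space (Γ : GraphFramework M) : GraphLikeSpace (FVertex M) M.E where
  top := TopologicalSpace.generateFrom Γ.subbasis
  src := Γ.srcVertex
  tgt := Γ.tgtVertex
  continuous_edgeMap := by
    intro e
    refine continuous_generateFrom_iff.2 ?_
    rintro S (⟨e', U, hU, rfl⟩ | ⟨b, i, ε, rfl⟩)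
    · apply isOpen_preimage_edgeMap
      · by_cases h : e' = e
        · subst h
          convert hU using 1
          ext r
          simp
        · convert isOpen_empty using 1
          ext r
          simp [h]
      · rintro ⟨r, -, hr⟩
        simp at hr
      · rintro ⟨r, -, hr⟩
        simp at hr
    · have key : ∀ r : Ioo (0 : ℝ) 1, Points.inner r e ∈ Γ.side b i ε ↔
          (((e : α) ∉ b.1 ∧ Γ.σ b e = i) ∨
          ((e : α) ∈ b.1 ∧ Γ.d b e = i ∧ 1 - (ε e : ℝ) < r) ∨
          ((e : α) ∈ b.1 ∧ Γ.d b e = -i ∧ (r : ℝ) < ε e)) := fun r => Iff.rfl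
      apply isOpen_preimage_edgeMap
      · simp only [key, ofPred_or, ofPred_and]
        refine (isOpen_const.inter isOpen_const).union ((isOpen_const.inter (isOpen_const.inter
          (isOpen_lt continuous_const continuous_subtype_val))).union
          (isOpen_const.inter (isOpen_const.inter
          (isOpen_lt continuous_subtype_val continuous_const))))
      · intro h
        have h : Γ.srcVertex e b = i := h
        refine ⟨ε e, (ε e).2.1, fun r hr => (key r).2 ?_⟩
        by_cases he : (e : α) ∈ b.1
        · rw [srcVertex, if_pos he] at h
          exact Or.inr (Or.inr ⟨he, by rw [← h, neg_neg], hr⟩)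
        · rw [srcVertex, if_neg he] at h
          exact Or.inl ⟨he, h⟩
      · intro h
        have h : Γ.tgtVertex e b = i := h
        refine ⟨1 - ε e, by linarith [(ε e).2.1], fun r hr => (key r).2 ?_⟩
        by_cases he : (e : α) ∈ b.1
        · rw [tgtVertex, if_pos he] at h
          exact Or.inr (Or.inl ⟨he, h, hr⟩)
        · rw [tgtVertex, if_neg he] at h
          exact Or.inl ⟨he, h⟩
  isOpen_inner := fun e U hU => TopologicalSpace.isOpen_generateFrom_of_mem
    (Or.inl ⟨e, U, hU, rfl⟩)
  separated := by
    intro v w hvw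
    obtain ⟨b, hb⟩ := Function.ne_iff.1 hvw
    let ε : α → Ioo (0 : ℝ) 1 := fun _ => ⟨1 / 2, by norm_num, by norm_num⟩
    refine ⟨Γ.side b (v b) ε, Γ.side b (w b) ε,
      TopologicalSpace.isOpen_generateFrom_of_mem (Or.inr ⟨_, _, _, rfl⟩),
      TopologicalSpace.isOpen_generateFrom_of_mem (Or.inr ⟨_, _, _, rfl⟩), ?_, ?_, rfl, rfl⟩
    · rw [Set.disjoint_left]
      rintro (x | ⟨r, e⟩) h1 h2
      · exact hb (Eq.trans (Eq.symm h1) h2)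
      · have hw : w b = -v b := by
          rcases Int.units_eq_one_or (v b) with h | h <;>
            rcases Int.units_eq_one_or (w b) with h' | h' <;> simp_all
        have e2 : ((ε e : Ioo (0 : ℝ) 1) : ℝ) = 1 / 2 := rfl
        rcases h1 with ⟨a1, a2⟩ | ⟨a1, a2, a3⟩ | ⟨a1, a2, a3⟩ <;>
          rcases h2 with ⟨b1, b2⟩ | ⟨b1, b2, b3⟩ | ⟨b1, b2, b3⟩
        · exact hb (a2.symm.trans b2)
        · exact a1 b1
        · exact a1 b1
        · exact b1 a1
        · exact hb (a2.symm.trans b2)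
        · rw [e2] at a3 b3
          linarith
        · exact b1 a1
        · rw [e2] at a3 b3
          linarith
        · exact hb (neg_injective (a2.symm.trans b2))
    · intro x
      change x b = v b ∨ x b = w b
      rcases Int.units_eq_one_or (v b) with h | h <;>
        rcases Int.units_eq_one_or (w b) with h' | h' <;>
        rcases Int.units_eq_one_or (x b) with h'' | h'' <;> simp_all

/-- The graph-like space `Ĝ(M, Γ)`. -/
noncomputable abbrev hatSpace (Γ : GraphFramework M) :
    GraphLikeSpace Γ.space.hatVertices M.E :=
  Γ.space.hat

/-- The restriction of `Ĝ(M, Γ)` to the edges that lie in `s`. -/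
noncomputable abbrev hatRestrict (Γ : GraphFramework M) (s : Set α) :
    GraphLikeSpace Γ.space.hatVertices (Subtype.val ⁻¹' s : Set M.E) :=
  Γ.hatSpace.restrict (Subtype.val ⁻¹' s)

end GraphFramework

end Framework

end GraphicMatroid

namespace GraphicMatroid

/-! ### Cocircuits and closure -/

section MatroidLemmas

variable {α : Type u} {M : Matroid α}

/-! A vertex of `G(M, Γ)` is a colouring of the cocircuits by signs, to be read as "on which side of
each cut". In a graph with a spanning tree `s`, the path in `s` between two vertices uses exactly
those `e` at whose fundamental cut the two vertices differ, and the vertices differ at a cut `b`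
according to the parity of the number of path edges in `b`. This suggests `diffSet` (the edges of
the prospective path) and `Sat` (each cocircuit meets it finitely, and the parity rule holds).
Moreover, two tree edges cut a tree into three parts, so that one of the four sign patterns at their
fundamental cuts never occurs; this is `Quad`. Colourings with both properties relative to the
end-vertices of edges are called `Reg`.

For `Reg` colourings `v` and `w`, the edges in `diffSet M s v w` and the vertices satisfying
`OnLine` form a pseudo-line. It is compact because `OnLine` passes to limits. It is connected
because crossing finitely many edges of the difference leads from any vertex to one that agrees with
a given other vertex on any finite set of cocircuits. Deleting an edge separates by means of its
fundamental cocircuit.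

It remains to see that all vertices of the hat space are `Reg`. The axioms of a framework say that a
clockwise walk around a circuit changes its sign at `b` exactly when it passes an element of `b`
(`tail_eq_head_mul`). So `Sat` and `Quad` spread over fundamental circuits, and connectedness of `M`
carries them to all end-vertices (`ground_subset`). When cocircuits exist, the edges of a
pseudo-circle form a circuit and its vertices are limits of end-vertices of that circuit (`InCl`).
Passing `Sat` to such limits requires the main combinatorial fact `finite_fundCircuit_inter`: only
finitely many elements of `s ∩ b` lie in fundamental circuits of elements of a given circuit. Those
on one side of `b` are spokes of fans whose rims are arcs of the circuit; parity of
circuit-cocircuit intersections orders the spokes linearly, and tameness excludes an infinite such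
fan.

Conversely, limits of circuits lie on pseudo-circles (`isPseudoCircle_sub`), and an inner vertex of
a line is an end-vertex or a limit of a circuit (`OnLine.exists_end_or_inCl`), so lines between
vertices of the hat space stay in it. This is (A). In (B), spanning sets contain bases, while a
non-spanning set avoids a cocircuit whose two sides disconnect the space. (C) follows because bases
are the minimal spanning sets. -/

theorem exists_isCocircuit_mem_disjoint {K : Set α} {y : α} (hK : K ⊆ M.E) (hy : y ∈ M.E)
    (h : y ∉ M.closure K) : ∃ c, M.IsCocircuit c ∧ y ∈ c ∧ Disjoint c K := by
  obtain ⟨I, hI⟩ := M.exists_isBasis K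
  have hyI : y ∉ M.closure I := by rwa [hI.closure_eq_closure]
  have hyI' : y ∉ I := fun h' => hyI (M.mem_closure_of_mem h' hI.indep.subset_ground)
  have hi : M.Indep (insert y I) := (hI.indep.insert_indep_iff_of_notMem hyI').2 ⟨hy, hyI⟩
  obtain ⟨B, hB, hIB⟩ := hi.exists_isBase_superset
  have hyB : y ∈ B := hIB (mem_insert _ _)
  refine ⟨_, hB.compl_closure_sdiff_singleton_isCocircuit hyB, ⟨hy, ?_⟩, ?_⟩
  · exact hB.indep.notMem_closure_sdiff_of_mem hyB
  · rw [disjoint_left]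
    intro z hz hzK
    refine hz.2 (M.closure_subset_closure ?_ (hI.subset_closure hzK))
    exact fun a ha => ⟨hIB (mem_insert_of_mem _ ha), fun h => hyI' (h ▸ ha)⟩

theorem mem_closure_of_forall_isCocircuit {K : Set α} {y : α} (hK : K ⊆ M.E) (hy : y ∈ M.E)
    (h : ∀ c, M.IsCocircuit c → Disjoint c K → y ∉ c) : y ∈ M.closure K := by
  by_contra hcl
  obtain ⟨c, hc, hyc, hd⟩ := exists_isCocircuit_mem_disjoint hK hy hcl
  exact h c hc hd hyc

theorem disjoint_closure_of_isCocircuit {K c : Set α} (hc : M.IsCocircuit c) (h : Disjoint c K) :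
    Disjoint c (M.closure K) := by
  rw [disjoint_left]
  intro y hyc hy
  have hyK : y ∉ K := fun h' => h.le_bot ⟨hyc, h'⟩
  obtain ⟨C, hCK, hC, hyC⟩ := M.exists_isCircuit_of_mem_closure hy hyK
  refine hC.inter_isCocircuit_ne_singleton hc (e := y) ?_
  ext z
  constructor
  · rintro ⟨hz, hzc⟩
    rcases hCK hz with rfl | hzK
    · rfl
    · exact absurd ⟨hzc, hzK⟩ (fun h' => h.le_bot h')
  · rintro rfl
    exact ⟨hyC, hyc⟩

/-- Orthogonality of circuits and cocircuits, in the form in which it is applied throughout. -/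
theorem mem_of_inter_subset_pair {C c : Set α} (hC : M.IsCircuit C) (hc : M.IsCocircuit c)
    {e f : α} (heC : e ∈ C) (hec : e ∈ c) (h : C ∩ c ⊆ {e, f}) : f ∈ C ∩ c := by
  by_contra hf
  refine hC.inter_isCocircuit_ne_singleton hc (e := e) ?_
  ext z
  constructor
  · intro hz
    rcases h hz with rfl | rfl
    · rfl
    · exact absurd hz hf
  · rintro rfl
    exact ⟨heC, hec⟩

end MatroidLemmas

/-! ### Arcs of a cyclic order -/

namespace IsCyclicOrderOn

variable {α : Type u} {X : Set α} {R : α → α → α → Prop} {a b c x y z : α}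

theorem cyclic' (hR : IsCyclicOrderOn X R) (h : R a b c) : R c a b :=
  hR.cyclic _ _ _ (hR.cyclic _ _ _ h)

theorem ne (hR : IsCyclicOrderOn X R) (h : R a b c) : a ≠ b ∧ b ≠ c ∧ a ≠ c := by
  have key : ∀ x y z, R x y z → x ≠ z := by
    rintro x y z h rfl
    exact hR.asymm _ _ _ h h
  exact ⟨(key _ _ _ (hR.cyclic _ _ _ h)).symm, (key _ _ _ (hR.cyclic' h)).symm, key _ _ _ h⟩

/-- The open arc from `a` to `c`. -/
def arc (R : α → α → α → Prop) (a c : α) : Set α := {b | R a b c}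

theorem arc_subset (hR : IsCyclicOrderOn X R) : arc R a c ⊆ X := fun _ h => (hR.mem _ _ _ h).2.1

theorem arc_split (hR : IsCyclicOrderOn X R) (h : R a b c) :
    arc R a c = arc R a b ∪ {b} ∪ arc R b c := by
  ext x
  constructor
  · intro hx
    by_cases hxb : x = b
    · exact Or.inl (Or.inr hxb)
    have hx : R a x c := hx
    have hm := hR.mem _ _ _ h
    rcases hR.total a hm.1 x (hR.mem _ _ _ hx).2.1 b hm.2.1 (hR.ne hx).1 hxb (hR.ne h).1 with h1 | h1
    · exact Or.inl (Or.inl h1)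
    · right
      have h2 := hR.trans x c a b (hR.cyclic _ _ _ hx) (hR.cyclic' (hR.cyclic' h1))
      exact hR.cyclic' h2
  · rintro ((hx | rfl) | hx)
    · exact hR.trans _ _ _ _ hx h
    · exact h
    · exact hR.cyclic _ _ _ (hR.trans _ _ _ _ (hR.cyclic' h) (hR.cyclic' hx))

theorem disjoint_arc (hR : IsCyclicOrderOn X R) (h : R a b c) :
    Disjoint (arc R a b) (arc R b c) := by
  rw [disjoint_left]
  intro x (hx : R a x b) (hy : R b x c)
  have h1 := hR.trans b x c a hy (hR.cyclic _ _ _ h)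
  exact hR.asymm _ _ _ hx h1

theorem arc_union (hR : IsCyclicOrderOn X R) (ha : a ∈ X) (hb : b ∈ X) (hab : a ≠ b) :
    X = arc R a b ∪ arc R b a ∪ {a, b} := by
  ext x
  constructor
  · intro hx
    by_cases hxa : x = a
    · exact Or.inr (Or.inl hxa)
    by_cases hxb : x = b
    · exact Or.inr (Or.inr hxb)
    rcases hR.total a ha x hx b hb (Ne.symm hxa) hxb hab with h | h
    · exact Or.inl (Or.inl h)
    · exact Or.inl (Or.inr h)
  · rintro ((h | h) | rfl | rfl)
    · exact hR.arc_subset h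
    · exact hR.arc_subset h
    · exact ha
    · exact hb

theorem exists_next (hR : IsCyclicOrderOn X R) {S : Set α} (hS : S.Finite) (hne : S.Nonempty) :
    ∃ q ∈ S, Disjoint S (arc R y q) := by
  -- An element `g` of `S` on the arc from `y` to a minimiser `q` would have a strictly smaller
  -- count.
  obtain ⟨q, hq, hmin⟩ := exists_min_image S (fun q => (S ∩ arc R y q).ncard) hS hne
  refine ⟨q, hq, ?_⟩
  by_contra hd
  obtain ⟨g, hgS, hg⟩ := not_disjoint_iff.1 hd
  have hlt : (S ∩ arc R y g).ncard < (S ∩ arc R y q).ncard := by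
    refine ncard_lt_ncard ⟨?_, fun h => ?_⟩ (hS.subset inter_subset_left)
    · rw [hR.arc_split hg]
      exact fun x hx => ⟨hx.1, Or.inl (Or.inl hx.2)⟩
    · exact (hR.ne (h ⟨hgS, hg⟩).2).2.1 rfl
  exact absurd (hmin g hgS) (not_le.2 hlt)

theorem exists_prev (hR : IsCyclicOrderOn X R) {S : Set α} (hS : S.Finite) (hne : S.Nonempty) :
    ∃ q ∈ S, Disjoint S (arc R q y) := by
  obtain ⟨q, hq, hmin⟩ := exists_min_image S (fun q => (S ∩ arc R q y).ncard) hS hne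
  refine ⟨q, hq, ?_⟩
  by_contra hd
  obtain ⟨g, hgS, hg⟩ := not_disjoint_iff.1 hd
  have hlt : (S ∩ arc R g y).ncard < (S ∩ arc R q y).ncard := by
    refine ncard_lt_ncard ⟨?_, fun h => ?_⟩ (hS.subset inter_subset_left)
    · rw [hR.arc_split hg]
      exact fun x hx => ⟨hx.1, Or.inr hx.2⟩
    · exact (hR.ne (h ⟨hgS, hg⟩).2).1 rfl
  exact absurd (hmin g hgS) (not_le.2 hlt)

end IsCyclicOrderOn

/-! ### Signs along a walk around a circuit -/

namespace GraphFramework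

variable {α : Type u} {M : Matroid α} (Γ : GraphFramework M)

/-- The cyclic order on the circuit `o`. -/
def rel (o : Set α) : α → α → α → Prop := circuitRel M Γ.c Γ.d Γ.σ o

/-- The open arc of the circuit `o` from `f` to `e`. -/
def arc (o : Set α) (f e : α) : Set α := IsCyclicOrderOn.arc (Γ.rel o) f e

open Classical in
/-- The sign at `b` of the end-vertex of `e` at which a clockwise walk around `o` leaves `e`. -/
noncomputable def head (o : Set α) (e : α) (b : Set α) : ℤˣ :=
  if e ∈ b then Γ.c o e * Γ.d b e else Γ.σ b e

open Classical in
/-- The sign at `b` of the end-vertex of `e` at which a clockwise walk around `o` enters `e`. -/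
noncomputable def tail (o : Set α) (e : α) (b : Set α) : ℤˣ :=
  if e ∈ b then -(Γ.c o e * Γ.d b e) else Γ.σ b e

variable {Γ} {o b s : Set α} {e f g : α}

theorem head_of_notMem (h : e ∉ b) : Γ.head o e b = Γ.σ b e := if_neg h

theorem tail_of_notMem (h : e ∉ b) : Γ.tail o e b = Γ.σ b e := if_neg h

theorem tail_of_mem (h : e ∈ b) : Γ.tail o e b = -Γ.head o e b := by
  rw [tail, head, if_pos h, if_pos h]

theorem tail_eq_head (h : e ∉ b) : Γ.tail o e b = Γ.head o e b := by
  rw [tail_of_notMem h, head_of_notMem h]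

theorem tail_eq_head_iff : Γ.tail o e b = Γ.head o e b ↔ e ∉ b := by
  refine ⟨fun h he => ?_, tail_eq_head⟩
  rw [tail_of_mem he] at h
  exact absurd h.symm ((by decide : ∀ u : ℤˣ, u ≠ -u) _)

theorem isCyclicOrderOn (ho : M.IsCircuit o) : IsCyclicOrderOn o (Γ.rel o) := Γ.cyclicOrder o ho

/-- The four adjacency axioms are the four cases of one statement: the walk enters `e` at the vertex
where it left `f`, as far as `b` can see. -/
theorem head_eq_tail_of_adjacent (ho : M.IsCircuit o) (hb : M.IsCocircuit b) (hs : s.Finite)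
    (hbs : b ∩ o ⊆ s) (hso : s ⊆ o) (h : ClockwiseAdjacent (Γ.rel o) s f e) :
    Γ.head o f b = Γ.tail o e b := by
  by_cases hf : f ∈ b <;> by_cases he : e ∈ b
  · rw [head, tail, if_pos hf, if_pos he]
    exact Γ.adj_mem_mem o b s f e ho hb hs hbs hso h hf he
  · rw [head, tail, if_pos hf, if_neg he]
    exact Γ.adj_mem_notMem o b s f e ho hb hs hbs hso h hf he
  · rw [head, tail, if_neg hf, if_pos he]
    rw [Γ.adj_notMem_mem o b s f e ho hb hs hbs hso h hf he, neg_neg]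
  · rw [head, tail, if_neg hf, if_neg he]
    exact Γ.adj_notMem_notMem o b s f e ho hb hs hbs hso h hf he

/-- Adjoining `f` and `e` to the finite set `b ∩ o` makes them clockwise adjacent, since no element
of `b` lies on the arc between them. -/
theorem head_eq_tail_of_disjoint (hT : IsTame M) (ho : M.IsCircuit o) (hb : M.IsCocircuit b)
    (hf : f ∈ o) (he : e ∈ o) (hfe : f ≠ e) (h : Disjoint b (Γ.arc o f e)) :
    Γ.head o f b = Γ.tail o e b := by
  have hR := Γ.isCyclicOrderOn ho
  refine head_eq_tail_of_adjacent (s := (b ∩ o) ∪ {f, e}) ho hb ?_ subset_union_left ?_ ?_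
  · exact ((hT o b ho hb).subset fun x hx => ⟨hx.2, hx.1⟩).union (by simp)
  · rintro x (hx | rfl | rfl)
    exacts [hx.2, hf, he]
  · refine ⟨by simp, by simp, hfe, ?_⟩
    rintro g (hg | rfl | rfl) hgf hge
    · rcases hR.total f hf e he g hg.2 hfe (Ne.symm hge) (Ne.symm hgf) with h1 | h1
      · exact h1
      · exact absurd (show g ∈ Γ.arc o f e from hR.cyclic' h1) (disjoint_left.1 h hg.1)
    · exact absurd rfl hgf
    · exact absurd rfl hge

theorem finite_inter_arc (hT : IsTame M) (ho : M.IsCircuit o) (hb : M.IsCocircuit b) :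
    (b ∩ Γ.arc o f e).Finite :=
  (hT o b ho hb).subset fun _ hx => ⟨(Γ.isCyclicOrderOn ho).arc_subset hx.2, hx.1⟩

/-- The sign at `b` changes once for every element of `b` that is passed on an arc. -/
theorem tail_eq_head_mul (hT : IsTame M) (ho : M.IsCircuit o) (hb : M.IsCocircuit b)
    (hf : f ∈ o) (he : e ∈ o) (hfe : f ≠ e) :
    Γ.tail o e b = Γ.head o f b * (-1) ^ (b ∩ Γ.arc o f e).ncard := by
  have hR := Γ.isCyclicOrderOn ho
  induction hn : (b ∩ Γ.arc o f e).ncard using Nat.strong_induction_on generalizing e f with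
  | _ n ih =>
    by_cases hd : Disjoint b (Γ.arc o f e)
    · rw [← hn, hd.inter_eq, ncard_empty, pow_zero, mul_one,
        head_eq_tail_of_disjoint hT ho hb hf he hfe hd]
    -- Splitting the arc at `g ∈ b` leaves two arcs with fewer elements of `b`; passing `g` itself
    -- contributes the remaining sign.
    obtain ⟨g, hgb, hg⟩ := not_disjoint_iff.1 hd
    have hgo : g ∈ o := hR.arc_subset hg
    have hne := hR.ne hg
    have hsplit : b ∩ Γ.arc o f e = (b ∩ Γ.arc o f g) ∪ ({g} ∪ (b ∩ Γ.arc o g e)) := by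
      rw [arc, hR.arc_split hg]
      ext x
      simp only [arc, mem_inter_iff, mem_union, mem_singleton_iff]
      constructor
      · rintro ⟨h1, (h2 | h2) | h2⟩ <;> tauto
      · rintro (h | rfl | h) <;> tauto
    have hfin1 : (b ∩ Γ.arc o f g).Finite := finite_inter_arc hT ho hb
    have hfin2 : (b ∩ Γ.arc o g e).Finite := finite_inter_arc hT ho hb
    have hcard : (b ∩ Γ.arc o f e).ncard =
        (b ∩ Γ.arc o f g).ncard + (1 + (b ∩ Γ.arc o g e).ncard) := by
      rw [hsplit, ncard_union_eq _ hfin1 ((finite_singleton g).union hfin2),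
        ncard_union_eq _ (finite_singleton g) hfin2, ncard_singleton]
      · rw [disjoint_singleton_left]
        exact fun h => (hR.ne h.2).1 rfl
      · rw [disjoint_left]
        rintro x ⟨-, hx⟩ (rfl | ⟨-, hx'⟩)
        · exact (hR.ne hx).2.1 rfl
        · exact disjoint_left.1 (hR.disjoint_arc hg) hx hx'
    have h1 := ih _ (by omega) hf hgo hne.1 rfl
    have h2 := ih _ (by omega) hgo he hne.2.1 rfl
    rw [h2, ← hn, hcard, pow_add, pow_add, pow_one, ← mul_assoc, ← mul_assoc, ← h1,
      tail_of_mem hgb]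
    simp

theorem σ_eq_of_disjoint (hT : IsTame M) (ho : M.IsCircuit o) (hb : M.IsCocircuit b)
    (hd : Disjoint b o) (hf : f ∈ o) (he : e ∈ o) : Γ.σ b f = Γ.σ b e := by
  by_cases hfe : f = e
  · rw [hfe]
  have h := head_eq_tail_of_disjoint (Γ := Γ) hT ho hb hf he hfe
    (hd.mono_right (Γ.isCyclicOrderOn ho).arc_subset)
  rwa [head_of_notMem fun h => disjoint_left.1 hd h hf,
    tail_of_notMem fun h => disjoint_left.1 hd h he] at h

/-- Modulo 2 every summand of `signing` is 1. This is all that is kept of the signs in the parity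
arguments on fans. -/
theorem even_ncard_inter (Γ : GraphFramework M) (hT : IsTame M) (ho : M.IsCircuit o)
    (hb : M.IsCocircuit b) : Even (o ∩ b).ncard := by
  have hfin := hT o b ho hb
  have h := Γ.signing o b ho hb
  rw [finsum_mem_eq_finite_toFinset_sum _ hfin] at h
  have h2 := congrArg (Int.cast : ℤ → ZMod 2) h
  rw [Int.cast_sum] at h2
  have hu : ∀ u : ℤˣ, ((u : ℤ) : ZMod 2) = 1 := by
    intro u
    rcases Int.units_eq_one_or u with rfl | rfl <;> decide
  simp only [Int.cast_mul, hu, mul_one, Finset.sum_const, nsmul_eq_mul, Int.cast_zero] at h2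
  rw [ncard_eq_toFinset_card _ hfin]
  exact (ZMod.natCast_eq_zero_iff_even).1 h2

end GraphFramework

/-! ### Infinite fans in a matroid -/

section MatroidLemmas

variable {α : Type u} {M : Matroid α}

/-- There is no infinite fan: a sequence `q` of elements outside of a base `β` that meets every
circuit finitely cannot have fundamental circuits that grow along infinitely many elements `x n` of
one fundamental circuit. -/
theorem false_of_increasing_fundCocircuit {β : Set α} {e : α} {x q : ℕ → α} (hβ : M.IsBase β)
    (heE : e ∈ M.E) (heβ : e ∉ β) (hxβ : ∀ n, x n ∈ β)
    (hex : ∀ n, e ∈ M.fundCocircuit (x n) β) (hqE : ∀ n, q n ∈ M.E) (hqβ : ∀ n, q n ∉ β)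
    (hqe : ∀ n, q n ≠ e) (hfin : ∀ C, M.IsCircuit C → {n | q n ∈ C}.Finite)
    (hxq : ∀ i j, q j ∈ M.fundCocircuit (x i) β ↔ i < j) : False := by
  -- Exchange all `x n` for the `q n`. The new set still spans: the fundamental circuit of `q (n +
  -- 1)` meets `range x` exactly in `x 0, …, x n`, so `x n` is recovered by induction.
  set Y : Set α := (β \ range x) ∪ range q with hY
  have hYE : Y ⊆ M.E := by
    rintro y (hy | ⟨n, rfl⟩)
    exacts [hβ.subset_ground hy.1, hqE n]
  have hsub : ∀ n, x n ∈ M.closure Y := by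
    intro n
    induction n using Nat.strong_induction_on with
    | _ n ih =>
      have hC : M.IsCircuit (M.fundCircuit (q (n + 1)) β) :=
        hβ.fundCircuit_isCircuit (hqE _) (hqβ _)
      have hxC : x n ∈ M.fundCircuit (q (n + 1)) β :=
        hβ.mem_fundCocircuit_iff_mem_fundCircuit.1 ((hxq n (n + 1)).2 (Nat.lt_succ_self n))
      have h1 := hC.mem_closure_sdiff_singleton_of_mem hxC
      rw [← M.closure_closure Y]
      refine M.closure_subset_closure ?_ h1
      rintro y ⟨hyC, hyn⟩
      rcases M.fundCircuit_subset_insert _ _ hyC with rfl | hyβ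
      · exact M.mem_closure_of_mem (Or.inr ⟨_, rfl⟩) hYE
      · by_cases hyx : y ∈ range x
        · obtain ⟨m, rfl⟩ := hyx
          have hm := (hxq m (n + 1)).1 (hβ.mem_fundCocircuit_iff_mem_fundCircuit.2 hyC)
          refine ih m ?_
          rcases Nat.lt_succ_iff_lt_or_eq.1 hm with h | rfl
          · exact h
          · exact absurd rfl hyn
        · exact M.mem_closure_of_mem (Or.inl ⟨hyβ, hyx⟩) hYE
  have hβY : β ⊆ M.closure Y := by
    intro y hy
    by_cases hyx : y ∈ range x
    · obtain ⟨m, rfl⟩ := hyx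
      exact hsub m
    · exact M.mem_closure_of_mem (Or.inl ⟨hy, hyx⟩) hYE
  have heY : e ∈ M.closure Y := by
    rw [← M.closure_closure Y]
    refine M.closure_subset_closure hβY ?_
    rwa [hβ.closure_eq]
  have heY' : e ∉ Y := by
    rintro (h | ⟨n, hn⟩)
    exacts [heβ h.1, hqe n hn]
  obtain ⟨d, hdY, hd, hed⟩ := M.exists_isCircuit_of_mem_closure heY heY'
  -- The circuit `d` contains no `q j` with `j > n`, and these are the only ones in the fundamental
  -- cocircuit of `x n`; so that cocircuit meets `d` in `e` alone.
  obtain ⟨n, hn⟩ := (hfin d hd).bddAbove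
  refine hd.inter_isCocircuit_ne_singleton (M.fundCocircuit_isCocircuit (hxβ n) hβ) (e := e) ?_
  ext y
  constructor
  · rintro ⟨hyd, hyc⟩
    rcases hdY hyd with rfl | hy | ⟨j, rfl⟩
    · rfl
    · have hyx : y ∈ ({x n} : Set α) := (M.fundCocircuit_inter_eq (hxβ n)) ▸ ⟨hyc, hy.1⟩
      exact absurd ⟨n, hyx.symm⟩ hy.2
    · exact absurd ((hxq n j).1 hyc) (not_lt.2 (hn hyd))
  · rintro rfl
    exact ⟨hed, hex n⟩

end MatroidLemmas

/-! ### The two sides of a cocircuit -/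

namespace GraphFramework

variable {α : Type u} {M : Matroid α} (Γ : GraphFramework M)

open Classical in
/-- The sign at `b` of the end-vertex `ι_e(0)`. -/
noncomputable def src (e : α) (b : Set α) : ℤˣ := if e ∈ b then -Γ.d b e else Γ.σ b e

open Classical in
/-- The sign at `b` of the end-vertex `ι_e(1)`. -/
noncomputable def tgt (e : α) (b : Set α) : ℤˣ := if e ∈ b then Γ.d b e else Γ.σ b e

open Classical in
/-- The sign at `c` of that end-vertex of `q ∈ b` that has sign `i` at `b`. -/
noncomputable def endAt (b : Set α) (i : ℤˣ) (q : α) (c : Set α) : ℤˣ :=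
  if Γ.d b q = i then Γ.tgt q c else Γ.src q c

/-- The elements off the cocircuit `b` on the side `i` of `b`. -/
def sideSet (b : Set α) (i : ℤˣ) : Set α := {x | x ∈ M.E ∧ x ∉ b ∧ Γ.σ b x = i}

variable {Γ} {o b c s w : Set α} {e f g q q' x y : α} {i : ℤˣ}

theorem head_eq : Γ.head o e = if Γ.c o e = 1 then Γ.tgt e else Γ.src e := by
  ext b
  rcases Int.units_eq_one_or (Γ.c o e) with h | h <;> simp [head, tgt, src, h]

theorem tail_eq : Γ.tail o e = if Γ.c o e = 1 then Γ.src e else Γ.tgt e := by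
  ext b
  rcases Int.units_eq_one_or (Γ.c o e) with h | h <;> simp [tail, tgt, src, h]

/-- `head` and `tail` depend on the direction in which `o` runs through `q`, `endAt` does not. This
allows end-vertices reached along different circuits to be compared. -/
theorem head_eq_endAt (hq : q ∈ b) (h : Γ.head o q b = i) : Γ.head o q c = Γ.endAt b i q c := by
  rw [head, if_pos hq] at h
  rw [head_eq, endAt]
  rcases Int.units_eq_one_or (Γ.c o q) with h' | h'
  · rw [h', one_mul] at h
    rw [if_pos h', if_pos h]
  · rw [h', neg_one_mul] at h
    rw [if_neg (by rw [h']; decide), if_neg]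
    rintro rfl
    exact absurd h.symm ((by decide : ∀ u : ℤˣ, u ≠ -u) _)

theorem tail_eq_endAt (hq : q ∈ b) (h : Γ.tail o q b = i) : Γ.tail o q c = Γ.endAt b i q c := by
  rw [tail, if_pos hq] at h
  rw [tail_eq, endAt]
  rcases Int.units_eq_one_or (Γ.c o q) with h' | h'
  · rw [h', one_mul] at h
    rw [if_pos h', if_neg]
    rintro rfl
    exact absurd h.symm ((by decide : ∀ u : ℤˣ, u ≠ -u) _)
  · rw [h', neg_one_mul, neg_neg] at h
    rw [if_neg (by rw [h']; decide), if_pos h]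

theorem src_eq_tgt_iff : Γ.src e c = Γ.tgt e c ↔ e ∉ c := by
  by_cases h : e ∈ c
  · simp only [src, tgt, h, not_true_eq_false, iff_false]
    exact (by decide : ∀ u : ℤˣ, -u ≠ u) _
  · simp [src, tgt, h]

theorem endAt_eq_endAt_neg_iff : Γ.endAt b i q c = Γ.endAt b (-i) q c ↔ q ∉ c := by
  rw [← src_eq_tgt_iff (Γ := Γ), endAt, endAt]
  have key : ∀ d i : ℤˣ, (d = i ∧ ¬ d = -i) ∨ (¬ d = i ∧ d = -i) := by decide
  rcases key (Γ.d b q) i with ⟨h1, h2⟩ | ⟨h1, h2⟩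
  · rw [if_pos h1, if_neg h2, eq_comm]
  · rw [if_neg h1, if_pos h2]

theorem arc_subset (ho : M.IsCircuit o) : Γ.arc o f e ⊆ o := (Γ.isCyclicOrderOn ho).arc_subset

theorem arc_subset_left (ho : M.IsCircuit o) (hx : x ∈ Γ.arc o f e) :
    Γ.arc o f x ⊆ Γ.arc o f e := by
  rw [arc, arc, (Γ.isCyclicOrderOn ho).arc_split hx]
  exact fun _ h => Or.inl (Or.inl h)

theorem arc_subset_right (ho : M.IsCircuit o) (hx : x ∈ Γ.arc o f e) :
    Γ.arc o x e ⊆ Γ.arc o f e := by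
  rw [arc, arc, (Γ.isCyclicOrderOn ho).arc_split hx]
  exact fun _ h => Or.inr h

theorem ne_of_mem_arc (ho : M.IsCircuit o) (hx : x ∈ Γ.arc o f e) : f ≠ x ∧ x ≠ e ∧ f ≠ e :=
  (Γ.isCyclicOrderOn ho).ne hx

theorem mem_of_mem_arc (ho : M.IsCircuit o) (hx : x ∈ Γ.arc o f e) : f ∈ o ∧ x ∈ o ∧ e ∈ o :=
  (Γ.isCyclicOrderOn ho).mem _ _ _ hx

/-- Going along an arc that avoids `c` from its start to an inner element. -/
theorem head_eq_tail_of_mem_arc (hT : IsTame M) (ho : M.IsCircuit o) (hc : M.IsCocircuit c)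
    (hx : x ∈ Γ.arc o f e) (h : ∀ y ∈ Γ.arc o f e, y ≠ x → y ∉ c) :
    Γ.head o f c = Γ.tail o x c := by
  have hm := mem_of_mem_arc ho hx
  refine head_eq_tail_of_disjoint hT ho hc hm.1 hm.2.1 (ne_of_mem_arc ho hx).1 ?_
  rw [disjoint_left]
  exact fun y hy hya => h y (arc_subset_left ho hx hya) (ne_of_mem_arc ho hya).2.1 hy

theorem head_eq_tail_of_mem_arc' (hT : IsTame M) (ho : M.IsCircuit o) (hc : M.IsCocircuit c)
    (hx : x ∈ Γ.arc o f e) (h : ∀ y ∈ Γ.arc o f e, y ≠ x → y ∉ c) :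
    Γ.head o x c = Γ.tail o e c := by
  have hm := mem_of_mem_arc ho hx
  refine head_eq_tail_of_disjoint hT ho hc hm.2.1 hm.2.2 (ne_of_mem_arc ho hx).2.1 ?_
  rw [disjoint_left]
  exact fun y hy hya => h y (arc_subset_right ho hx hya) (ne_of_mem_arc ho hya).1.symm hy

theorem arc_subset_sideSet (hT : IsTame M) (ho : M.IsCircuit o) (hb : M.IsCocircuit b)
    (hd : Disjoint b (Γ.arc o f e)) (hi : Γ.head o f b = i) : Γ.arc o f e ⊆ Γ.sideSet b i := by
  intro x hx
  have hxb : x ∉ b := fun h => disjoint_left.1 hd h hx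
  refine ⟨ho.subset_ground (arc_subset ho hx), hxb, ?_⟩
  rw [← tail_of_notMem (o := o) hxb, ← hi]
  exact (head_eq_tail_of_mem_arc hT ho hb hx fun _ hy _ h => disjoint_left.1 hd h hy).symm

theorem subset_sideSet_of_disjoint (hT : IsTame M) (ho : M.IsCircuit o) (hb : M.IsCocircuit b)
    (hd : Disjoint b o) (hx : x ∈ o) (hxi : Γ.σ b x = i) : o ⊆ Γ.sideSet b i := fun _ hy =>
  ⟨ho.subset_ground hy, fun h => disjoint_left.1 hd h hy,
    (σ_eq_of_disjoint hT ho hb hd hy hx).trans hxi⟩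

theorem disjoint_sideSet : Disjoint b (Γ.sideSet b i) :=
  disjoint_left.2 fun _ h h' => h'.2.1 h

theorem disjoint_sideSet_neg : Disjoint (Γ.sideSet b i) (Γ.sideSet b (-i)) := by
  rw [disjoint_left]
  rintro x ⟨-, -, h⟩ ⟨-, -, h'⟩
  exact (by decide : ∀ u : ℤˣ, u ≠ -u) _ (h.symm.trans h')

theorem sideSet_subset_ground : Γ.sideSet b i ⊆ M.E := fun _ h => h.1

theorem mem_sideSet_or (hx : x ∈ M.E) (hxb : x ∉ b) (i : ℤˣ) :
    x ∈ Γ.sideSet b i ∨ x ∈ Γ.sideSet b (-i) := by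
  rcases (by decide : ∀ u i : ℤˣ, u = i ∨ u = -i) (Γ.σ b x) i with h | h
  · exact Or.inl ⟨hx, hxb, h⟩
  · exact Or.inr ⟨hx, hxb, h⟩

/-- `σ_b` is constant on a circuit that avoids `b`, so no circuit can mix elements of the two sides.
-/
theorem indep_union_of_sideSet (hT : IsTame M) (hb : M.IsCocircuit b) {r : Set α}
    (hr : M.Indep r) (hri : r ⊆ Γ.sideSet b i) (hw : M.Indep w) (hwi : w ⊆ Γ.sideSet b (-i)) :
    M.Indep (r ∪ w) := by
  rw [Matroid.indep_iff_forall_subset_not_isCircuit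
    (union_subset hr.subset_ground hw.subset_ground)]
  intro C hC hCc
  have hd : Disjoint b C := by
    refine Disjoint.mono_right hC (disjoint_union_right.2 ⟨?_, ?_⟩)
    exacts [disjoint_sideSet.mono_right hri, disjoint_sideSet.mono_right hwi]
  obtain ⟨x, hx⟩ := hCc.nonempty
  rcases hC hx with h | h
  · have hCs := subset_sideSet_of_disjoint hT hCc hb hd hx (hri h).2.2
    refine hCc.not_indep (hr.subset fun y hy => ?_)
    exact (hC hy).resolve_right fun h' => disjoint_left.1 disjoint_sideSet_neg (hCs hy) (hwi h')
  · have hCs := subset_sideSet_of_disjoint hT hCc hb hd hx (hwi h).2.2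
    refine hCc.not_indep (hw.subset fun y hy => ?_)
    exact (hC hy).resolve_left fun h' => disjoint_left.1 disjoint_sideSet_neg (hri h') (hCs hy)

/-- If `c` avoids a side of `b`, then the end-vertices of the elements of `b` on that side have the
same sign at `c`. -/
theorem endAt_neg_eq (hT : IsTame M) (hb : M.IsCocircuit b)
    (hw : M.IsBasis w (Γ.sideSet b (-i))) (hc : M.IsCocircuit c) (hcw : Disjoint c w)
    (hq : q ∈ b) (hq' : q' ∈ b) : Γ.endAt b (-i) q c = Γ.endAt b (-i) q' c := by
  by_cases hqq : q = q'
  · rw [hqq]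
  obtain ⟨r, hr⟩ := M.exists_isBasis (Γ.sideSet b i) sideSet_subset_ground
  have hI : M.Indep (r ∪ w) :=
    indep_union_of_sideSet hT hb hr.indep hr.subset hw.indep hw.subset
  have hbI : Disjoint b (r ∪ w) := disjoint_union_right.2
    ⟨disjoint_sideSet.mono_right hr.subset, disjoint_sideSet.mono_right hw.subset⟩
  have hqcl : q ∉ M.closure (r ∪ w) := fun h =>
    disjoint_left.1 (disjoint_closure_of_isCocircuit hb hbI) hq h
  have hqE := hb.subset_ground hq
  have hq'E := hb.subset_ground hq'
  have hJ : M.Indep (insert q (r ∪ w)) :=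
    (hI.insert_indep_iff_of_notMem fun h => disjoint_left.1 hbI hq h).2 ⟨hqE, hqcl⟩
  -- `r ∪ w` spans everything off `b`, so by minimality of cocircuits `b` is the only cocircuit that
  -- could avoid it and contain `q'`; but `b` contains `q`.
  have hq'cl : q' ∈ M.closure (insert q (r ∪ w)) := by
    refine mem_closure_of_forall_isCocircuit hJ.subset_ground hq'E fun c' hc' hd hq'c' => ?_
    have hd1 : Disjoint c' (M.closure (r ∪ w)) :=
      disjoint_closure_of_isCocircuit hc' (hd.mono_right (subset_insert _ _))
    have hsub : c' ⊆ b := by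
      intro y hy
      by_contra hyb
      refine disjoint_left.1 hd1 hy ?_
      rcases mem_sideSet_or (Γ := Γ) (hc'.subset_ground hy) hyb i with h | h
      · exact M.closure_subset_closure subset_union_left (hr.subset_closure h)
      · exact M.closure_subset_closure subset_union_right (hw.subset_closure h)
    have heq : c' = b := Matroid.IsCircuit.eq_of_subset_isCircuit hc'.isCircuit hb.isCircuit hsub
    exact disjoint_left.1 hd (heq ▸ hq) (mem_insert _ _)
  have hq'J : q' ∉ insert q (r ∪ w) := by
    rintro (h | h)
    exacts [hqq h.symm, disjoint_left.1 hbI hq' h]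
  set C := M.fundCircuit q' (insert q (r ∪ w)) with hCdef
  have hC : M.IsCircuit C := hJ.fundCircuit_isCircuit hq'cl hq'J
  have hCsub : ∀ y ∈ C, y ∉ b → y ∈ r ∪ w := by
    intro y hy hyb
    rcases M.fundCircuit_subset_insert _ _ hy with rfl | rfl | h
    exacts [absurd hq' hyb, absurd hq hyb, h]
  have hCb : C ∩ b ⊆ {q', q} := by
    rintro y ⟨hy, hyb⟩
    rcases M.fundCircuit_subset_insert _ _ hy with rfl | rfl | h
    exacts [Or.inl rfl, Or.inr rfl, absurd h (disjoint_left.1 hbI hyb)]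
  have hq'C : q' ∈ C := M.mem_fundCircuit _ _
  have hqC : q ∈ C := (mem_of_inter_subset_pair hC hb hq'C hq' hCb).1
  -- Of the two arcs of `C` between `q` and `q'`, one runs on the side `-i`, hence inside `w`. It
  -- avoids `c` and so carries the sign at `c` from one end-vertex to the other.
  have key : ∀ p p', p ∈ C → p ∈ b → p' ∈ C → p' ∈ b → p ≠ p' → C ∩ b ⊆ {p, p'} →
      Γ.head C p b = -i → Γ.endAt b (-i) p c = Γ.endAt b (-i) p' c := by
    intro p p' hp hpb hp' hp'b hpp hsub hi
    have hd : Disjoint b (Γ.arc C p p') := by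
      rw [disjoint_left]
      intro y hyb hy
      have hne := ne_of_mem_arc hC hy
      rcases hsub ⟨arc_subset hC hy, hyb⟩ with rfl | rfl
      exacts [hne.1 rfl, hne.2.1 rfl]
    have hside := arc_subset_sideSet hT hC hb hd hi
    have hd' : Disjoint c (Γ.arc C p p') := by
      rw [disjoint_left]
      intro y hyc hy
      rcases hCsub y (arc_subset hC hy) (hside hy).2.1 with h | h
      · exact disjoint_left.1 disjoint_sideSet_neg (hr.subset h) (hside hy)
      · exact disjoint_left.1 hcw hyc h
    have h1 := head_eq_tail_of_disjoint (Γ := Γ) hT hC hb hp hp' hpp hd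
    have h2 := head_eq_tail_of_disjoint (Γ := Γ) hT hC hc hp hp' hpp hd'
    rw [← head_eq_endAt hpb hi, ← tail_eq_endAt hp'b (h1.symm.trans hi), h2]
  rcases (by decide : ∀ u i : ℤˣ, u = -i ∨ u = i) (Γ.head C q b) i with h | h
  · exact key q q' hqC hq hq'C hq' hqq (by rwa [pair_comm]) h
  · refine (key q' q hq'C hq' hqC hq (Ne.symm hqq) hCb ?_).symm
    have hd : Disjoint b (Γ.arc C q' q) := by
      rw [disjoint_left]
      intro y hyb hy
      have hne := ne_of_mem_arc hC hy
      rcases hCb ⟨arc_subset hC hy, hyb⟩ with rfl | rfl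
      exacts [hne.1 rfl, hne.2.1 rfl]
    rw [head_eq_tail_of_disjoint hT hC hb hq'C hqC (Ne.symm hqq) hd, tail_of_mem hq, h]

/-- The end-vertices of an element `x` of a circuit are joined along the circuit to end-vertices of
elements of `b`. -/
theorem exists_ends (hT : IsTame M) (ho : M.IsCircuit o) (hb : M.IsCocircuit b) (hx : x ∈ o)
    (hxi : x ∈ Γ.sideSet b i) (hne : (o ∩ b).Nonempty) :
    ∃ q ∈ o ∩ b, ∃ q' ∈ o ∩ b, ∀ c, M.IsCocircuit c →
      (∀ y ∈ o, y ≠ x → y ∈ Γ.sideSet b i → y ∉ c) →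
      Γ.head o x c = Γ.endAt b i q c ∧ Γ.tail o x c = Γ.endAt b i q' c := by
  have hR := Γ.isCyclicOrderOn ho
  have hxb : x ∉ b := hxi.2.1
  -- `q` and `q'` are the first elements of `b` met from `x` in the two directions; the arcs leading
  -- to them stay on the side `i`.
  obtain ⟨q, hq, hqd⟩ := hR.exists_next (y := x) (hT o b ho hb) hne
  obtain ⟨q', hq', hqd'⟩ := hR.exists_prev (y := x) (hT o b ho hb) hne
  have hd : Disjoint b (Γ.arc o x q) :=
    disjoint_left.2 fun y hyb hy => disjoint_left.1 hqd ⟨arc_subset ho hy, hyb⟩ hy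
  have hd' : Disjoint b (Γ.arc o q' x) :=
    disjoint_left.2 fun y hyb hy => disjoint_left.1 hqd' ⟨arc_subset ho hy, hyb⟩ hy
  have hxq : x ≠ q := fun h => hxb (h ▸ hq.2)
  have hxq' : q' ≠ x := fun h => hxb (h ▸ hq'.2)
  have h1 := head_eq_tail_of_disjoint (Γ := Γ) hT ho hb hx hq.1 hxq hd
  have h1' := head_eq_tail_of_disjoint (Γ := Γ) hT ho hb hq'.1 hx hxq' hd'
  have hxi' : Γ.head o x b = i := by rw [head_of_notMem hxb, hxi.2.2]
  have hqi : Γ.head o q' b = i := by rw [h1', tail_of_notMem hxb, hxi.2.2]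
  refine ⟨q, hq, q', hq', fun c hc h => ⟨?_, ?_⟩⟩
  · rw [← tail_eq_endAt (c := c) hq.2 (h1.symm.trans hxi')]
    refine head_eq_tail_of_disjoint hT ho hc hx hq.1 hxq (disjoint_left.2 fun y hyc hy => ?_)
    exact h y (arc_subset ho hy) (ne_of_mem_arc ho hy).1.symm
      (arc_subset_sideSet hT ho hb hd hxi' hy) hyc
  · rw [← head_eq_endAt (c := c) hq'.2 hqi]
    refine (head_eq_tail_of_disjoint hT ho hc hq'.1 hx hxq'
      (disjoint_left.2 fun y hyc hy => ?_)).symm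
    exact h y (arc_subset ho hy) (ne_of_mem_arc ho hy).2.1
      (arc_subset_sideSet hT ho hb hd' hqi hy) hyc

end GraphFramework

/-! ### Fans have finitely many spokes -/

namespace GraphFramework

variable {α : Type u} {M : Matroid α} {Γ : GraphFramework M}
variable {o b c s w β K J Q : Set α} {e f g q q' x y : α} {i : ℤˣ}

/-- The rim elements needed for `false_of_increasing_fundCocircuit` are taken from the successive
differences of the increasing sets; its finiteness condition is tameness, as all `q n` lie in `b`.
-/
theorem false_of_increasing (hT : IsTame M) (hb : M.IsCocircuit b) (hβ : M.IsBase β)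
    (hJβ : J ⊆ β) (hgE : g ∈ M.E) (hgβ : g ∉ β) (hgJ : ∀ x ∈ J, g ∈ M.fundCocircuit x β) {q : ℕ → α}
    (hqb : ∀ n, q n ∈ b) (hqβ : ∀ n, q n ∉ β) (hqg : ∀ n, q n ≠ g)
    (hlt : ∀ m n, m < n →
      {x ∈ J | q m ∈ M.fundCocircuit x β} ⊂ {x ∈ J | q n ∈ M.fundCocircuit x β}) : False := by
  have hne : ∀ n, ∃ x, x ∈ {x ∈ J | q (n + 1) ∈ M.fundCocircuit x β} ∧
      x ∉ {x ∈ J | q n ∈ M.fundCocircuit x β} :=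
    fun n => exists_of_ssubset (hlt n (n + 1) n.lt_succ_self)
  choose x hx hx' using hne
  have hmono : ∀ m n, m ≤ n →
      {x ∈ J | q m ∈ M.fundCocircuit x β} ⊆ {x ∈ J | q n ∈ M.fundCocircuit x β} := by
    intro m n h
    rcases h.lt_or_eq with h | rfl
    exacts [(hlt m n h).1, Subset.rfl]
  have hinj : Function.Injective q := by
    intro m n h
    by_contra hmn
    rcases lt_or_gt_of_ne hmn with h' | h'
    · exact (hlt m n h').ne (by rw [h])
    · exact (hlt n m h').ne (by rw [h])
  refine false_of_increasing_fundCocircuit hβ hgE hgβ (fun n => hJβ (hx n).1)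
    (fun n => hgJ _ (hx n).1) (fun n => hb.subset_ground (hqb n)) hqβ hqg (fun C hC => ?_)
    (fun i j => ⟨fun h => ?_, fun h => ?_⟩)
  · refine Finite.of_finite_image ((hT C b hC hb).subset ?_) hinj.injOn
    rintro _ ⟨n, hn, rfl⟩
    exact ⟨hn, hqb n⟩
  · by_contra hij
    exact hx' i (hmono j i (not_lt.1 hij) ⟨(hx i).1, h⟩)
  · exact (hmono (i + 1) j h (hx i)).2

/-- A fan has only finitely many spokes `Q`. -/
theorem finite_of_fan (Γ : GraphFramework M) (hT : IsTame M) (hb : M.IsCocircuit b)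
    (hs : M.IsBase s) (hQ : Q ⊆ s ∩ b) (hK : M.Indep K) (hbK : Disjoint b K) (hJK : J ⊆ K)
    (hKs : K \ J ⊆ s) (hf : f ∈ b) (hg : g ∈ b) (hfg : f ≠ g) (hfQ : f ∉ Q) (hgQ : g ∉ Q)
    (h1 : ∀ q ∈ insert g Q, ∀ c, M.IsCocircuit c → Disjoint c K → (q ∈ c ↔ f ∈ c))
    (h2 : ∀ x ∈ J, ∀ c, M.IsCocircuit c → c ∩ K = {x} → (f ∈ c ↔ g ∉ c))
    (h3 : ∀ x ∈ J, ∀ y ∈ J, x ≠ y → ∀ c, M.IsCocircuit c → ∀ c', M.IsCocircuit c' →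
      c ∩ K = {x} → c' ∩ K = {y} → f ∉ c → f ∉ c' → Γ.σ c y = Γ.σ c f → Γ.σ c' x ≠ Γ.σ c' f) :
    Q.Finite := by
  -- Picture `J` as a rim running from the foot of `f` to the foot of `g`, with the elements of `Q`
  -- attached to it as spokes. By `h1` the spokes are parallel after contraction of `K`, by `h2`
  -- each rim element separates `f` from `g`, and by `h3` two rim elements cannot each lie on the
  -- `f`-side of the other.
  by_contra hinf
  have hbE := hb.subset_ground
  have hQb : Q ⊆ b := fun x hx => (hQ hx).2
  have hindep : ∀ p ∈ b, M.Indep (insert p K) := by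
    intro p hp
    refine (hK.insert_indep_iff_of_notMem fun h => disjoint_left.1 hbK hp h).2 ⟨hbE hp, fun h => ?_⟩
    exact disjoint_left.1 (disjoint_closure_of_isCocircuit hb hbK) hp h
  have hcl : ∀ p ∈ insert f (insert g Q), ∀ p' ∈ insert f (insert g Q),
      p ∈ M.closure (insert p' K) := by
    have h1' : ∀ q ∈ insert f (insert g Q), ∀ c, M.IsCocircuit c → Disjoint c K →
        (q ∈ c ↔ f ∈ c) := by
      rintro q (rfl | hq) c hc hd
      exacts [Iff.rfl, h1 q hq c hc hd]
    have hsub : insert f (insert g Q) ⊆ b := insert_subset hf (insert_subset hg hQb)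
    intro p hp p' hp'
    refine mem_closure_of_forall_isCocircuit (hindep p' (hsub hp')).subset_ground (hbE (hsub hp))
      fun c hc hd hpc => ?_
    have hdK : Disjoint c K := hd.mono_right (subset_insert _ _)
    exact disjoint_left.1 hd ((h1' p' hp' c hc hdK).2 ((h1' p hp c hc hdK).1 hpc)) (mem_insert _ _)
  have hnotin : ∀ β, M.IsBase β → ∀ p ∈ insert f (insert g Q), insert p K ⊆ β →
      ∀ p' ∈ insert f (insert g Q), p' ≠ p → p' ∈ b → p' ∉ β := by
    intro β hβ p hp hpβ p' hp' hne hp'b hp'β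
    refine hβ.indep.notMem_closure_sdiff_of_mem hp'β (M.closure_subset_closure ?_ (hcl p' hp' p hp))
    rintro y hy
    refine ⟨hpβ hy, ?_⟩
    rintro rfl
    rcases hy with h | h
    exacts [hne h, disjoint_left.1 hbK hp'b h]
  have hcirc : ∀ β, M.IsBase β → ∀ p ∈ insert f (insert g Q), p ∈ b → insert p K ⊆ β →
      ∀ p' ∈ insert f (insert g Q), p' ≠ p → p' ∈ b →
      M.IsCircuit (M.fundCircuit p' β) ∧ M.fundCircuit p' β ⊆ insert p' (insert p K) ∧
        p ∈ M.fundCircuit p' β := by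
    intro β hβ p hp hpb hpβ p' hp' hne hp'b
    have hni : p' ∉ insert p K := by
      rintro (h | h)
      exacts [hne h, disjoint_left.1 hbK hp'b h]
    have hC := (hindep p hpb).fundCircuit_isCircuit (hcl p' hp' p hp) hni
    have hsub := M.fundCircuit_subset_insert p' (insert p K)
    have heq := hC.eq_fundCircuit_of_subset hβ.indep (hsub.trans (insert_subset_insert hpβ))
    rw [← heq]
    refine ⟨hC, hsub, (mem_of_inter_subset_pair hC hb (M.mem_fundCircuit _ _) hp'b ?_).1⟩
    rintro y ⟨hy, hyb⟩
    rcases hsub hy with h | h | h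
    exacts [Or.inl h, Or.inr h, absurd h (disjoint_left.1 hbK hyb)]
  have hfS : f ∈ insert f (insert g Q) := mem_insert _ _
  have hgS : g ∈ insert f (insert g Q) := mem_insert_of_mem _ (mem_insert _ _)
  have hQS : ∀ q ∈ Q, q ∈ insert f (insert g Q) :=
    fun q hq => mem_insert_of_mem _ (mem_insert_of_mem _ hq)
  have hneQf : ∀ q ∈ Q, q ≠ f := fun q hq h => hfQ (h ▸ hq)
  have hneQg : ∀ q ∈ Q, q ≠ g := fun q hq h => hgQ (h ▸ hq)
  have hcocirc : ∀ β, M.IsBase β → K ⊆ β → ∀ x ∈ J, M.IsCocircuit (M.fundCocircuit x β) ∧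
      M.fundCocircuit x β ∩ K = {x} := by
    intro β hβ hKβ x hx
    refine ⟨M.fundCocircuit_isCocircuit (hKβ (hJK hx)) hβ, ?_⟩
    refine subset_antisymm ?_ ?_
    · rw [← M.fundCocircuit_inter_eq (hKβ (hJK hx))]
      exact inter_subset_inter_right _ hKβ
    · rintro _ rfl
      exact ⟨M.mem_fundCocircuit _ _, hJK hx⟩
  have hpc : ∀ β, M.IsBase β → ∀ p ∈ b, insert p K ⊆ β → ∀ x ∈ J, p ∉ M.fundCocircuit x β := by
    intro β hβ p hp hpβ x hx h
    have hxβ : x ∈ β := hpβ (mem_insert_of_mem _ (hJK hx))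
    have h' : p ∈ ({x} : Set α) := (M.fundCocircuit_inter_eq hxβ) ▸ ⟨h, hpβ (mem_insert _ _)⟩
    rw [mem_singleton_iff.1 h'] at hp
    exact disjoint_left.1 hbK hp (hJK hx)
  obtain ⟨β, hβ, hfβ⟩ := (hindep f hf).exists_isBase_superset
  obtain ⟨γ, hγ, hgγ⟩ := (hindep g hg).exists_isBase_superset
  have hKβ : K ⊆ β := (subset_insert _ _).trans hfβ
  have hKγ : K ⊆ γ := (subset_insert _ _).trans hgγ
  -- The segment of the rim between the feet of `f` and `q`.
  set A : α → Set α := fun q => {x ∈ J | q ∈ M.fundCocircuit x β} with hA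
  -- The fundamental cocircuit `c` of `q` in `s` meets `K` only in `J` and omits `q'`. If the
  -- segments were equal, the fundamental circuits of `q` and `q'` would meet `c` in sets that
  -- differ by `q` alone, against parity.
  have hAne : ∀ q ∈ Q, ∀ q' ∈ Q, q ≠ q' → A q ≠ A q' := by
    intro q hq q' hq' hqq heq
    obtain ⟨hC, hCs, hfC⟩ := hcirc β hβ f hfS hf hfβ q (hQS q hq) (hneQf q hq) (hQb hq)
    obtain ⟨hC', hCs', hfC'⟩ := hcirc β hβ f hfS hf hfβ q' (hQS q' hq') (hneQf q' hq') (hQb hq')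
    set c := M.fundCocircuit q s with hc_def
    have hc : M.IsCocircuit c := M.fundCocircuit_isCocircuit (hQ hq).1 hs
    have hcs : c ∩ s = {q} := M.fundCocircuit_inter_eq (hQ hq).1
    have hmem : ∀ p, p ∈ K → p ∈ c → p ∈ J := by
      intro p hpK hpc
      by_contra hpJ
      have : p ∈ ({q} : Set α) := hcs ▸ ⟨hpc, hKs ⟨hpK, hpJ⟩⟩
      rw [mem_singleton_iff.1 this] at hpK
      exact disjoint_left.1 hbK (hQb hq) hpK
    have hq'c : q' ∉ c := fun h => hqq (show q' ∈ ({q} : Set α) from hcs ▸ ⟨h, (hQ hq').1⟩).symm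
    have hmemA : ∀ p, p ∈ J → (p ∈ M.fundCircuit q β ↔ p ∈ M.fundCircuit q' β) := by
      intro p hp
      rw [← hβ.mem_fundCocircuit_iff_mem_fundCircuit, ← hβ.mem_fundCocircuit_iff_mem_fundCircuit]
      have : p ∈ A q ↔ p ∈ A q' := by rw [heq]
      simpa [hA, hp] using this
    have hins : M.fundCircuit q β ∩ c = insert q (M.fundCircuit q' β ∩ c) := by
      ext p
      constructor
      · rintro ⟨hp, hpc⟩
        rcases hCs hp with rfl | rfl | hpK
        · exact Or.inl rfl
        · exact Or.inr ⟨hfC', hpc⟩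
        · exact Or.inr ⟨(hmemA p (hmem p hpK hpc)).1 hp, hpc⟩
      · rintro (rfl | ⟨hp, hpc⟩)
        · exact ⟨M.mem_fundCircuit _ _, M.mem_fundCocircuit _ _⟩
        · rcases hCs' hp with rfl | rfl | hpK
          · exact absurd hpc hq'c
          · exact ⟨hfC, hpc⟩
          · exact ⟨(hmemA p (hmem p hpK hpc)).2 hp, hpc⟩
    have hqn : q ∉ M.fundCircuit q' β ∩ c := by
      rintro ⟨h, -⟩
      rcases hCs' h with h | h | h
      exacts [hqq h, hneQf q hq h, disjoint_left.1 hbK (hQb hq) h]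
    have e1 := even_ncard_inter Γ hT hC hc
    have e2 := even_ncard_inter Γ hT hC' hc
    rw [hins, ncard_insert_of_notMem hqn (hT _ _ hC' hc), Nat.even_add_one] at e1
    exact e1 e2
  -- If `x ∈ A q \ A q'` and `y ∈ A q' \ A q`, the circuit of `q'` joins `y` to `f` avoiding the
  -- cocircuit of `x`, and the circuit of `q` joins `x` to `f` avoiding that of `y`; this is what
  -- `h3` forbids.
  have hchain : ∀ q ∈ Q, ∀ q' ∈ Q, A q ⊆ A q' ∨ A q' ⊆ A q := by
    intro q hq q' hq'
    by_contra hcon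
    rw [not_or, not_subset, not_subset] at hcon
    obtain ⟨⟨x, hx, hx'⟩, y, hy, hy'⟩ := hcon
    have hxy : x ≠ y := by
      rintro rfl
      exact hx' hy
    obtain ⟨hcx, hcxK⟩ := hcocirc β hβ hKβ x hx.1
    obtain ⟨hcy, hcyK⟩ := hcocirc β hβ hKβ y hy.1
    have key : ∀ q ∈ Q, ∀ x ∈ J, x ∉ A q → ∀ y ∈ A q,
        Γ.σ (M.fundCocircuit x β) y = Γ.σ (M.fundCocircuit x β) f := by
      intro q hq x hx hxA y hy
      obtain ⟨hC, hCs, hfC⟩ := hcirc β hβ f hfS hf hfβ q (hQS q hq) (hneQf q hq) (hQb hq)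
      obtain ⟨hc, hcK⟩ := hcocirc β hβ hKβ x hx
      refine σ_eq_of_disjoint hT hC hc ?_ (hβ.mem_fundCocircuit_iff_mem_fundCircuit.1 hy.2) hfC
      rw [disjoint_left]
      intro z hzc hz
      rcases hCs hz with rfl | rfl | h
      · exact hxA ⟨hx, hzc⟩
      · exact hpc β hβ z hf hfβ x hx hzc
      · have : z ∈ ({x} : Set α) := hcK ▸ ⟨hzc, h⟩
        rw [mem_singleton_iff.1 this] at hz
        exact hxA ⟨hx, hβ.mem_fundCocircuit_iff_mem_fundCircuit.2 hz⟩
    exact h3 x hx.1 y hy.1 hxy _ hcx _ hcy hcxK hcyK (hpc β hβ f hf hfβ x hx.1)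
      (hpc β hβ f hf hfβ y hy.1) (key q' hq' x hx.1 hx' y hy) (key q hq y hy.1 hy' x hx)
  -- Seen from `g` instead of `f`, the segment of `q` is the complementary one. The circuit of `q`
  -- over `γ` meets the cocircuit of `x` in a subset of `{g, x, q}` containing `g`, and parity
  -- decides between `x` and `q`.
  have hcompl : ∀ q ∈ Q, ∀ x ∈ J, (q ∈ M.fundCocircuit x γ ↔ q ∉ M.fundCocircuit x β) := by
    intro q hq x hx
    obtain ⟨hC, hCs, hgC⟩ := hcirc γ hγ g hgS hg hgγ q (hQS q hq) (hneQg q hq) (hQb hq)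
    obtain ⟨hc, hcK⟩ := hcocirc β hβ hKβ x hx
    have hgc : g ∈ M.fundCocircuit x β :=
      not_not.1 (mt (h2 x hx _ hc hcK).2 (hpc β hβ f hf hfβ x hx))
    have hsub : M.fundCircuit q γ ∩ M.fundCocircuit x β ⊆ {g, x, q} := by
      rintro y ⟨hy, hyc⟩
      rcases hCs hy with rfl | rfl | h
      · simp
      · simp
      · exact Or.inr (Or.inl (show y ∈ ({x} : Set α) from hcK ▸ ⟨hyc, h⟩))
    have hev := even_ncard_inter Γ hT hC hc
    have hxβ := M.mem_fundCocircuit x β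
    have hqq := M.mem_fundCircuit q γ
    have hxg : x ≠ g := fun h => disjoint_left.1 hbK hg (h ▸ hJK hx)
    have hxq : x ≠ q := fun h => disjoint_left.1 hbK (hQb hq) (h ▸ hJK hx)
    rw [hγ.mem_fundCocircuit_iff_mem_fundCircuit]
    constructor
    · intro hxC hqc
      have : M.fundCircuit q γ ∩ M.fundCocircuit x β = {g, x, q} := by
        refine subset_antisymm hsub ?_
        rintro y (rfl | rfl | rfl)
        exacts [⟨hgC, hgc⟩, ⟨hxC, hxβ⟩, ⟨hqq, hqc⟩]
      rw [this, ncard_insert_of_notMem, ncard_pair hxq] at hev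
      · exact absurd hev (by decide)
      · rintro (h | h)
        exacts [hxg h.symm, hneQg q hq (Eq.symm h)]
    · intro hqc
      refine (mem_of_inter_subset_pair hC hc hgC hgc fun y hy => ?_).1
      rcases hsub hy with h | h | h
      · exact Or.inl h
      · exact Or.inr h
      · rw [mem_singleton_iff.1 h] at hy
        exact absurd hy.2 hqc
  obtain ⟨q, hqQ⟩ : ∃ q : ℕ ↪ α, ∀ n, q n ∈ Q :=
    ⟨(Set.Infinite.natEmbedding Q hinf).trans (Function.Embedding.subtype _), fun n =>
      (Set.Infinite.natEmbedding Q hinf n).2⟩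
  have : IsTrans (Set α) (· ⊂ ·) := ⟨fun _ _ _ h h' => h.trans h'⟩
  -- An increasing subsequence contradicts `false_of_increasing` over `β`. Otherwise the chain
  -- property and injectivity make the segments strictly decreasing, and their complements increase
  -- over `γ`.
  obtain ⟨k, hk | hk⟩ := exists_increasing_or_nonincreasing_subseq (· ⊂ ·) (fun n => A (q n))
  · refine false_of_increasing hT hb hβ (hJK.trans hKβ) (hbE hg)
      (hnotin β hβ f hfS hfβ g hgS hfg.symm hg) (fun x hx => ?_) (fun n => hQb (hqQ (k n)))
      (fun n => hnotin β hβ f hfS hfβ _ (hQS _ (hqQ _)) (hneQf _ (hqQ _)) (hQb (hqQ _)))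
      (fun n => hneQg _ (hqQ (k n))) hk
    obtain ⟨hc, hcK⟩ := hcocirc β hβ hKβ x hx
    exact not_not.1 (mt (h2 x hx _ hc hcK).2 (hpc β hβ f hf hfβ x hx))
  · have hB : ∀ n, {x ∈ J | q (k n) ∈ M.fundCocircuit x γ} = J \ A (q (k n)) := by
      intro n
      ext x
      simp only [mem_ofPred_eq, mem_sdiff, hA]
      constructor
      · rintro ⟨hx, h⟩
        exact ⟨hx, fun h' => (hcompl _ (hqQ _) x hx).1 h h'.2⟩
      · rintro ⟨hx, h⟩
        exact ⟨hx, (hcompl _ (hqQ _) x hx).2 fun h' => h ⟨hx, h'⟩⟩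
    refine false_of_increasing hT hb hγ (hJK.trans hKγ) (hbE hf)
      (hnotin γ hγ g hgS hgγ f hfS hfg hf) (fun x hx => ?_) (fun n => hQb (hqQ (k n)))
      (fun n => hnotin γ hγ g hgS hgγ _ (hQS _ (hqQ _)) (hneQg _ (hqQ _)) (hQb (hqQ _)))
      (fun n => hneQf _ (hqQ (k n))) fun m n hmn => ?_
    · obtain ⟨hc, hcK⟩ := hcocirc γ hγ hKγ x hx
      exact (h2 x hx _ hc hcK).2 (hpc γ hγ g hg hgγ x hx)
    · rw [hB, hB]
      have hne : A (q (k n)) ≠ A (q (k m)) := hAne _ (hqQ _) _ (hqQ _) fun h =>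
        hmn.ne' (k.injective (q.injective h))
      have hss : A (q (k n)) ⊂ A (q (k m)) := by
        rcases hchain _ (hqQ (k m)) _ (hqQ (k n)) with h | h
        · exact absurd (h.ssubset_of_ne hne.symm) (hk m n hmn)
        · exact h.ssubset_of_ne hne
      obtain ⟨z, hz, hz'⟩ := exists_of_ssubset hss
      exact ⟨fun y hy => ⟨hy.1, fun h => hy.2 (hss.1 h)⟩, fun h => (h ⟨hz.1, hz'⟩).2 hz⟩

end GraphFramework

/-! ### Spokes attached to an arc of a circuit -/

namespace GraphFramework

variable {α : Type u} {M : Matroid α} {Γ : GraphFramework M}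
variable {o b c s t w β K J Q X : Set α} {e f g q q' x y : α} {i : ℤˣ}

theorem notMem_of_mem_fundCircuit (hx : x ∉ b) (hq : q ∈ b) (h : q ∈ M.fundCircuit x s) :
    x ∉ s := by
  intro hxs
  rw [M.fundCircuit_eq_of_mem hxs] at h
  exact hx (mem_singleton_iff.1 h ▸ hq)

theorem disjoint_fundCocircuit (hq : q ∈ s) (hK : K ⊆ s) (hqK : q ∉ K) :
    Disjoint (M.fundCocircuit q s) K := by
  rw [disjoint_left]
  intro y hy hyK
  have : y ∈ ({q} : Set α) := (M.fundCocircuit_inter_eq hq) ▸ ⟨hy, hK hyK⟩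
  exact hqK (mem_singleton_iff.1 this ▸ hyK)

theorem forall_notMem_of_disjoint (hd : Disjoint c (s ∩ Γ.sideSet b i)) :
    ∀ y ∈ M.fundCircuit x s, y ≠ x → y ∈ Γ.sideSet b i → y ∉ c := by
  intro y hy hyx hyi hyc
  rcases M.fundCircuit_subset_insert _ _ hy with h | h
  · exact hyx h
  · exact disjoint_left.1 hd hyc ⟨h, hyi⟩

/-- The spoke `q` is joined to `x` through `s` on the side `i`. Indeed `x` is joined there to two
elements of `b`; were neither of them `q`, both ends of `x` would have the same sign at the
fundamental cocircuit of `q`, which contains `x`. -/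
theorem endAt_eq_σ (hT : IsTame M) (hb : M.IsCocircuit b) (hs : M.IsBase s)
    (hw : M.IsBasis (s ∩ Γ.sideSet b (-i)) (Γ.sideSet b (-i))) (hqs : q ∈ s) (hqb : q ∈ b)
    (hx : x ∈ Γ.sideSet b i) (hq : q ∈ M.fundCircuit x s) (hc : M.IsCocircuit c)
    (hd : Disjoint c (s ∩ Γ.sideSet b i)) (hxc : x ∉ c) : Γ.endAt b i q c = Γ.σ c x := by
  have hxs := notMem_of_mem_fundCircuit hx.2.1 hqb hq
  have hC := hs.fundCircuit_isCircuit hx.1 hxs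
  obtain ⟨q₁, hq₁, q₂, hq₂, h⟩ := exists_ends hT hC hb (M.mem_fundCircuit _ _) hx ⟨q, hq, hqb⟩
  have hc₀ := M.fundCocircuit_isCocircuit hqs hs
  have hn : ∀ j, q ∉ s ∩ Γ.sideSet b j := fun j hj => hj.2.2.1 hqb
  have hd₀ : ∀ j, Disjoint (M.fundCocircuit q s) (s ∩ Γ.sideSet b j) :=
    fun j => disjoint_fundCocircuit hqs inter_subset_left (hn j)
  have hxc₀ : x ∈ M.fundCocircuit q s := hs.mem_fundCocircuit_iff_mem_fundCircuit.2 hq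
  have hmem : ∀ p, p ∈ M.fundCircuit x s ∩ b → p ≠ q → p ∉ M.fundCocircuit q s := by
    intro p hp hpq hpc
    have hps : p ∈ s := (M.fundCircuit_subset_insert _ _ hp.1).resolve_left fun h' =>
      hx.2.1 (h' ▸ hp.2)
    exact hpq (mem_singleton_iff.1 ((M.fundCocircuit_inter_eq hqs) ▸ ⟨hpc, hps⟩))
  have hor : q₁ = q ∨ q₂ = q := by
    by_contra hcon
    rw [not_or] at hcon
    obtain ⟨h1, h2⟩ := h _ hc₀ (forall_notMem_of_disjoint (hd₀ i))
    have e1 := (endAt_eq_endAt_neg_iff (i := i) (b := b) (Γ := Γ)).2 (hmem _ hq₁ hcon.1)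
    have e2 := (endAt_eq_endAt_neg_iff (i := i) (b := b) (Γ := Γ)).2 (hmem _ hq₂ hcon.2)
    have e3 := endAt_neg_eq hT hb hw hc₀ (hd₀ (-i)) hq₁.2 hq₂.2
    refine (tail_eq_head_iff (Γ := Γ) (o := M.fundCircuit x s)).1 ?_ hxc₀
    rw [h1, h2, e1, e2, e3]
  obtain ⟨h1, h2⟩ := h c hc (forall_notMem_of_disjoint hd)
  rcases hor with rfl | rfl
  · rw [← h1, head_of_notMem hxc]
  · rw [← h2, tail_of_notMem hxc]

/-- By `endAt_neg_eq` the ends on the side `-i` agree at `c`, so the ends on the side `i` alone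
decide membership in `c`. -/
theorem mem_iff_mem_of_endAt_eq (hT : IsTame M) (hb : M.IsCocircuit b)
    (hw : M.IsBasis w (Γ.sideSet b (-i))) (hc : M.IsCocircuit c) (hcw : Disjoint c w)
    (hq : q ∈ b) (hq' : q' ∈ b) (h : Γ.endAt b i q c = Γ.endAt b i q' c) : q ∈ c ↔ q' ∈ c := by
  rw [← not_iff_not, ← endAt_eq_endAt_neg_iff (Γ := Γ) (b := b) (i := i),
    ← endAt_eq_endAt_neg_iff (Γ := Γ) (b := b) (i := i), h, endAt_neg_eq hT hb hw hc hcw hq hq']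

theorem mem_iff_notMem_of_endAt_ne (hT : IsTame M) (hb : M.IsCocircuit b)
    (hw : M.IsBasis w (Γ.sideSet b (-i))) (hc : M.IsCocircuit c) (hcw : Disjoint c w)
    (hq : q ∈ b) (hq' : q' ∈ b) (h : Γ.endAt b i q c ≠ Γ.endAt b i q' c) : q ∈ c ↔ q' ∉ c := by
  rw [← not_iff_not, not_not, ← endAt_eq_endAt_neg_iff (Γ := Γ) (b := b) (i := i),
    ← not_iff_not, ← endAt_eq_endAt_neg_iff (Γ := Γ) (b := b) (i := i),
    endAt_neg_eq hT hb hw hc hcw hq hq']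
  exact (by decide : ∀ a b h : ℤˣ, a ≠ b → (¬ a = h ↔ b = h)) _ _ _ h

/-- The arc between consecutive elements `f`, `g` of `b` on `o` is the rim of a fan. A cocircuit
that meets the rim in one element `x` sees a walk along the rim change sign at `x` only, which gives
the separation conditions of `finite_of_fan`. -/
theorem finite_spokes_of_arc (hT : IsTame M) (hb : M.IsCocircuit b) (hs : M.IsBase s)
    (hw : M.IsBasis (s ∩ Γ.sideSet b (-i)) (Γ.sideSet b (-i))) (ho : M.IsCircuit o)
    (hf : f ∈ o ∩ b) (hg : g ∈ o ∩ b) (hfg : f ≠ g) (hd : Disjoint b (Γ.arc o f g))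
    (hi : Γ.head o f b = i) :
    {q | q ∈ s ∩ b ∧ ∃ x ∈ Γ.arc o f g, q ∈ M.fundCircuit x s}.Finite := by
  set J := Γ.arc o f g with hJ
  have hR := Γ.isCyclicOrderOn ho
  have hJi : J ⊆ Γ.sideSet b i := arc_subset_sideSet hT ho hb hd hi
  have hJindep : M.Indep J := by
    refine (ho.sdiff_singleton_indep hf.1).subset fun y hy => ⟨arc_subset ho hy, ?_⟩
    exact (ne_of_mem_arc ho hy).1.symm
  have hsE := hs.subset_ground
  have hUi : J ∪ (s ∩ Γ.sideSet b i) ⊆ Γ.sideSet b i := union_subset hJi inter_subset_right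
  -- `I` contains the rim, spans all of `s` on the side `i`, and consists of elements of `s` apart
  -- from the rim; together with `W` it plays the role of `K` in `finite_of_fan`.
  obtain ⟨I, hI, hJI⟩ := hJindep.subset_isBasis_of_subset
    (subset_union_left (t := s ∩ Γ.sideSet b i)) (hUi.trans sideSet_subset_ground)
  have hIi : I ⊆ Γ.sideSet b i := hI.subset.trans hUi
  set W := s ∩ Γ.sideSet b (-i) with hW
  have hK : M.Indep (I ∪ W) :=
    indep_union_of_sideSet hT hb hI.indep hIi hw.indep inter_subset_right
  have hbK : Disjoint b (I ∪ W) := disjoint_union_right.2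
    ⟨disjoint_sideSet.mono_right hIi, disjoint_sideSet.mono_right inter_subset_right⟩
  have hgi : Γ.tail o g b = i := by
    rw [← head_eq_tail_of_disjoint hT ho hb hf.1 hg.1 hfg hd, hi]
  have hfin : ({q | q ∈ s ∩ b ∧ ∃ x ∈ J, q ∈ M.fundCircuit x s} \ {f, g}).Finite := by
    refine finite_of_fan (J := J) Γ hT hb hs (fun q hq => hq.1.1) hK hbK
      (hJI.trans subset_union_left) ?_ hf.2 hg.2 hfg (fun h => h.2 (by simp))
      (fun h => h.2 (by simp)) ?_ ?_ ?_
    · rintro y ⟨hy | hy, hyJ⟩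
      · exact ((hI.subset hy).resolve_left hyJ).1
      · exact hy.1
    · intro q hq c hc hcK
      have hcI : Disjoint c (M.closure I) :=
        disjoint_closure_of_isCocircuit hc (hcK.mono_right subset_union_left)
      have hcU : Disjoint c (J ∪ (s ∩ Γ.sideSet b i)) := hcI.mono_right hI.subset_closure
      have hcJ : Disjoint c J := hcU.mono_right subset_union_left
      have hcW : Disjoint c W := hcK.mono_right subset_union_right
      have hqb : q ∈ b := by
        rcases hq with rfl | hq
        exacts [hg.2, hq.1.1.2]
      refine mem_iff_mem_of_endAt_eq hT hb hw hc hcW hqb hf.2 ?_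
      rcases hq with rfl | hq
      · rw [← tail_eq_endAt hg.2 hgi, ← head_eq_endAt hf.2 hi]
        exact (head_eq_tail_of_disjoint hT ho hc hf.1 hg.1 hfg hcJ).symm
      · obtain ⟨⟨hqs, hqb⟩, x, hx, hqx⟩ := hq.1
        have hxc : x ∉ c := fun h => disjoint_left.1 hcJ h hx
        rw [endAt_eq_σ hT hb hs hw hqs hqb (hJi hx) hqx hc
          (hcU.mono_right subset_union_right) hxc, ← head_eq_endAt hf.2 hi,
          ← tail_of_notMem (o := o) hxc]
        exact (head_eq_tail_of_mem_arc hT ho hc hx fun y hy _ h => disjoint_left.1 hcJ h hy).symm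
    · intro x hx c hc hcK
      have hJc : ∀ y ∈ J, y ≠ x → y ∉ c := fun y hy hyx hyc =>
        hyx (show y ∈ ({x} : Set α) from hcK ▸ ⟨hyc, Or.inl (hJI hy)⟩)
      have hcW : Disjoint c W := by
        rw [disjoint_left]
        intro y hyc hy
        have h : y ∈ ({x} : Set α) := hcK ▸ ⟨hyc, Or.inr hy⟩
        rw [mem_singleton_iff.1 h] at hy
        exact disjoint_left.1 disjoint_sideSet_neg (hJi hx) hy.2
      have hxc : x ∈ c := (show x ∈ c ∩ (I ∪ W) from hcK ▸ rfl).1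
      refine mem_iff_notMem_of_endAt_ne hT hb hw hc hcW hf.2 hg.2 ?_
      rw [← tail_eq_endAt hg.2 hgi, ← head_eq_endAt hf.2 hi,
        head_eq_tail_of_mem_arc hT ho hc hx hJc, ← head_eq_tail_of_mem_arc' hT ho hc hx hJc]
      exact fun h => tail_eq_head_iff.1 h hxc
    · have key : ∀ x ∈ J, ∀ y, y ∈ Γ.arc o x g → ∀ c, M.IsCocircuit c → c ∩ (I ∪ W) = {x} →
          f ∉ c → Γ.σ c y ≠ Γ.σ c f := by
        intro x hx y hy c hc hcK hfc heq
        have hJc : ∀ y ∈ J, y ≠ x → y ∉ c := fun y hy hyx hyc =>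
          hyx (show y ∈ ({x} : Set α) from hcK ▸ ⟨hyc, Or.inl (hJI hy)⟩)
        have hxc : x ∈ c := (show x ∈ c ∩ (I ∪ W) from hcK ▸ rfl).1
        have hyc : y ∉ c := hJc y (arc_subset_right ho hx hy) (ne_of_mem_arc ho hy).1.symm
        have h1 := head_eq_tail_of_mem_arc hT ho hc hx hJc
        have h2 : Γ.head o x c = Γ.tail o y c := by
          refine head_eq_tail_of_disjoint hT ho hc (mem_of_mem_arc ho hx).2.1
            (mem_of_mem_arc ho hy).2.1 (ne_of_mem_arc ho hy).1 (disjoint_left.2 fun z hzc hz => ?_)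
          exact hJc z (arc_subset_right ho hx (arc_subset_left ho hy hz))
            (ne_of_mem_arc ho hz).1.symm hzc
        rw [head_of_notMem hfc, ← heq, ← tail_of_notMem (o := o) hyc, ← h2] at h1
        exact tail_eq_head_iff.1 h1.symm hxc
      intro x hx y hy hxy c hc c' hc' hcK hcK' hfc hfc' h1 h2
      rcases hR.total f hf.1 x (arc_subset ho hx) y (arc_subset ho hy) (ne_of_mem_arc ho hx).1 hxy
        (ne_of_mem_arc ho hy).1 with h | h
      · refine key x hx y ?_ c hc hcK hfc h1
        have hy' : y ∈ IsCyclicOrderOn.arc (Γ.rel o) f g := hy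
        rw [hR.arc_split hx] at hy'
        rcases hy' with (h' | h') | h'
        · exact absurd (hR.cyclic _ _ _ h') (hR.asymm _ _ _ h)
        · exact absurd h' hxy.symm
        · exact h'
      · refine key y hy x ?_ c' hc' hcK' hfc' h2
        have hx' : x ∈ IsCyclicOrderOn.arc (Γ.rel o) f g := hx
        rw [hR.arc_split hy] at hx'
        rcases hx' with (h' | h') | h'
        · exact absurd h (hR.asymm _ _ _ h')
        · exact absurd h' hxy
        · exact h'
  refine (hfin.union (toFinite {f, g})).subset fun q hq => ?_
  by_cases h : q ∈ ({f, g} : Set α)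
  exacts [Or.inr h, Or.inl ⟨hq, h⟩]

end GraphFramework

/-! ### Finitely many spokes for an arbitrary circuit and base -/

namespace GraphFramework

variable {α : Type u} {M : Matroid α} {Γ : GraphFramework M}
variable {o b c s s₁ t w β K J Q X : Set α} {e f g q q' x y : α} {i : ℤˣ}

/-- The finite set `o ∩ b` cuts `o` into finitely many arcs, each with finitely many spokes. The two
elements of `b` bounding an arc are distinct because `o ∩ b` is not a singleton. -/
theorem finite_spokes (hT : IsTame M) (hb : M.IsCocircuit b) (hs : M.IsBase s)
    (hw : M.IsBasis (s ∩ Γ.sideSet b (-i)) (Γ.sideSet b (-i))) (ho : M.IsCircuit o)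
    (hne : (o ∩ b).Nonempty) :
    {q | q ∈ s ∩ b ∧ ∃ x ∈ o ∩ Γ.sideSet b i, q ∈ M.fundCircuit x s}.Finite := by
  have hfin := hT o b ho hb
  have hR := Γ.isCyclicOrderOn ho
  set S : Set (α × α) := {p | p ∈ (o ∩ b) ×ˢ (o ∩ b) ∧ p.1 ≠ p.2 ∧
    Disjoint b (Γ.arc o p.1 p.2) ∧ Γ.head o p.1 b = i} with hS
  have hSfin : S.Finite := (hfin.prod hfin).subset fun p hp => hp.1
  refine (hSfin.biUnion (t := fun p => {q | q ∈ s ∩ b ∧ ∃ x ∈ Γ.arc o p.1 p.2,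
    q ∈ M.fundCircuit x s}) fun p hp => finite_spokes_of_arc hT hb hs hw ho hp.1.1 hp.1.2
      hp.2.1 hp.2.2.1 hp.2.2.2).subset ?_
  rintro q ⟨hq, x, ⟨hxo, hxi⟩, hqx⟩
  have hxb : x ∉ b := hxi.2.1
  obtain ⟨g, hg, hgd⟩ := hR.exists_next (y := x) hfin hne
  obtain ⟨f, hf, hfd⟩ := hR.exists_prev (y := x) hfin hne
  have hxg : x ≠ g := fun h => hxb (h ▸ hg.2)
  have hfx : f ≠ x := fun h => hxb (h ▸ hf.2)
  have hfg : f ≠ g := by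
    rintro rfl
    refine ho.inter_isCocircuit_ne_singleton hb (e := f) (subset_antisymm (fun y hy => ?_) ?_)
    · have hyo : y ∈ IsCyclicOrderOn.arc (Γ.rel o) x f ∪ IsCyclicOrderOn.arc (Γ.rel o) f x
          ∪ {x, f} := (hR.arc_union hxo hf.1 hxg) ▸ hy.1
      rcases hyo with (h | h) | rfl | h
      exacts [absurd h (disjoint_left.1 hgd hy), absurd h (disjoint_left.1 hfd hy),
        absurd hy.2 hxb, h]
    · rintro _ rfl
      exact hf
  have hrel : x ∈ IsCyclicOrderOn.arc (Γ.rel o) f g := by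
    rcases hR.total f hf.1 x hxo g hg.1 hfx hxg hfg with h | h
    · exact h
    · exact absurd (hR.cyclic _ _ _ h) (disjoint_left.1 hgd hf)
  have hdfx : Disjoint b (Γ.arc o f x) :=
    disjoint_left.2 fun y hy h => disjoint_left.1 hfd ⟨arc_subset ho h, hy⟩ h
  refine mem_biUnion (x := (f, g)) ⟨⟨hf, hg⟩, hfg, ?_, ?_⟩ ⟨hq, x, hrel, hqx⟩
  · rw [arc, hR.arc_split hrel]
    refine disjoint_left.2 fun y hy h => ?_
    rcases h with (h | rfl) | h
    exacts [disjoint_left.1 hdfx hy h, hxb hy, disjoint_left.1 hgd ⟨hR.arc_subset h, hy⟩ h]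
  · rw [head_eq_tail_of_disjoint hT ho hb hf.1 hxo hfx hdfx, tail_of_notMem hxb, hxi.2.2]

/-- The fan argument needs a base that spans the side `-i` from within. Such a base can be had
without changing `s` on the side `i`. -/
theorem exists_adapted (hT : IsTame M) (hb : M.IsCocircuit b) (hs : M.IsBase s) (i : ℤˣ) :
    ∃ s₁, M.IsBase s₁ ∧ M.IsBasis (s₁ ∩ Γ.sideSet b (-i)) (Γ.sideSet b (-i)) ∧
      s₁ ∩ Γ.sideSet b i = s ∩ Γ.sideSet b i := by
  obtain ⟨w, hw⟩ := M.exists_isBasis (Γ.sideSet b (-i)) sideSet_subset_ground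
  have hI := indep_union_of_sideSet hT hb (hs.indep.inter_right (Γ.sideSet b i))
    inter_subset_right hw.indep hw.subset
  have hZE : s ∩ Γ.sideSet b i ∪ w ∪ s ∩ b ⊆ M.E :=
    union_subset hI.subset_ground (inter_subset_left.trans hs.subset_ground)
  have hZ : M.Spanning (s ∩ Γ.sideSet b i ∪ w ∪ s ∩ b) := by
    have hsub : s ⊆ M.closure (s ∩ Γ.sideSet b i ∪ w ∪ s ∩ b) := by
      intro y hy
      by_cases hyb : y ∈ b
      · exact M.mem_closure_of_mem (Or.inr ⟨hy, hyb⟩) hZE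
      rcases mem_sideSet_or (Γ := Γ) (hs.subset_ground hy) hyb i with h | h
      · exact M.mem_closure_of_mem (Or.inl (Or.inl ⟨hy, h⟩)) hZE
      · exact M.closure_subset_closure (subset_union_right.trans subset_union_left)
          (hw.subset_closure h)
    rw [Matroid.spanning_iff_ground_subset_closure hZE, ← hs.closure_eq, ← M.closure_closure (_ ∪ _)]
    exact M.closure_subset_closure hsub
  obtain ⟨s₁, hs₁, hIs, hsZ⟩ := hI.exists_isBase_subset_spanning hZ subset_union_left
  have hn : ∀ y, y ∈ Γ.sideSet b i → y ∈ Γ.sideSet b (-i) → False :=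
    fun y h h' => disjoint_left.1 disjoint_sideSet_neg h h'
  refine ⟨s₁, hs₁, ?_, ?_⟩
  · have : s₁ ∩ Γ.sideSet b (-i) = w := by
      refine subset_antisymm (fun y hy => ?_) fun y hy => ⟨hIs (Or.inr hy), hw.subset hy⟩
      rcases hsZ hy.1 with (h | h) | h
      exacts [(hn y h.2 hy.2).elim, h, absurd h.2 hy.2.2.1]
    rwa [this]
  · refine subset_antisymm (fun y hy => ?_) fun y hy => ⟨hIs (Or.inl hy), hy.2⟩
    rcases hsZ hy.1 with (h | h) | h
    exacts [h, (hn y hy.2 (hw.subset h)).elim, absurd h.2 hy.2.2.1]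

/-- An `x ∈ X` with a relevant `e` is joined, inside `s` on the side `i`, to two spokes `q`, `q'` of
`s₁`. Which `e ∈ s ∩ b` lie in the fundamental circuit of `x` then depends on the pair `(q, q')`
only: finitely many pairs, each with finitely many `e` by tameness. -/
theorem finite_of_adapted (hT : IsTame M) (hb : M.IsCocircuit b) (hs : M.IsBase s)
    (hs₁ : M.IsBase s₁) (heq : s₁ ∩ Γ.sideSet b i = s ∩ Γ.sideSet b i) (hX : X ⊆ Γ.sideSet b i)
    (hF : {q | q ∈ s₁ ∩ b ∧ ∃ x ∈ X, q ∈ M.fundCircuit x s₁}.Finite) :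
    {e | e ∈ s ∩ b ∧ ∃ x ∈ X, e ∈ M.fundCircuit x s}.Finite := by
  set F := {q | q ∈ s₁ ∩ b ∧ ∃ x ∈ X, q ∈ M.fundCircuit x s₁} with hFdef
  set S : Set (α × α) := {p | p ∈ F ×ˢ F ∧ ∃ x ∈ X, x ∉ s ∧ ∀ c, M.IsCocircuit c →
    Disjoint c (s ∩ Γ.sideSet b i) → (x ∈ c ↔ Γ.endAt b i p.1 c ≠ Γ.endAt b i p.2 c)} with hS
  have hSfin : S.Finite := (hF.prod hF).subset fun p hp => hp.1
  have hdc : ∀ e ∈ s ∩ b, Disjoint (M.fundCocircuit e s) (s ∩ Γ.sideSet b i) := fun e he =>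
    disjoint_fundCocircuit he.1 inter_subset_left fun h => h.2.2.1 he.2
  refine (hSfin.biUnion (t := fun p => {e | e ∈ s ∩ b ∧ Γ.endAt b i p.1 (M.fundCocircuit e s) ≠
    Γ.endAt b i p.2 (M.fundCocircuit e s)}) ?_).subset ?_
  · rintro p ⟨-, x, hx, hxs, h⟩
    refine (hT _ b (hs.fundCircuit_isCircuit (hX hx).1 hxs) hb).subset ?_
    rintro e ⟨he, hne⟩
    refine ⟨hs.mem_fundCocircuit_iff_mem_fundCircuit.1 ?_, he.2⟩
    exact (h _ (M.fundCocircuit_isCocircuit he.1 hs) (hdc e he)).2 hne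
  · rintro e ⟨he, x, hx, hex⟩
    have hxs := notMem_of_mem_fundCircuit (hX hx).2.1 he.2 hex
    have hxs₁ : x ∉ s₁ := fun h =>
      hxs (heq ▸ (⟨h, hX hx⟩ : x ∈ s₁ ∩ Γ.sideSet b i) : x ∈ s ∩ Γ.sideSet b i).1
    have hC := hs₁.fundCircuit_isCircuit (hX hx).1 hxs₁
    have hc := M.fundCocircuit_isCocircuit he.1 hs
    have hxc : x ∈ M.fundCocircuit e s := hs.mem_fundCocircuit_iff_mem_fundCircuit.2 hex
    have hxC := M.mem_fundCircuit x s₁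
    have hsub : ∀ y ∈ M.fundCircuit x s₁, y ≠ x → y ∈ s₁ := fun y hy hyx =>
      (M.fundCircuit_subset_insert _ _ hy).resolve_left hyx
    have hdisj : ∀ c, Disjoint c (s ∩ Γ.sideSet b i) →
        ∀ y ∈ M.fundCircuit x s₁, y ≠ x → y ∈ Γ.sideSet b i → y ∉ c := fun c hcd =>
      forall_notMem_of_disjoint (heq ▸ hcd)
    -- Otherwise this circuit would lie on the side `i`, where `s₁` and `s` agree, and would meet
    -- the fundamental cocircuit of `e` in `x` alone.
    have hne : (M.fundCircuit x s₁ ∩ b).Nonempty := by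
      by_contra hemp
      have hd : Disjoint b (M.fundCircuit x s₁) :=
        (disjoint_iff_inter_eq_empty.2 (not_nonempty_iff_eq_empty.1 hemp)).symm
      have hCi := subset_sideSet_of_disjoint hT hC hb hd hxC (hX hx).2.2
      refine hC.inter_isCocircuit_ne_singleton hc (e := x) (subset_antisymm ?_ ?_)
      · rintro y ⟨hy, hyc⟩
        by_contra hyx
        exact hdisj _ (hdc e he) y hy hyx (hCi hy) hyc
      · rintro _ rfl
        exact ⟨hxC, hxc⟩
    obtain ⟨q, hq, q', hq', h⟩ := exists_ends hT hC hb hxC (hX hx) hne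
    have hmemF : ∀ q ∈ M.fundCircuit x s₁ ∩ b, q ∈ F := fun q hq =>
      ⟨⟨hsub q hq.1 fun h' => (hX hx).2.1 (h' ▸ hq.2), hq.2⟩, x, hx, hq.1⟩
    have key : ∀ c, M.IsCocircuit c → Disjoint c (s ∩ Γ.sideSet b i) →
        (x ∈ c ↔ Γ.endAt b i q c ≠ Γ.endAt b i q' c) := by
      intro c hc hcd
      obtain ⟨h1, h2⟩ := h c hc (hdisj c hcd)
      rw [← h1, ← h2, ← not_iff_not, ← tail_eq_head_iff (Γ := Γ) (o := M.fundCircuit x s₁),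
        ne_eq, not_not, eq_comm]
    exact mem_biUnion (x := (q, q')) ⟨⟨hmemF q hq, hmemF q' hq'⟩, x, hx, hxs, key⟩
      ⟨he, (key _ hc (hdc e he)).1 hxc⟩

theorem finite_side (hT : IsTame M) (hb : M.IsCocircuit b) (hs : M.IsBase s) (ho : M.IsCircuit o)
    (hne : (o ∩ b).Nonempty) (i : ℤˣ) :
    {q | q ∈ s ∩ b ∧ ∃ x ∈ o ∩ Γ.sideSet b i, q ∈ M.fundCircuit x s}.Finite := by
  obtain ⟨s₁, hs₁, hw, heq⟩ := exists_adapted (Γ := Γ) hT hb hs i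
  exact finite_of_adapted hT hb hs hs₁ heq inter_subset_right (finite_spokes hT hb hs₁ hw ho hne)

/-- If the spokes of a circuit on one side of `b` do not all meet, then the circuit is covered by
two circuits that meet `b`. -/
theorem exists_cover (hT : IsTame M) (hb : M.IsCocircuit b) (hs : M.IsBase s)
    (hw : M.IsBasis (s ∩ Γ.sideSet b (-i)) (Γ.sideSet b (-i))) (ho : M.IsCircuit o)
    (hoi : o ⊆ Γ.sideSet b i) {q₀ q₁ : α} (hq₀ : q₀ ∈ s ∩ b) (hq₁ : q₁ ∈ s ∩ b) (hqq : q₀ ≠ q₁)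
    (h₀ : ∃ x ∈ o, q₀ ∈ M.fundCircuit x s) (h₁ : ∃ x ∈ o, q₁ ∈ M.fundCircuit x s) :
    ∃ C C', M.IsCircuit C ∧ M.IsCircuit C' ∧ (C ∩ b).Nonempty ∧ (C' ∩ b).Nonempty ∧
      o ⊆ C ∪ C' := by
  obtain ⟨e, heo⟩ := ho.nonempty
  set J := o \ {e} with hJ
  have hJi : J ⊆ Γ.sideSet b i := sdiff_subset.trans hoi
  have hUi : J ∪ (s ∩ Γ.sideSet b i) ⊆ Γ.sideSet b i := union_subset hJi inter_subset_right
  obtain ⟨I, hI, hJI⟩ := (ho.sdiff_singleton_indep heo).subset_isBasis_of_subset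
    (subset_union_left (t := s ∩ Γ.sideSet b i)) (hUi.trans sideSet_subset_ground)
  have hIi : I ⊆ Γ.sideSet b i := hI.subset.trans hUi
  set W := s ∩ Γ.sideSet b (-i) with hW
  have hK : M.Indep (I ∪ W) :=
    indep_union_of_sideSet hT hb hI.indep hIi hw.indep inter_subset_right
  have hbK : Disjoint b (I ∪ W) := disjoint_union_right.2
    ⟨disjoint_sideSet.mono_right hIi, disjoint_sideSet.mono_right inter_subset_right⟩
  -- Such a `c` also avoids `o`, so the circuit looks like a single vertex to `c`, and both spokes
  -- end there.
  have htwin : ∀ c, M.IsCocircuit c → Disjoint c (I ∪ W) → (q₀ ∈ c ↔ q₁ ∈ c) := by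
    intro c hc hcK
    have hcI : Disjoint c (M.closure I) :=
      disjoint_closure_of_isCocircuit hc (hcK.mono_right subset_union_left)
    have hcs : Disjoint c (s ∩ Γ.sideSet b i) :=
      hcI.mono_right (subset_union_right.trans hI.subset_closure)
    have hco : Disjoint c o := by
      refine hcI.mono_right (ho.subset_closure_sdiff_singleton e |>.trans ?_)
      exact M.closure_subset_closure hJI
    obtain ⟨x, hx, hqx⟩ := h₀
    obtain ⟨x', hx', hqx'⟩ := h₁
    refine mem_iff_mem_of_endAt_eq hT hb hw hc (hcK.mono_right subset_union_right) hq₀.2 hq₁.2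
      (i := i) ?_
    rw [endAt_eq_σ hT hb hs hw hq₀.1 hq₀.2 (hoi hx) hqx hc hcs (disjoint_right.1 hco hx),
      endAt_eq_σ hT hb hs hw hq₁.1 hq₁.2 (hoi hx') hqx' hc hcs (disjoint_right.1 hco hx'),
      σ_eq_of_disjoint hT ho hc hco hx hx']
  have hq₀cl : q₀ ∉ M.closure (I ∪ W) := fun h =>
    disjoint_left.1 (disjoint_closure_of_isCocircuit hb hbK) hq₀.2 h
  have hi : M.Indep (insert q₀ (I ∪ W)) :=
    (hK.insert_indep_iff_of_notMem fun h => disjoint_left.1 hbK hq₀.2 h).2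
      ⟨hb.subset_ground hq₀.2, hq₀cl⟩
  obtain ⟨β, hβ, hiβ⟩ := hi.exists_isBase_superset
  have hKβ : I ∪ W ⊆ β := (subset_insert _ _).trans hiβ
  have hq₀β : q₀ ∈ β := hiβ (mem_insert _ _)
  have hcoc : ∀ p ∈ β, p ∉ I ∪ W → (q₀ ∈ M.fundCocircuit p β ↔ q₁ ∈ M.fundCocircuit p β) :=
    fun p hp hpK => htwin _ (M.fundCocircuit_isCocircuit hp hβ) (disjoint_fundCocircuit hp hKβ hpK)
  have hq₀p : ∀ p ∈ β, q₀ ∈ M.fundCocircuit p β → q₀ = p := fun p hp h =>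
    mem_singleton_iff.1 ((M.fundCocircuit_inter_eq hp) ▸ ⟨h, hq₀β⟩)
  have hq₁β : q₁ ∉ β := fun h =>
    hqq (hq₀p _ h ((hcoc q₁ h (disjoint_left.1 hbK hq₁.2)).2 (M.mem_fundCocircuit _ _)))
  have hq₁E := hb.subset_ground hq₁.2
  have hC := hβ.fundCircuit_isCircuit hq₁E hq₁β
  have hCs : M.fundCircuit q₁ β ⊆ insert q₁ (insert q₀ (I ∪ W)) := by
    intro p hp
    rcases M.fundCircuit_subset_insert _ _ hp with rfl | hpβ
    · exact Or.inl rfl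
    by_contra hcon
    simp only [mem_insert_iff, not_or] at hcon
    exact hcon.2.1 (hq₀p p hpβ ((hcoc p hpβ hcon.2.2).2
      (hβ.mem_fundCocircuit_iff_mem_fundCircuit.2 hp))).symm
  -- Without an element of `J` the circuit would be contained in `s`.
  obtain ⟨x, hxC, hxJ⟩ : ∃ x ∈ M.fundCircuit q₁ β, x ∈ J := by
    by_contra hcon
    push Not at hcon
    refine hC.not_indep (hs.indep.subset fun y hy => ?_)
    rcases hCs hy with rfl | rfl | h | h
    · exact hq₁.1
    · exact hq₀.1
    · exact ((hI.subset h).resolve_left (hcon y hy)).1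
    · exact h.1
  have hJβ : J ⊆ β := hJI.trans (subset_union_left.trans hKβ)
  have heβ : e ∉ β := fun h => ho.not_indep (hβ.indep.subset fun y hy => by
    by_cases hye : y = e
    exacts [hye ▸ h, hJβ ⟨hy, hye⟩])
  -- As in a theta graph: the first circuit passes from one spoke to the other along one part of
  -- `o`. Exchanging `x` for `e` forces the fundamental circuit of `q₁` to take the other part.
  have hβ' : M.IsBase (insert e (β \ {x})) := by
    rw [insert_sdiff_singleton_comm (fun h : e = x => heβ (h ▸ hJβ hxJ))]
    refine hβ.isBase_insert_sdiff_of_mem_closure (M.closure_subset_closure ?_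
      (ho.mem_closure_sdiff_singleton_of_mem hxJ.1)) (Or.inr (hJβ hxJ))
    rintro y ⟨hy, hyx⟩
    refine ⟨?_, hyx⟩
    by_cases hye : y = e
    exacts [Or.inl hye, Or.inr (hJβ ⟨hy, hye⟩)]
  have hq₁β' : q₁ ∉ insert e (β \ {x}) := by
    rintro (rfl | h)
    exacts [(hoi heo).2.1 hq₁.2, hq₁β h.1]
  have hC' := hβ'.fundCircuit_isCircuit hq₁E hq₁β'
  refine ⟨_, _, hC, hC', ⟨q₁, M.mem_fundCircuit _ _, hq₁.2⟩, ⟨q₁, M.mem_fundCircuit _ _, hq₁.2⟩, ?_⟩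
  intro y hy
  by_cases hyC : y ∈ M.fundCircuit q₁ β
  · exact Or.inl hyC
  refine Or.inr (hβ'.mem_fundCocircuit_iff_mem_fundCircuit.1 ?_)
  have hyx : y ≠ x := fun h => hyC (h ▸ hxC)
  have hsub' : ∀ z ∈ o, z ≠ x → z ∈ insert e (β \ {x}) := by
    intro z hz hzx
    by_cases hze : z = e
    exacts [Or.inl hze, Or.inr ⟨hJβ ⟨hz, hze⟩, hzx⟩]
  have hyβ' := hsub' y hy hyx
  have hc := M.fundCocircuit_isCocircuit hyβ' hβ'
  have hcβ : ∀ z ∈ insert e (β \ {x}), z ∈ M.fundCocircuit y (insert e (β \ {x})) → z = y :=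
    fun z hz hzc => mem_singleton_iff.1 ((M.fundCocircuit_inter_eq hyβ') ▸ ⟨hzc, hz⟩)
  -- Orthogonality twice: the cocircuit of `y` contains `x` because it meets `o`, and then `q₁`
  -- because it meets the first circuit in `x` and not in `y`.
  have hxc := (mem_of_inter_subset_pair ho hc hy (M.mem_fundCocircuit _ _) (f := x) fun z hz => by
    by_cases hzx : z = x
    exacts [Or.inr hzx, Or.inl (hcβ z (hsub' z hz.1 hzx) hz.2)]).2
  refine (mem_of_inter_subset_pair hC hc hxC hxc (f := q₁) fun z hz => ?_).2
  by_cases hzx : z = x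
  · exact Or.inl hzx
  rcases M.fundCircuit_subset_insert _ _ hz.1 with h | h
  · exact Or.inr h
  · exact absurd hz.1 (hcβ z (Or.inr ⟨h, hzx⟩) hz.2 ▸ hyC)

/-- Only finitely many elements of a base and a cocircuit have a fundamental cocircuit that meets a
given circuit. -/
theorem finite_fundCircuit_inter (Γ : GraphFramework M) (hT : IsTame M) (hb : M.IsCocircuit b)
    (hs : M.IsBase s) (ho : M.IsCircuit o) :
    {e | e ∈ s ∩ b ∧ ∃ x ∈ o, e ∈ M.fundCircuit x s}.Finite := by
  have hside : ∀ i, {q | q ∈ s ∩ b ∧ ∃ x ∈ o ∩ Γ.sideSet b i, q ∈ M.fundCircuit x s}.Finite := by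
    intro i
    by_cases hne : (o ∩ b).Nonempty
    · exact finite_side hT hb hs ho hne i
    have hd : Disjoint b o :=
      (disjoint_iff_inter_eq_empty.2 (not_nonempty_iff_eq_empty.1 hne)).symm
    by_cases hoi : (o ∩ Γ.sideSet b i).Nonempty
    · obtain ⟨x, hx, hxi⟩ := hoi
      have hoi := subset_sideSet_of_disjoint hT ho hb hd hx hxi.2.2
      obtain ⟨s₁, hs₁, hw, heq⟩ := exists_adapted (Γ := Γ) hT hb hs i
      refine finite_of_adapted hT hb hs hs₁ heq inter_subset_right ?_
      -- As soon as there are two spokes, `exists_cover` replaces `o`, which misses `b`, by two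
      -- circuits that meet `b`.
      by_cases hsub : {q | q ∈ s₁ ∩ b ∧ ∃ x ∈ o ∩ Γ.sideSet b i, q ∈ M.fundCircuit x s₁}.Subsingleton
      · exact hsub.finite
      obtain ⟨q₀, ⟨hq₀, x₀, hx₀, h₀⟩, q₁, ⟨hq₁, x₁, hx₁, h₁⟩, hqq⟩ := not_subsingleton_iff.1 hsub
      obtain ⟨C, C', hC, hC', hCb, hCb', hcov⟩ := exists_cover hT hb hs₁ hw ho hoi hq₀ hq₁ hqq
        ⟨x₀, hx₀.1, h₀⟩ ⟨x₁, hx₁.1, h₁⟩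
      refine ((finite_side (Γ := Γ) hT hb hs₁ hC hCb i).union
        (finite_side (Γ := Γ) hT hb hs₁ hC' hCb' i)).subset ?_
      rintro q ⟨hq, x, ⟨hxo, hxi⟩, hqx⟩
      rcases hcov hxo with h | h
      exacts [Or.inl ⟨hq, x, ⟨h, hxi⟩, hqx⟩, Or.inr ⟨hq, x, ⟨h, hxi⟩, hqx⟩]
    · convert finite_empty
      ext q
      simp only [mem_ofPred_eq, mem_empty_iff_false, iff_false]
      rintro ⟨-, x, hx, -⟩
      exact hoi ⟨x, hx⟩
  refine (((hside 1).union (hside (-1))).union ((hT o b ho hb).biUnion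
    (t := fun x => M.fundCircuit x s ∩ b) fun x hx => ?_)).subset ?_
  · by_cases hxs : x ∈ s
    · rw [M.fundCircuit_eq_of_mem hxs]
      exact (finite_singleton x).inter_of_left _
    · exact hT _ _ (hs.fundCircuit_isCircuit (ho.subset_ground hx.1) hxs) hb
  · rintro q ⟨hq, x, hxo, hqx⟩
    by_cases hxb : x ∈ b
    · exact Or.inr (mem_biUnion (x := x) ⟨hxo, hxb⟩ ⟨hqx, hq.2⟩)
    · rcases mem_sideSet_or (Γ := Γ) (ho.subset_ground hxo) hxb 1 with h | h
      · exact Or.inl (Or.inl ⟨hq, x, ⟨hxo, h⟩, hqx⟩)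
      · exact Or.inl (Or.inr ⟨hq, x, ⟨hxo, h⟩, hqx⟩)

end GraphFramework

/-! ### Colourings and the paths of a base between them -/

section Connected

variable {α : Type u} {M : Matroid α} {s K b : Set α} {e x : α}

/-- The fundamental graph of a base of a connected matroid is connected. -/
theorem IsConnectedMatroid.ground_subset (hM : IsConnectedMatroid M) (hs : M.IsBase s)
    (hK : K ⊆ M.E) (hne : K.Nonempty)
    (h : ∀ x ∈ M.E, x ∉ s → ∀ y ∈ M.fundCircuit x s, y ∈ K → M.fundCircuit x s ⊆ K) :
    M.E ⊆ K := by
  by_contra hcon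
  rw [not_subset] at hcon
  -- Each fundamental circuit lies inside `K` or outside it, so `s ∩ K` and `s \ K` span the two
  -- parts and would witness a separation.
  refine hM K (M.E \ K) ⟨union_sdiff_cancel hK, disjoint_sdiff_right, hne, hcon, s ∩ K, s \ K,
    ?_, ?_, ?_⟩
  · refine (hs.indep.inter_right K).isBasis_of_subset_of_subset_closure inter_subset_right ?_
    intro y hy
    by_cases hys : y ∈ s
    · exact M.mem_closure_of_mem ⟨hys, hy⟩ (inter_subset_right.trans hK)
    have hC := hs.fundCircuit_isCircuit (hK hy) hys
    have hsub := h y (hK hy) hys y (M.mem_fundCircuit _ _) hy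
    refine M.closure_subset_closure ?_ (hC.mem_closure_sdiff_singleton_of_mem
      (M.mem_fundCircuit y s))
    rintro z ⟨hz, hzy⟩
    exact ⟨(M.fundCircuit_subset_insert _ _ hz).resolve_left hzy, hsub hz⟩
  · refine (hs.indep.sdiff K).isBasis_of_subset_of_subset_closure
      (sdiff_subset_sdiff_left hs.subset_ground) ?_
    intro y hy
    by_cases hys : y ∈ s
    · exact M.mem_closure_of_mem ⟨hys, hy.2⟩ (sdiff_subset.trans hs.subset_ground)
    have hC := hs.fundCircuit_isCircuit hy.1 hys
    refine M.closure_subset_closure ?_ (hC.mem_closure_sdiff_singleton_of_mem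
      (M.mem_fundCircuit y s))
    rintro z ⟨hz, hzy⟩
    exact ⟨(M.fundCircuit_subset_insert _ _ hz).resolve_left hzy, fun hzK =>
      hy.2 (h y hy.1 hys z hz hzK (M.mem_fundCircuit _ _))⟩
  · rwa [inter_union_sdiff]

theorem fundCircuit_inter_fundCocircuit_subset (he : e ∈ s) :
    M.fundCircuit x s ∩ M.fundCocircuit e s ⊆ {e, x} := by
  rintro y ⟨hy, hyc⟩
  rcases M.fundCircuit_subset_insert _ _ hy with h | h
  · exact Or.inr h
  · exact Or.inl (mem_singleton_iff.1 ((M.fundCocircuit_inter_eq he) ▸ ⟨hyc, h⟩))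

/-- The elements of the base `s` at whose fundamental cocircuits two colourings differ. -/
def diffSet (M : Matroid α) (s : Set α) (x y : Set α → ℤˣ) : Set α :=
  {e | e ∈ s ∧ x (M.fundCocircuit e s) ≠ y (M.fundCocircuit e s)}

/-- The difference of two colourings is determined by the values at the fundamental cocircuits of
the base `s`, as for the two ends of a path in `s`. -/
def Sat (M : Matroid α) (s : Set α) (x y : Set α → ℤˣ) : Prop :=
  ∀ b, M.IsCocircuit b → (b ∩ diffSet M s x y).Finite ∧
    x b = y b * (-1) ^ (b ∩ diffSet M s x y).ncard

variable {x y z : Set α → ℤˣ}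

theorem diffSet_subset : diffSet M s x y ⊆ s := fun _ h => h.1

theorem diffSet_comm : diffSet M s x y = diffSet M s y x := by
  ext e
  simp only [diffSet, mem_ofPred_eq, ne_comm]

theorem diffSet_self : diffSet M s x x = ∅ := by
  ext e
  simp [diffSet]

theorem mem_diffSet_trans_iff : e ∈ diffSet M s x z ↔
    (e ∈ diffSet M s x y ∧ e ∉ diffSet M s y z) ∨ (e ∈ diffSet M s y z ∧ e ∉ diffSet M s x y) := by
  simp only [diffSet, mem_ofPred_eq]
  have key : ∀ a b c : ℤˣ, a ≠ c ↔ (a ≠ b ∧ b = c) ∨ (b ≠ c ∧ a = b) := by decide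
  rw [key _ (y (M.fundCocircuit e s)) _]
  tauto

theorem neg_one_pow_ncard_symmDiff {A B : Set α} (hA : A.Finite) (hB : B.Finite) :
    (-1 : ℤˣ) ^ ((A \ B) ∪ (B \ A)).ncard = (-1) ^ A.ncard * (-1) ^ B.ncard := by
  rw [ncard_union_eq (disjoint_left.2 fun x h h' => h.2 h'.1) (hA.subset sdiff_subset)
    (hB.subset sdiff_subset), ← ncard_inter_add_ncard_sdiff_eq_ncard A B hA,
    ← ncard_inter_add_ncard_sdiff_eq_ncard B A hB, inter_comm B A, ← pow_add]
  rw [show (A ∩ B).ncard + (A \ B).ncard + ((A ∩ B).ncard + (B \ A).ncard) =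
    (A \ B).ncard + (B \ A).ncard + 2 * (A ∩ B).ncard by ring, pow_add _ _ (2 * _), pow_mul]
  simp

theorem Sat.refl (M : Matroid α) (s : Set α) (x : Set α → ℤˣ) : Sat M s x x := fun b _ => by
  simp [diffSet_self]

theorem Sat.symm (h : Sat M s x y) : Sat M s y x := fun b hb => by
  obtain ⟨h1, h2⟩ := h b hb
  rw [diffSet_comm]
  refine ⟨h1, ?_⟩
  rw [h2, mul_assoc, ← pow_add, ← two_mul, pow_mul]
  simp

/-- The differences compose by symmetric difference, under which the parities add. -/
theorem Sat.trans (h : Sat M s x y) (h' : Sat M s y z) : Sat M s x z := fun b hb => by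
  obtain ⟨h1, h2⟩ := h b hb
  obtain ⟨h1', h2'⟩ := h' b hb
  have key : b ∩ diffSet M s x z = ((b ∩ diffSet M s x y) \ (b ∩ diffSet M s y z)) ∪
      ((b ∩ diffSet M s y z) \ (b ∩ diffSet M s x y)) := by
    ext e
    simp only [mem_inter_iff, mem_union, mem_sdiff]
    rw [mem_diffSet_trans_iff (y := y)]
    tauto
  rw [key]
  refine ⟨(h1.subset sdiff_subset).union (h1'.subset sdiff_subset), ?_⟩
  rw [neg_one_pow_ncard_symmDiff h1 h1', h2, h2']
  ac_rfl

theorem diffSet_congr (hs : M.IsBase s) (h : ∀ b, M.IsCocircuit b → x b = y b) :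
    diffSet M s x z = diffSet M s y z := by
  ext e
  simp only [diffSet, mem_ofPred_eq]
  refine and_congr_right fun he => ?_
  rw [h _ (M.fundCocircuit_isCocircuit he hs)]

theorem Sat.of_eq (hs : M.IsBase s) (h : ∀ b, M.IsCocircuit b → x b = y b) : Sat M s x y :=
  fun b hb => by simp [diffSet_congr hs h, diffSet_self, h b hb]

theorem Sat.eq_of_disjoint (h : Sat M s x y) (hb : M.IsCocircuit b)
    (hd : Disjoint b (diffSet M s x y)) : x b = y b := by
  rw [(h b hb).2, hd.inter_eq, ncard_empty, pow_zero, mul_one]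

end Connected

/-! ### End-vertices satisfy the parity rule -/

namespace GraphFramework

variable {α : Type u} {M : Matroid α} (Γ : GraphFramework M)

/-- The colouring `y` never lies in the quadrant of two fundamental cocircuits that contains no
end-vertex of their two base elements. -/
def Quad (s : Set α) (y : Set α → ℤˣ) : Prop :=
  ∀ e ∈ s, ∀ f ∈ s, e ≠ f → y (M.fundCocircuit e s) = Γ.σ (M.fundCocircuit e s) f ∨
    y (M.fundCocircuit f s) = Γ.σ (M.fundCocircuit f s) e

variable {Γ} {o b s : Set α} {e f x z z' : α} {y : Set α → ℤˣ}

theorem ends_iff {p : (Set α → ℤˣ) → Prop} (o : Set α) :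
    (p (Γ.head o e) ∧ p (Γ.tail o e)) ↔ (p (Γ.src e) ∧ p (Γ.tgt e)) := by
  rw [head_eq, tail_eq]
  split_ifs
  exacts [and_comm, Iff.rfl]

theorem src_of_notMem (h : e ∉ b) : Γ.src e b = Γ.σ b e := if_neg h

theorem tgt_of_notMem (h : e ∉ b) : Γ.tgt e b = Γ.σ b e := if_neg h

theorem notMem_fundCocircuit (he : e ∈ s) (hf : f ∈ s) (h : e ≠ f) : e ∉ M.fundCocircuit f s :=
  fun h' => h (mem_singleton_iff.1 ((M.fundCocircuit_inter_eq hf) ▸ ⟨h', he⟩))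

theorem diffSet_src_tgt (hs : M.IsBase s) :
    diffSet M s (Γ.src e) (Γ.tgt e) = M.fundCircuit e s ∩ s := by
  ext g
  simp only [diffSet, mem_ofPred_eq, ne_eq, src_eq_tgt_iff, not_not, mem_inter_iff,
    hs.mem_fundCocircuit_iff_mem_fundCircuit]
  tauto

/-- The arcs of the fundamental circuit between `x` and `e` lie in `s`. The fundamental cocircuit of
a base element meets such an arc in at most that element, so the arc is the difference of its two
ends, and the parity rule is `tail_eq_head_mul`. -/
theorem sat_head_tail (hT : IsTame M) (hs : M.IsBase s) (hx : x ∈ M.E) (hxs : x ∉ s)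
    (he : e ∈ M.fundCircuit x s) (hex : e ≠ x) :
    Sat M s (Γ.tail (M.fundCircuit x s) e) (Γ.head (M.fundCircuit x s) x) ∧
      Sat M s (Γ.tail (M.fundCircuit x s) x) (Γ.head (M.fundCircuit x s) e) := by
  have hC := hs.fundCircuit_isCircuit hx hxs
  have hxC := M.mem_fundCircuit x s
  have key : ∀ p q, p ∈ M.fundCircuit x s → q ∈ M.fundCircuit x s → p ≠ q → (p = x ∨ q = x) →
      Sat M s (Γ.tail (M.fundCircuit x s) q) (Γ.head (M.fundCircuit x s) p) := by
    intro p q hp hq hpq hx'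
    have hxa : x ∉ Γ.arc (M.fundCircuit x s) p q := fun h => by
      rcases hx' with rfl | rfl
      exacts [(ne_of_mem_arc hC h).1 rfl, (ne_of_mem_arc hC h).2.1 rfl]
    have hD : diffSet M s (Γ.tail (M.fundCircuit x s) q) (Γ.head (M.fundCircuit x s) p) =
        Γ.arc (M.fundCircuit x s) p q := by
      ext g
      have hsub : ∀ hg : g ∈ s, M.fundCocircuit g s ∩ Γ.arc (M.fundCircuit x s) p q ⊆ {g} := by
        rintro hg y ⟨hyc, hy⟩
        rcases fundCircuit_inter_fundCocircuit_subset hg ⟨arc_subset hC hy, hyc⟩ with h | h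
        · exact h
        · exact absurd (mem_singleton_iff.1 h ▸ hy) hxa
      constructor
      · rintro ⟨hg, hne⟩
        rw [tail_eq_head_mul hT hC (M.fundCocircuit_isCocircuit hg hs) hp hq hpq] at hne
        by_contra hga
        refine hne ?_
        have : M.fundCocircuit g s ∩ Γ.arc (M.fundCircuit x s) p q = ∅ := by
          rw [eq_empty_iff_forall_notMem]
          intro y hy
          exact hga (mem_singleton_iff.1 (hsub hg hy) ▸ hy.2)
        rw [this, ncard_empty, pow_zero, mul_one]
      · intro hga
        have hg : g ∈ s := (M.fundCircuit_subset_insert _ _ (arc_subset hC hga)).resolve_left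
          fun h => hxa (h ▸ hga)
        refine ⟨hg, ?_⟩
        rw [tail_eq_head_mul hT hC (M.fundCocircuit_isCocircuit hg hs) hp hq hpq]
        have : M.fundCocircuit g s ∩ Γ.arc (M.fundCircuit x s) p q = {g} :=
          subset_antisymm (hsub hg) (singleton_subset_iff.2 ⟨M.mem_fundCocircuit _ _, hga⟩)
        rw [this, ncard_singleton, pow_one]
        exact (by decide : ∀ u : ℤˣ, u * -1 ≠ u) _
    intro b hb
    rw [hD]
    exact ⟨finite_inter_arc hT hC hb, tail_eq_head_mul hT hC hb hp hq hpq⟩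
  exact ⟨key x e hxC he hex.symm (Or.inl rfl), key e x he hxC hex (Or.inr rfl)⟩

theorem sat_src_tgt_of_mem (hs : M.IsBase s) (he : e ∈ s) : Sat M s (Γ.src e) (Γ.tgt e) := by
  intro b hb
  rw [diffSet_src_tgt hs, M.fundCircuit_eq_of_mem he, inter_eq_left.2 (singleton_subset_iff.2 he)]
  refine ⟨(finite_singleton e).inter_of_right b, ?_⟩
  by_cases heb : e ∈ b
  · rw [inter_eq_right.2 (singleton_subset_iff.2 heb), ncard_singleton, src, tgt, if_pos heb,
      if_pos heb]
    simp
  · rw [inter_singleton_eq_empty.2 heb, src_of_notMem heb, tgt_of_notMem heb]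
    simp

theorem sat_head_tail_iff : Sat M s (Γ.head o e) (Γ.tail o e) ↔ Sat M s (Γ.src e) (Γ.tgt e) := by
  rw [head_eq, tail_eq]
  split_ifs
  exacts [⟨Sat.symm, Sat.symm⟩, Iff.rfl]

/-- For `e ∉ s`, the rest of the fundamental circuit leads from one end of `e` to the other, through
a base element `f`. If there is no `f`, then `e` is a loop, lies in no cocircuit, and its ends
coincide. -/
theorem sat_src_tgt (hT : IsTame M) (hs : M.IsBase s) (he : e ∈ M.E) :
    Sat M s (Γ.src e) (Γ.tgt e) := by
  by_cases hes : e ∈ s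
  · exact sat_src_tgt_of_mem hs hes
  have hC := hs.fundCircuit_isCircuit he hes
  by_cases h : ∃ f ∈ M.fundCircuit e s, f ≠ e
  · obtain ⟨f, hf, hfe⟩ := h
    obtain ⟨h1, h2⟩ := sat_head_tail (Γ := Γ) hT hs he hes hf hfe
    have hfs := (M.fundCircuit_subset_insert _ _ hf).resolve_left hfe
    have h3 := sat_head_tail_iff (o := M.fundCircuit e s).2 (sat_src_tgt_of_mem (Γ := Γ) hs hfs)
    exact (sat_head_tail_iff (o := M.fundCircuit e s)).1 ((h2.trans (h3.trans h1)).symm)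
  · push Not at h
    refine Sat.of_eq hs fun b hb => src_eq_tgt_iff.2 fun heb => ?_
    refine hC.inter_isCocircuit_ne_singleton hb (e := e) (subset_antisymm ?_ ?_)
    · exact fun y hy => h y hy.1
    · rintro _ rfl
      exact ⟨M.mem_fundCircuit _ _, heb⟩

theorem sat_src_src_of_mem_fundCircuit (hT : IsTame M) (hs : M.IsBase s) (hx : x ∈ M.E)
    (hxs : x ∉ s) (hz : z ∈ M.fundCircuit x s) : Sat M s (Γ.src x) (Γ.src z) := by
  by_cases hzx : z = x
  · exact hzx ▸ Sat.refl M s _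
  have hzE : z ∈ M.E := hs.subset_ground
    ((M.fundCircuit_subset_insert _ _ hz).resolve_left hzx)
  obtain ⟨h1, -⟩ := sat_head_tail (Γ := Γ) hT hs hx hxs hz hzx
  have h2 := sat_src_tgt (Γ := Γ) hT hs hx
  have h3 := sat_src_tgt (Γ := Γ) hT hs hzE
  rw [head_eq, tail_eq] at h1
  split_ifs at h1
  all_goals first
    | exact h1.symm
    | exact h2.trans h1.symm
    | exact h1.symm.trans h3.symm
    | exact h2.trans (h1.symm.trans h3.symm)

theorem sat_src_src (hT : IsTame M) (hM : IsConnectedMatroid M) (hs : M.IsBase s) (hz : z ∈ M.E)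
    (hz' : z' ∈ M.E) : Sat M s (Γ.src z) (Γ.src z') := by
  refine (hM.ground_subset hs (K := {y | y ∈ M.E ∧ Sat M s (Γ.src z) (Γ.src y)})
    (fun _ h => h.1) ⟨z, hz, Sat.refl _ _ _⟩ ?_ hz').2
  rintro x hx hxs y hy ⟨hyE, hyz⟩ t ht
  exact ⟨(hs.fundCircuit_isCircuit hx hxs).subset_ground ht, hyz.trans
    ((sat_src_src_of_mem_fundCircuit hT hs hx hxs hy).symm.trans
      (sat_src_src_of_mem_fundCircuit hT hs hx hxs ht))⟩

end GraphFramework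

/-! ### Limits of colourings -/

section Approx

variable {α : Type u} {M : Matroid α} {s : Set α} {v x y z : Set α → ℤˣ}

/-- Within `b`, the colourings `x` and `v` can differ only on `F`. So a single `y` that agrees with
`x` at `b` and at the fundamental cocircuits of `F ∩ s` has the same difference from `v` within `b`,
and the parity rule for `y` is the one for `x`. -/
theorem Sat.of_approx (hs : M.IsBase s) (h : ∀ b, M.IsCocircuit b → ∃ F : Set α, F.Finite ∧
    ∀ B : Set (Set α), B.Finite → (∀ c ∈ B, M.IsCocircuit c) → ∃ y, Sat M s v y ∧
      (∀ c ∈ B, y c = x c) ∧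
      ∀ e ∈ s ∩ b, e ∉ F → y (M.fundCocircuit e s) = v (M.fundCocircuit e s)) :
    Sat M s v x := by
  intro b hb
  obtain ⟨F, hF, h⟩ := h b hb
  have hx : ∀ e ∈ s ∩ b, e ∉ F → x (M.fundCocircuit e s) = v (M.fundCocircuit e s) := by
    intro e he heF
    obtain ⟨y, -, h1, h2⟩ := h {M.fundCocircuit e s} (finite_singleton _) (by
      rintro _ rfl
      exact M.fundCocircuit_isCocircuit he.1 hs)
    rw [← h1 _ rfl, h2 e he heF]
  obtain ⟨y, hy, h1, h2⟩ := h (insert b ((fun e => M.fundCocircuit e s) '' (F ∩ s)))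
    (((hF.inter_of_left s).image _).insert b) (by
      rintro c (rfl | ⟨e, he, rfl⟩)
      exacts [hb, M.fundCocircuit_isCocircuit he.2 hs])
  have hD : b ∩ diffSet M s v x = b ∩ diffSet M s v y := by
    ext e
    simp only [diffSet, mem_inter_iff, mem_ofPred_eq]
    refine and_congr_right fun heb => and_congr_right fun hes => ?_
    by_cases heF : e ∈ F
    · rw [h1 _ (Or.inr ⟨e, ⟨heF, hes⟩, rfl⟩)]
    · rw [h2 e ⟨hes, heb⟩ heF, hx e ⟨hes, heb⟩ heF]
  rw [hD, ← h1 b (Or.inl rfl)]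
  exact hy b hb

theorem disjoint_fundCocircuit_fundCircuit {p t : α} (hs : M.IsBase s) (hp : p ∈ s)
    (hpC : p ∉ M.fundCircuit t s) : Disjoint (M.fundCocircuit p s) (M.fundCircuit t s) := by
  rw [disjoint_left]
  intro y hyc hy
  rcases fundCircuit_inter_fundCocircuit_subset hp ⟨hy, hyc⟩ with rfl | h
  · exact hpC hy
  · rw [mem_singleton_iff] at h
    subst h
    exact hpC (hs.mem_fundCocircuit_iff_mem_fundCircuit.1 hyc)

end Approx

/-! ### Regular colourings, limits of circuits and lines -/

namespace GraphFramework

variable {α : Type u} {M : Matroid α} (Γ : GraphFramework M)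

/-- The colouring `x` is a limit of end-vertices of elements of `o`. -/
def InCl (o : Set α) (x : Set α → ℤˣ) : Prop :=
  ∀ B : Set (Set α), B.Finite → (∀ b ∈ B, M.IsCocircuit b) →
    ∃ e ∈ o, ∃ y, (y = Γ.src e ∨ y = Γ.tgt e) ∧ ∀ b ∈ B, y b = x b

/-- The colouring `x` is related to the base `s` in the same way as all end-vertices of edges. -/
def Reg (s : Set α) (x : Set α → ℤˣ) : Prop :=
  Γ.Quad s x ∧ ∀ e ∈ M.E, Sat M s (Γ.src e) x

/-- The colourings that lie between `v` and `w` with respect to the base `s`. -/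
def OnLine (s : Set α) (v w x : Set α → ℤˣ) : Prop :=
  Γ.Quad s x ∧ Sat M s v x ∧ ∀ e ∈ s, x (M.fundCocircuit e s) = v (M.fundCocircuit e s) ∨
    x (M.fundCocircuit e s) = w (M.fundCocircuit e s)

variable {Γ} {o o' b s : Set α} {e f g z z' : α} {a v w x y : Set α → ℤˣ}

theorem InCl.mono (h : Γ.InCl o x) (ho : o ⊆ o') : Γ.InCl o' x := fun B hB hBc => by
  obtain ⟨e, he, y, hy⟩ := h B hB hBc
  exact ⟨e, ho he, y, hy⟩

theorem InCl.of_end (he : e ∈ o) (hy : y = Γ.src e ∨ y = Γ.tgt e)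
    (h : ∀ b, M.IsCocircuit b → y b = x b) : Γ.InCl o x := fun _ _ hBc =>
  ⟨e, he, y, hy, fun b hb => h b (hBc b hb)⟩

theorem InCl.exists_of_finite {S : Set (Set α)} (hS : S.Finite) (h : Γ.InCl (⋃₀ S) x) :
    ∃ o ∈ S, Γ.InCl o x := by
  by_contra hcon
  push Not at hcon
  simp only [InCl, not_forall] at hcon
  choose! B hB hBc hn using hcon
  obtain ⟨e, ⟨o, ho, heo⟩, y, hy, hyx⟩ := h (⋃ o ∈ S, B o) (hS.biUnion hB) (by
    intro b hb
    simp only [mem_iUnion] at hb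
    obtain ⟨o, ho, hb⟩ := hb
    exact hBc o ho b hb)
  exact hn o ho ⟨e, heo, y, hy, fun b hb => hyx b (mem_biUnion ho hb)⟩

theorem Quad.of_approx (hs : M.IsBase s) (h : ∀ B : Set (Set α), B.Finite →
    (∀ c ∈ B, M.IsCocircuit c) → ∃ y, Γ.Quad s y ∧ ∀ c ∈ B, y c = x c) : Γ.Quad s x := by
  intro e he f hf hef
  obtain ⟨y, hy, h⟩ := h {M.fundCocircuit e s, M.fundCocircuit f s} (toFinite _) (by
    rintro c (rfl | rfl)
    exacts [M.fundCocircuit_isCocircuit he hs, M.fundCocircuit_isCocircuit hf hs])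
  rw [← h _ (Or.inl rfl), ← h _ (Or.inr rfl)]
  exact hy e he f hf hef

/-- The arc from `e` to `z` avoids the cocircuit of `e` and contains `f`; the arc from `z` to `f`
avoids the cocircuit of `f` and contains `e`. Every end-vertex on the circuit belongs to one of
these two stretches. -/
theorem quad_of_mem_arc (hT : IsTame M) (hs : M.IsBase s) (hz : z ∈ M.E) (hzs : z ∉ s)
    (he : e ∈ s) (hf : f ∈ s) (hef : f ∈ Γ.arc (M.fundCircuit z s) e z)
    (hg : g ∈ M.fundCircuit z s) (hy : y = Γ.head (M.fundCircuit z s) g ∨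
      y = Γ.tail (M.fundCircuit z s) g) : y (M.fundCocircuit e s) = Γ.σ (M.fundCocircuit e s) f ∨
      y (M.fundCocircuit f s) = Γ.σ (M.fundCocircuit f s) e := by
  set C := M.fundCircuit z s with hCdef
  have hC : M.IsCircuit C := hs.fundCircuit_isCircuit hz hzs
  have hR := Γ.isCyclicOrderOn hC
  have hne := ne_of_mem_arc hC hef
  have hm := mem_of_mem_arc hC hef
  have hbe := M.fundCocircuit_isCocircuit he hs
  have hbf := M.fundCocircuit_isCocircuit hf hs
  have hebf : e ∉ M.fundCocircuit f s := notMem_fundCocircuit he hf hne.1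
  have hfbe : f ∉ M.fundCocircuit e s := notMem_fundCocircuit hf he hne.1.symm
  have hsub : ∀ p ∈ s, ∀ t ∈ C, t ≠ p → t ≠ z → t ∉ M.fundCocircuit p s := by
    intro p hp t ht htp htz htc
    rcases fundCircuit_inter_fundCocircuit_subset hp ⟨ht, htc⟩ with h | h
    exacts [htp h, htz h]
  have hexf : e ∈ Γ.arc C z f := hR.cyclic' hef
  have hd1 : ∀ t ∈ Γ.arc C e z, t ∉ M.fundCocircuit e s := fun t ht =>
    hsub e he t (arc_subset hC ht) (ne_of_mem_arc hC ht).1.symm (ne_of_mem_arc hC ht).2.1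
  have hd2 : ∀ t ∈ Γ.arc C z f, t ∉ M.fundCocircuit f s := fun t ht =>
    hsub f hf t (arc_subset hC ht) (ne_of_mem_arc hC ht).2.1 (ne_of_mem_arc hC ht).1.symm
  have h1 := head_eq_tail_of_mem_arc hT hC hbf hexf fun t ht _ => hd2 t ht
  have h2 := head_eq_tail_of_mem_arc' hT hC hbe hef fun t ht _ => hd1 t ht
  have h3 := head_eq_tail_of_mem_arc hT hC hbe hef fun t ht _ => hd1 t ht
  rw [tail_of_notMem hebf] at h1
  rw [head_of_notMem hfbe] at h2
  rw [tail_of_notMem hfbe] at h3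
  have hval : ∀ c, g ∉ c → y c = Γ.σ c g := fun c hgc => by
    rcases hy with rfl | rfl
    exacts [head_of_notMem hgc, tail_of_notMem hgc]
  by_cases hge : g = e
  · exact Or.inr (hge ▸ hval _ (hge ▸ hebf))
  by_cases hgf : g = f
  · exact Or.inl (hgf ▸ hval _ (hgf ▸ hfbe))
  have hgC : g ∈ IsCyclicOrderOn.arc (Γ.rel C) e z ∪ IsCyclicOrderOn.arc (Γ.rel C) z e ∪ {e, z} :=
    (hR.arc_union hm.1 hm.2.2 hne.2.2) ▸ hg
  rcases hgC with (h | h) | h | h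
  · have hgbe := hd1 g h
    left
    rw [hval _ hgbe, ← tail_of_notMem (o := C) hgbe, ← h3]
    exact (head_eq_tail_of_mem_arc hT hC hbe h fun t ht _ => hd1 t ht).symm
  · have hsub' : Γ.arc C z e ⊆ Γ.arc C z f := arc_subset_left hC hexf
    have hgbf := hd2 g (hsub' h)
    right
    rw [hval _ hgbf, ← tail_of_notMem (o := C) hgbf, ← h1]
    exact (head_eq_tail_of_mem_arc hT hC hbf h fun t ht _ => hd2 t (hsub' ht)).symm
  · exact absurd h hge
  · rw [mem_singleton_iff] at h
    subst h
    rcases hy with rfl | rfl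
    exacts [Or.inr h1, Or.inl h2.symm]

/-- For fixed `e`, `f` the property spreads from `e` over fundamental circuits `C`. If `e` or `f` is
not in `C`, its fundamental cocircuit avoids `C` and has constant sign there; if both are in `C`,
`quad_of_mem_arc` applies. -/
theorem quad_end (hT : IsTame M) (hM : IsConnectedMatroid M) (hs : M.IsBase s) (hz : z ∈ M.E) :
    Γ.Quad s (Γ.src z) ∧ Γ.Quad s (Γ.tgt z) := by
  have main : ∀ e ∈ s, ∀ f ∈ s, e ≠ f → ∀ y, (y = Γ.src z ∨ y = Γ.tgt z) →
      (y (M.fundCocircuit e s) = Γ.σ (M.fundCocircuit e s) f ∨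
      y (M.fundCocircuit f s) = Γ.σ (M.fundCocircuit f s) e) := by
    intro e he f hf hef
    set p : (Set α → ℤˣ) → Prop := fun y => y (M.fundCocircuit e s) = Γ.σ (M.fundCocircuit e s) f ∨
      y (M.fundCocircuit f s) = Γ.σ (M.fundCocircuit f s) e with hp
    have hK := hM.ground_subset hs (K := {z | z ∈ M.E ∧ p (Γ.src z) ∧ p (Γ.tgt z)})
      (fun _ h => h.1) ⟨e, hs.subset_ground he, ?_⟩ ?_ hz
    · rintro y (rfl | rfl)
      exacts [hK.2.1, hK.2.2]
    · have := notMem_fundCocircuit (M := M) he hf hef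
      exact ⟨Or.inr (src_of_notMem this), Or.inr (tgt_of_notMem this)⟩
    rintro x hx hxs t ht ⟨-, htp⟩ g hg
    have hC := hs.fundCircuit_isCircuit hx hxs
    refine ⟨hC.subset_ground hg, (ends_iff (M.fundCircuit x s)).1 ?_⟩
    have hval : ∀ q ∈ s, q ∉ M.fundCircuit x s → ∀ t ∈ M.fundCircuit x s,
        Γ.head (M.fundCircuit x s) g (M.fundCocircuit q s) = Γ.σ (M.fundCocircuit q s) t ∧
        Γ.tail (M.fundCircuit x s) g (M.fundCocircuit q s) = Γ.σ (M.fundCocircuit q s) t := by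
      intro q hq hqC t ht
      have hd := disjoint_fundCocircuit_fundCircuit hs hq hqC
      have hgn : g ∉ M.fundCocircuit q s := fun h => disjoint_left.1 hd h hg
      rw [head_of_notMem hgn, tail_of_notMem hgn,
        σ_eq_of_disjoint hT hC (M.fundCocircuit_isCocircuit hq hs) hd hg ht]
      exact ⟨rfl, rfl⟩
    by_cases heC : e ∈ M.fundCircuit x s <;> by_cases hfC : f ∈ M.fundCircuit x s
    · have hex : e ≠ x := fun h => hxs (h ▸ he)
      have hfx : f ≠ x := fun h => hxs (h ▸ hf)
      rcases (Γ.isCyclicOrderOn hC).total e heC f hfC x (M.mem_fundCircuit _ _) hef hfx hex with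
        h | h
      · exact ⟨quad_of_mem_arc hT hs hx hxs he hf h hg (Or.inl rfl),
          quad_of_mem_arc hT hs hx hxs he hf h hg (Or.inr rfl)⟩
      · have h' : e ∈ Γ.arc (M.fundCircuit x s) f x := (Γ.isCyclicOrderOn hC).cyclic _ _ _ h
        exact ⟨(quad_of_mem_arc hT hs hx hxs hf he h' hg (Or.inl rfl)).symm,
          (quad_of_mem_arc hT hs hx hxs hf he h' hg (Or.inr rfl)).symm⟩
    · obtain ⟨h1, h2⟩ := hval f hf hfC e heC
      exact ⟨Or.inr h1, Or.inr h2⟩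
    · obtain ⟨h1, h2⟩ := hval e he heC f hfC
      exact ⟨Or.inl h1, Or.inl h2⟩
    · obtain ⟨h1, h2⟩ := hval f hf hfC t ht
      obtain ⟨h3, h4⟩ := hval e he heC t ht
      have e1 : t ∉ M.fundCocircuit e s := fun h => disjoint_left.1 (disjoint_fundCocircuit_fundCircuit hs he heC) h ht
      have e2 : t ∉ M.fundCocircuit f s := fun h => disjoint_left.1 (disjoint_fundCocircuit_fundCircuit hs hf hfC) h ht
      have h5 := htp.1
      simp only [hp, src_of_notMem e1, src_of_notMem e2] at h5
      exact ⟨by simpa only [hp, h1, h3] using h5, by simpa only [hp, h2, h4] using h5⟩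
  exact ⟨fun e he f hf hef => main e he f hf hef _ (Or.inl rfl),
    fun e he f hf hef => main e he f hf hef _ (Or.inr rfl)⟩

theorem reg_end (hT : IsTame M) (hM : IsConnectedMatroid M) (hs : M.IsBase s) (hz : z ∈ M.E)
    (hy : y = Γ.src z ∨ y = Γ.tgt z) : Γ.Reg s y := by
  rcases hy with rfl | rfl
  · exact ⟨(quad_end hT hM hs hz).1, fun e he => sat_src_src hT hM hs he hz⟩
  · exact ⟨(quad_end hT hM hs hz).2, fun e he =>
      (sat_src_src hT hM hs he hz).trans (sat_src_tgt hT hs hz)⟩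

theorem Reg.sat (hx : Γ.Reg s x) (hy : Γ.Reg s y) (he : e ∈ M.E) : Sat M s x y :=
  (hx.2 e he).symm.trans (hy.2 e he)

theorem end_eq_σ (hy : y = Γ.src z ∨ y = Γ.tgt z) (hz : z ∉ b) : y b = Γ.σ b z := by
  rcases hy with rfl | rfl
  exacts [src_of_notMem hz, tgt_of_notMem hz]

theorem exists_end_eq (Γ : GraphFramework M) (hz : z ∈ b) (i : ℤˣ) :
    ∃ y, (y = Γ.src z ∨ y = Γ.tgt z) ∧ y b = i := by
  have h := (src_eq_tgt_iff (Γ := Γ) (e := z) (c := b)).not.2 (not_not.2 hz)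
  rcases (by decide : ∀ p q i : ℤˣ, p ≠ q → p = i ∨ q = i) _ _ i h with h | h
  exacts [⟨_, Or.inl rfl, h⟩, ⟨_, Or.inr rfl, h⟩]

theorem reg_of_inCl (hT : IsTame M) (hM : IsConnectedMatroid M) (hs : M.IsBase s)
    (ho : M.IsCircuit o) (hx : Γ.InCl o x) : Γ.Reg s x := by
  obtain ⟨z₀, hz₀⟩ := ho.nonempty
  have hz₀E := ho.subset_ground hz₀
  have hsat : Sat M s (Γ.src z₀) x := by
    -- Outside this finite set, the fundamental cocircuits of elements of `s ∩ b` avoid `o`, so all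
    -- end-vertices of elements of `o` agree there.
    refine Sat.of_approx hs fun b hb => ⟨_, finite_fundCircuit_inter Γ hT hb hs ho, ?_⟩
    intro B hB hBc
    obtain ⟨e, he, y, hy, hyx⟩ := hx B hB hBc
    have hr₀ := reg_end hT hM hs hz₀E (Γ := Γ) (Or.inl rfl)
    have hr := reg_end hT hM hs (ho.subset_ground he) hy
    refine ⟨y, hr₀.sat hr hz₀E, hyx, fun g hg hgF => ?_⟩
    have hd : Disjoint (M.fundCocircuit g s) o := by
      rw [disjoint_left]
      exact fun t htc ht => hgF ⟨hg, t, ht, hs.mem_fundCocircuit_iff_mem_fundCircuit.1 htc⟩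
    rw [end_eq_σ hy fun h => disjoint_left.1 hd h he,
      src_of_notMem fun h => disjoint_left.1 hd h hz₀,
      σ_eq_of_disjoint hT ho (M.fundCocircuit_isCocircuit hg.1 hs) hd he hz₀]
  refine ⟨Quad.of_approx hs fun B hB hBc => ?_, fun e he =>
    (sat_src_src hT hM hs he hz₀E).trans hsat⟩
  obtain ⟨e, he, y, hy, hyx⟩ := hx B hB hBc
  exact ⟨y, (reg_end hT hM hs (ho.subset_ground he) hy).1, hyx⟩

/-- Between two colourings there is an end-vertex of every element of their difference. -/
theorem diffSet_end_subset (hx : Γ.Quad s x) (hy : Γ.Quad s y) (he : e ∈ diffSet M s x y)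
    (hv : v = Γ.src e ∨ v = Γ.tgt e)
    (hve : v (M.fundCocircuit e s) = y (M.fundCocircuit e s)) :
    diffSet M s v y ⊆ diffSet M s x y \ {e} := by
  rintro f ⟨hf, hne⟩
  have hfe : f ≠ e := fun h => hne (h ▸ hve)
  refine ⟨⟨hf, ?_⟩, hfe⟩
  rw [end_eq_σ hv (notMem_fundCocircuit he.1 hf hfe.symm)] at hne
  -- `y` is not on the side of `e` at the cocircuit of `f`, so it is on the side of `f` at the
  -- cocircuit of `e`. Then `x` is not, and so `x` agrees with `v` at the cocircuit of `f`.
  have h1 := (hy e he.1 f hf hfe.symm).resolve_right (Ne.symm hne)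
  have h2 := (hx e he.1 f hf hfe.symm).resolve_left fun h => he.2 (h.trans h1.symm)
  rwa [h2]

theorem finite_sUnion_inter {B : Set (Set α)} (hB : B.Finite) (hBc : ∀ b ∈ B, M.IsCocircuit b)
    (h : Sat M s x y) : (⋃₀ B ∩ diffSet M s x y).Finite := by
  rw [sUnion_eq_biUnion, iUnion₂_inter]
  exact hB.biUnion fun b hb => (h b (hBc b hb)).1

/-- Replace `a` by the end nearer to `x` of an element of the difference. Each such step across an
element of `⋃₀ B` lowers the finite number of those left, and when none is left the parity rule
gives agreement on `B`. -/
theorem inCl_diffSet (hT : IsTame M) (hM : IsConnectedMatroid M) (hs : M.IsBase s)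
    (ha : Γ.Reg s a) (hx : Γ.Reg s x) (hne : (diffSet M s a x).Nonempty) :
    Γ.InCl (diffSet M s a x) x := by
  intro B hB hBc
  induction hn : (⋃₀ B ∩ diffSet M s a x).ncard using Nat.strong_induction_on generalizing a with
  | _ n ih =>
    have hE : ∀ e ∈ diffSet M s a x, e ∈ M.E := fun e he => hs.subset_ground he.1
    have hfin : (⋃₀ B ∩ diffSet M s a x).Finite := by
      obtain ⟨e, he⟩ := hne
      exact finite_sUnion_inter hB hBc (ha.sat hx (hE e he))
    by_cases hd : (⋃₀ B ∩ diffSet M s a x).Nonempty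
    · obtain ⟨e, heB, he⟩ := hd
      obtain ⟨y, hy, hye⟩ := exists_end_eq Γ (M.mem_fundCocircuit e s) (x (M.fundCocircuit e s))
      have hsub := diffSet_end_subset ha.1 hx.1 he hy hye
      have hr := reg_end hT hM hs (hE e he) hy
      by_cases hne' : (diffSet M s y x).Nonempty
      · have hlt : (⋃₀ B ∩ diffSet M s y x).ncard < n := by
          rw [← hn]
          refine ncard_lt_ncard ⟨fun t ht => ⟨ht.1, (hsub ht.2).1⟩, fun h => ?_⟩ hfin
          exact (hsub (h ⟨heB, he⟩).2).2 rfl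
        obtain ⟨f, hf, h⟩ := ih _ hlt hr hne' rfl
        exact ⟨f, (hsub hf).1, h⟩
      · refine ⟨e, he, y, hy, fun b hb => (hr.sat hx (hE e he)).eq_of_disjoint (hBc b hb) ?_⟩
        rw [not_nonempty_iff_eq_empty.1 hne']
        exact disjoint_empty _
    · obtain ⟨e, he⟩ := hne
      obtain ⟨y, hy, hye⟩ := exists_end_eq Γ (M.mem_fundCocircuit e s) (x (M.fundCocircuit e s))
      have hsub := diffSet_end_subset ha.1 hx.1 he hy hye
      have hr := reg_end hT hM hs (hE e he) hy
      refine ⟨e, he, y, hy, fun b hb => (hr.sat hx (hE e he)).eq_of_disjoint (hBc b hb) ?_⟩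
      rw [disjoint_left]
      exact fun t htb ht => hd ⟨t, ⟨b, hb, htb⟩, (hsub ht).1⟩

/-- Closedness of the line. Colourings on it differ from `v` only where `w` does, and this set meets
each cocircuit finitely, as `Sat.of_approx` requires. -/
theorem OnLine.of_approx (hs : M.IsBase s) (hvw : Sat M s v w)
    (h : ∀ B : Set (Set α), B.Finite → (∀ c ∈ B, M.IsCocircuit c) →
      ∃ y, Γ.OnLine s v w y ∧ ∀ c ∈ B, y c = x c) : Γ.OnLine s v w x := by
  refine ⟨Quad.of_approx hs fun B hB hBc => ?_, Sat.of_approx hs fun b hb => ⟨_, (hvw b hb).1,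
    fun B hB hBc => ?_⟩, fun e he => ?_⟩
  · obtain ⟨y, hy, hyx⟩ := h B hB hBc
    exact ⟨y, hy.1, hyx⟩
  · obtain ⟨y, hy, hyx⟩ := h B hB hBc
    refine ⟨y, hy.2.1, hyx, fun e he heF => ?_⟩
    have : v (M.fundCocircuit e s) = w (M.fundCocircuit e s) := by
      by_contra hne
      exact heF ⟨he.2, he.1, hne⟩
    rcases hy.2.2 e he.1 with h | h
    exacts [h, h.trans this.symm]
  · obtain ⟨y, hy, hyx⟩ := h {M.fundCocircuit e s} (finite_singleton _) (by
      rintro _ rfl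
      exact M.fundCocircuit_isCocircuit he hs)
    rw [← hyx _ rfl]
    exact hy.2.2 e he

theorem OnLine.congr (hs : M.IsBase s) (hvw : Sat M s v w) (hx : Γ.OnLine s v w x)
    (h : ∀ b, M.IsCocircuit b → x b = y b) : Γ.OnLine s v w y :=
  OnLine.of_approx hs hvw fun _ _ hBc => ⟨x, hx, fun c hc => h c (hBc c hc)⟩

theorem onLine_left (hv : Γ.Quad s v) : Γ.OnLine s v w v :=
  ⟨hv, Sat.refl _ _ _, fun _ _ => Or.inl rfl⟩

theorem onLine_right (hw : Γ.Quad s w) (hvw : Sat M s v w) : Γ.OnLine s v w w :=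
  ⟨hw, hvw, fun _ _ => Or.inr rfl⟩

theorem onLine_end (hT : IsTame M) (hM : IsConnectedMatroid M) (hs : M.IsBase s)
    (hv : Γ.Reg s v) (hw : Γ.Reg s w) (he : e ∈ diffSet M s v w)
    (hy : y = Γ.src e ∨ y = Γ.tgt e) : Γ.OnLine s v w y := by
  have heE := hs.subset_ground he.1
  have hr := reg_end hT hM hs heE hy
  refine ⟨hr.1, hv.sat hr heE, fun f hf => ?_⟩
  by_cases hfP : v (M.fundCocircuit f s) = w (M.fundCocircuit f s)
  · have hfe : e ≠ f := fun h => he.2 (h ▸ hfP)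
    rw [end_eq_σ hy (notMem_fundCocircuit he.1 hf hfe)]
    rcases hv.1 e he.1 f hf hfe with h | h
    · rcases hw.1 e he.1 f hf hfe with h' | h'
      · exact absurd (h.trans h'.symm) he.2
      · exact Or.inr h'.symm
    · exact Or.inl h.symm
  · exact (by decide : ∀ p q r : ℤˣ, q ≠ r → p = q ∨ p = r) _ _ _ hfP

theorem OnLine.diffSet_subset {x' : Set α → ℤˣ} (hx : Γ.OnLine s v w x)
    (hx' : Γ.OnLine s v w x') : diffSet M s x x' ⊆ diffSet M s v w := by
  rintro e ⟨he, hne⟩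
  refine ⟨he, fun h => hne ?_⟩
  rcases hx.2.2 e he with h1 | h1 <;> rcases hx'.2.2 e he with h2 | h2 <;> simp [h1, h2, h]

theorem OnLine.reg (hv : Γ.Reg s v) (hx : Γ.OnLine s v w x) : Γ.Reg s x :=
  ⟨hx.1, fun e he => (hv.2 e he).trans hx.2.1⟩

theorem diffSet_src_tgt_eq (hs : M.IsBase s) (ho : M.IsCircuit o)
    (hos : o \ {e} ⊆ s) : diffSet M s (Γ.src e) (Γ.tgt e) = o \ {e} := by
  have hes : e ∉ s := fun h => ho.not_indep (hs.indep.subset fun y hy => by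
    by_cases hye : y = e
    exacts [hye ▸ h, hos ⟨hy, hye⟩])
  have hoC : o = M.fundCircuit e s := ho.eq_fundCircuit_of_subset hs.indep fun y hy => by
    by_cases hye : y = e
    exacts [Or.inl hye, Or.inr (hos ⟨hy, hye⟩)]
  rw [diffSet_src_tgt hs, ← hoC]
  ext y
  exact ⟨fun h => ⟨h.1, fun h' => hes (mem_singleton_iff.1 h' ▸ h.2)⟩, fun h => ⟨h.1, hos h⟩⟩

/-- A circuit without one of its elements `e` is the path in `s` between the ends of `e`, so the
limits of the circuit are the points of that line. -/
theorem inCl_iff_onLine (hT : IsTame M) (hM : IsConnectedMatroid M) (hs : M.IsBase s)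
    (ho : M.IsCircuit o) (he : e ∈ o) (hos : o \ {e} ⊆ s) :
    Γ.InCl o x ↔ Γ.OnLine s (Γ.src e) (Γ.tgt e) x := by
  have heE := ho.subset_ground he
  have hD := diffSet_src_tgt_eq (Γ := Γ) hs ho hos
  have hr := reg_end hT hM hs heE (Γ := Γ) (Or.inl rfl)
  constructor
  · intro hx
    have hrx := reg_of_inCl hT hM hs ho hx
    refine ⟨hrx.1, hrx.2 e heE, fun f hf => ?_⟩
    by_cases hfD : f ∈ diffSet M s (Γ.src e) (Γ.tgt e)
    · exact (by decide : ∀ p q r : ℤˣ, q ≠ r → p = q ∨ p = r) _ _ _ hfD.2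
    left
    have hes : e ∉ s := fun h => ho.not_indep (hs.indep.subset fun y hy => by
      by_cases hye : y = e
      exacts [hye ▸ h, hos ⟨hy, hye⟩])
    have hfo : f ∉ o := fun h => hfD (hD ▸ ⟨h, fun h' => hes (mem_singleton_iff.1 h' ▸ hf)⟩)
    have hoC : o = M.fundCircuit e s := ho.eq_fundCircuit_of_subset hs.indep fun y hy => by
      by_cases hye : y = e
      exacts [Or.inl hye, Or.inr (hos ⟨hy, hye⟩)]
    have hd : Disjoint (M.fundCocircuit f s) o := by
      rw [hoC] at hfo ⊢
      exact disjoint_fundCocircuit_fundCircuit hs hf hfo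
    have hb := M.fundCocircuit_isCocircuit hf hs
    obtain ⟨g, hg, y, hy, hyx⟩ := hx {M.fundCocircuit f s} (finite_singleton _) (by
      rintro _ rfl
      exact hb)
    rw [← hyx _ rfl, end_eq_σ hy fun h => disjoint_left.1 hd h hg,
      src_of_notMem fun h => disjoint_left.1 hd h he, σ_eq_of_disjoint hT ho hb hd hg he]
  · intro hx
    by_cases hne : (diffSet M s (Γ.src e) x).Nonempty
    · refine (inCl_diffSet hT hM hs hr (hx.reg hr) hne).mono ?_
      exact ((onLine_left hr.1).diffSet_subset hx).trans (hD.subset.trans sdiff_subset)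
    · refine InCl.of_end he (Or.inl rfl) fun b hb => hx.2.1.eq_of_disjoint hb ?_
      rw [not_nonempty_iff_eq_empty.1 hne]
      exact disjoint_empty _

/-- Two elements of the ground set are joined by a finite chain of fundamental circuits. -/
theorem exists_chain (Γ : GraphFramework M) (hT : IsTame M) (hM : IsConnectedMatroid M)
    (hs : M.IsBase s) (hf : f ∈ M.E) (hz : z ∈ M.E) : ∃ S : Set (Set α), S.Finite ∧
      (∀ C ∈ S, M.IsCircuit C) ∧ ∀ e ∈ s, e ∉ ⋃₀ S →
        Γ.σ (M.fundCocircuit e s) f = Γ.σ (M.fundCocircuit e s) z := by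
  refine (hM.ground_subset hs (K := {z | z ∈ M.E ∧ ∃ S : Set (Set α), S.Finite ∧
    (∀ C ∈ S, M.IsCircuit C) ∧ ∀ e ∈ s, e ∉ ⋃₀ S →
      Γ.σ (M.fundCocircuit e s) f = Γ.σ (M.fundCocircuit e s) z})
    (fun _ h => h.1) ⟨f, hf, ∅, finite_empty, by simp, fun _ _ _ => rfl⟩ ?_ hz).2
  rintro x hx hxs t ht ⟨-, S, hS, hSc, h⟩ g hg
  have hC := hs.fundCircuit_isCircuit hx hxs
  refine ⟨hC.subset_ground hg, insert (M.fundCircuit x s) S, hS.insert _, ?_, fun e he heS => ?_⟩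
  · rintro C (rfl | hCS)
    exacts [hC, hSc C hCS]
  · rw [sUnion_insert, mem_union, not_or] at heS
    rw [h e he heS.2]
    exact σ_eq_of_disjoint hT hC (M.fundCocircuit_isCocircuit he hs)
      (disjoint_fundCocircuit_fundCircuit hs he heS.1) ht hg

/-- A colouring strictly between two others is an end-vertex or a limit of a circuit. -/
theorem OnLine.exists_end_or_inCl (hT : IsTame M) (hM : IsConnectedMatroid M) (hs : M.IsBase s)
    (hv : Γ.Reg s v) (hw : Γ.Reg s w) (hx : Γ.OnLine s v w x) (hvx : (diffSet M s v x).Nonempty)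
    (hxw : (diffSet M s x w).Nonempty) :
    (∃ e ∈ M.E, ∃ y, (y = Γ.src e ∨ y = Γ.tgt e) ∧ ∀ b, M.IsCocircuit b → y b = x b) ∨
      ∃ o, M.IsCircuit o ∧ Γ.InCl o x := by
  have hrx := hx.reg hv
  obtain ⟨f, hf⟩ := hvx
  obtain ⟨h, hh⟩ := hxw
  have hfE := hs.subset_ground hf.1
  obtain ⟨y, hy, hyf⟩ := exists_end_eq Γ (M.mem_fundCocircuit f s) (x (M.fundCocircuit f s))
  have hsub := diffSet_end_subset hv.1 hrx.1 hf hy hyf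
  have hry := reg_end hT hM hs hfE hy
  by_cases hne : (diffSet M s y x).Nonempty
  swap
  · refine Or.inl ⟨f, hfE, y, hy, fun b hb => (hry.sat hrx hfE).eq_of_disjoint hb ?_⟩
    rw [not_nonempty_iff_eq_empty.1 hne]
    exact disjoint_empty _
  right
  obtain ⟨S, hS, hSc, hσ⟩ := exists_chain Γ hT hM hs hfE (hs.subset_ground hh.1)
  -- An element between `f` and `x` separates `f` from `h`, by `Quad` for `x` and `w`, so it lies on
  -- the finite chain of circuits from `f` to `h`. Then `x` is a limit of one of them.
  have hcl := (inCl_diffSet hT hM hs hry hrx hne).mono (o' := ⋃₀ S) fun e he => by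
    by_contra heS
    obtain ⟨hvx, hef⟩ := hsub he
    have heq := hσ e he.1 heS
    have hxe := (hx.2.2 e he.1).resolve_left (Ne.symm hvx.2)
    have heh : e ≠ h := by
      rintro rfl
      exact hh.2 hxe
    have hye : x (M.fundCocircuit e s) ≠ Γ.σ (M.fundCocircuit e s) h := by
      rw [← heq, ← end_eq_σ hy (notMem_fundCocircuit hf.1 he.1 fun h' => hef h'.symm)]
      exact he.2.symm
    have h1 := (hrx.1 e he.1 h hh.1 heh).resolve_left hye
    have h2 := (hw.1 e he.1 h hh.1 heh).resolve_left (hxe ▸ hye)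
    exact hh.2 (h1.trans h2.symm)
  obtain ⟨C, hC, hCx⟩ := hcl.exists_of_finite hS
  exact ⟨C, hSc C hC, hCx⟩

end GraphFramework

/-! ### Compactness and connectedness of subspaces -/

namespace GraphFramework

variable {α : Type u} {M : Matroid α} (Γ : GraphFramework M)

open Classical in
/-- A vertex as a colouring. -/
noncomputable def col (v : FVertex M) (b : Set α) : ℤˣ :=
  if h : M.IsCocircuit b then v ⟨b, h⟩ else 1

/-- The vertex given by a colouring. -/
def toVertex (M : Matroid α) (x : Set α → ℤˣ) : FVertex M := fun b => x b.1

/-- The set of points of `G(M, Γ)` that are vertices in `A` or inner points of edges in `P`. -/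
def ptsOf (A : Set (FVertex M)) (P : Set α) : Set Γ.space.Pts
  | Points.vertex v => v ∈ A
  | Points.inner _ e => (e : α) ∈ P

/-- The graph-like subspace with vertex set `A` and edge set `P`. -/
noncomputable def sub (A : Set (FVertex M)) (P : Set α)
    (h : ∀ e : M.E, (e : α) ∈ P → Γ.srcVertex e ∈ A ∧ Γ.tgtVertex e ∈ A) :
    GraphLikeSpace A (Subtype.val ⁻¹' P : Set M.E) :=
  Γ.space.subspace (Function.Embedding.subtype (· ∈ A))
    (Function.Embedding.subtype (· ∈ (Subtype.val ⁻¹' P : Set M.E)))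
    (fun e => ⟨Γ.srcVertex e, (h e e.2).1⟩) (fun e => ⟨Γ.tgtVertex e, (h e e.2).2⟩)
    (fun _ => rfl) (fun _ => rfl)

/-- The side `i` of `b` in the space `G(M, Γ)`, without the middle points of the edges in `b`. -/
def half (b : {b : Set α // M.IsCocircuit b}) (i : ℤˣ) : Set Γ.space.Pts :=
  Γ.side b i fun _ => ⟨1 / 2, by norm_num, by norm_num⟩

variable {Γ} {A : Set (FVertex M)} {P b : Set α} {x y : Set α → ℤˣ} {v w : FVertex M}

theorem col_apply (hb : M.IsCocircuit b) : col v b = v ⟨b, hb⟩ := dif_pos hb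

theorem col_toVertex (hb : M.IsCocircuit b) : col (toVertex M x) b = x b := dif_pos hb

theorem toVertex_col : toVertex M (col v) = v := by
  ext b
  rw [toVertex, col_apply b.2]

theorem toVertex_eq_iff : toVertex M x = v ↔ ∀ b, M.IsCocircuit b → x b = col v b := by
  constructor
  · rintro rfl b hb
    rw [col_toVertex hb]
  · intro h
    funext b
    rw [toVertex, h b b.2, col_apply b.2]

theorem toVertex_src (e : M.E) : toVertex M (Γ.src e) = Γ.srcVertex e := rfl

theorem toVertex_tgt (e : M.E) : toVertex M (Γ.tgt e) = Γ.tgtVertex e := rfl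

theorem col_srcVertex (e : M.E) (hb : M.IsCocircuit b) : col (Γ.srcVertex e) b = Γ.src e b := by
  rw [← toVertex_src, col_toVertex hb]

theorem col_tgtVertex (e : M.E) (hb : M.IsCocircuit b) : col (Γ.tgtVertex e) b = Γ.tgt e b := by
  rw [← toVertex_tgt, col_toVertex hb]

theorem isOpen_side (b : {b : Set α // M.IsCocircuit b}) (i : ℤˣ) (ε : α → Ioo (0 : ℝ) 1) :
    IsOpen (X := Γ.space.Pts) (Γ.side b i ε) :=
  TopologicalSpace.isOpen_generateFrom_of_mem (Or.inr ⟨_, _, _, rfl⟩)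

theorem isOpen_half (b : {b : Set α // M.IsCocircuit b}) (i : ℤˣ) : IsOpen (Γ.half b i) :=
  isOpen_side b i _

theorem vert_mem_half {b : {b : Set α // M.IsCocircuit b}} {i : ℤˣ} :
    Γ.space.vert v ∈ Γ.half b i ↔ v b = i := Iff.rfl

theorem isOpen_innerPts (e : M.E) : IsOpen (range fun r => Γ.space.inner r e) := by
  rw [← image_univ]
  exact Γ.space.isOpen_inner e univ isOpen_univ

theorem isClosed_range_vert : IsClosed (range Γ.space.vert) := by
  have : range Γ.space.vert = (⋃ e, range fun r => Γ.space.inner r e)ᶜ := by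
    ext p
    rcases p with v | ⟨r, e⟩
    · refine ⟨fun _ h => ?_, fun _ => ⟨v, rfl⟩⟩
      obtain ⟨e, r, h⟩ := mem_iUnion.1 h
      cases h
    · refine ⟨fun h => ?_, fun h => (h (mem_iUnion.2 ⟨e, mem_range_self r⟩)).elim⟩
      obtain ⟨v, h⟩ := h
      cases h
  rw [this]
  exact (isOpen_iUnion fun e => isOpen_innerPts e).isClosed_compl

theorem isClosed_vert_eq (b : {b : Set α // M.IsCocircuit b}) (i : ℤˣ) :
    IsClosed (Γ.space.vert '' {v | v b = i}) := by
  have : Γ.space.vert '' {v | v b = i} = range Γ.space.vert \ Γ.half b (-i) := by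
    ext p
    constructor
    · rintro ⟨v, hv, rfl⟩
      refine ⟨⟨v, rfl⟩, fun h => ?_⟩
      rw [vert_mem_half, show v b = i from hv] at h
      exact (by decide : ∀ i : ℤˣ, i ≠ -i) _ h
    · rintro ⟨⟨v, rfl⟩, h⟩
      rw [vert_mem_half] at h
      exact ⟨v, (by decide : ∀ u i : ℤˣ, u ≠ -i → u = i) _ _ h, rfl⟩
  rw [this]
  exact isClosed_range_vert.sdiff (isOpen_half b _)

theorem range_ι_subset (e : M.E) :
    range (Γ.space.ι e) ⊆ ptsOf Γ {Γ.srcVertex e, Γ.tgtVertex e} {(e : α)} := by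
  rintro _ ⟨r, rfl⟩
  rw [GraphLikeSpace.ι, edgeMap]
  split_ifs
  exacts [rfl, Or.inl rfl, Or.inr rfl]

theorem inner_mem_range_ι (e : M.E) (r : Ioo (0 : ℝ) 1) :
    Γ.space.inner r e ∈ range (Γ.space.ι e) := by
  refine ⟨⟨r, r.2.1.le, r.2.2.le⟩, ?_⟩
  rw [GraphLikeSpace.ι, edgeMap, dif_pos r.2]
  rfl

theorem src_mem_range_ι (e : M.E) : Γ.space.vert (Γ.srcVertex e) ∈ range (Γ.space.ι e) := by
  refine ⟨0, ?_⟩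
  rw [GraphLikeSpace.ι, edgeMap, dif_neg (by simp), if_pos (by simp)]
  rfl

theorem tgt_mem_range_ι (e : M.E) : Γ.space.vert (Γ.tgtVertex e) ∈ range (Γ.space.ι e) := by
  refine ⟨1, ?_⟩
  rw [GraphLikeSpace.ι, edgeMap, dif_neg (by simp), if_neg (by simp)]
  rfl

theorem continuous_ι (e : M.E) : Continuous (Γ.space.ι e) := Γ.space.continuous_edgeMap e

theorem isPreconnected_range_ι (e : M.E) : IsPreconnected (range (Γ.space.ι e)) :=
  isPreconnected_range (continuous_ι e)

theorem range_ι_subset_ptsOf {e : M.E} (he : (e : α) ∈ P) (h : Γ.srcVertex e ∈ A ∧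
    Γ.tgtVertex e ∈ A) : range (Γ.space.ι e) ⊆ ptsOf Γ A P := by
  intro p hp
  have := range_ι_subset e hp
  rcases p with v | ⟨r, e'⟩
  · rcases this with rfl | rfl
    exacts [h.1, h.2]
  · change (e' : α) ∈ P
    rwa [show (e' : α) = e from this]

/-- A connected set of points that avoids the edges in `b` lies on one side of `b`. -/
theorem eq_of_isPreconnected {T : Set Γ.space.Pts} (hT : IsPreconnected T)
    (b : {b : Set α // M.IsCocircuit b}) (h : ∀ r (e : M.E), Γ.space.inner r e ∈ T → (e : α) ∉ b.1)
    (hv : Γ.space.vert v ∈ T) (hw : Γ.space.vert w ∈ T) : v b = w b := by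
  by_contra hne
  have hcov : T ⊆ Γ.half b (v b) ∪ Γ.half b (w b) := by
    intro p hp
    rcases p with y | ⟨r, e⟩
    · exact (by decide : ∀ p q r : ℤˣ, q ≠ r → p = q ∨ p = r) (y b) _ _ hne
    · have heb := h r e hp
      rcases (by decide : ∀ p q r : ℤˣ, q ≠ r → p = q ∨ p = r) (Γ.σ b e) _ _ hne with h | h
      exacts [Or.inl (Or.inl ⟨heb, h⟩), Or.inr (Or.inl ⟨heb, h⟩)]
  obtain ⟨p, hp, hp1, hp2⟩ := hT _ _ (isOpen_half b _) (isOpen_half b _) hcov ⟨_, hv, rfl⟩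
    ⟨_, hw, rfl⟩
  rcases p with y | ⟨r, e⟩
  · exact hne (Eq.trans (Eq.symm hp1) hp2)
  · have heb := h r e hp
    rcases hp1 with ⟨-, h1⟩ | h1 | h1
    · rcases hp2 with ⟨-, h2⟩ | h2 | h2
      exacts [hne (h1.symm.trans h2), heb h2.1, heb h2.1]
    · exact heb h1.1
    · exact heb h1.1

/-- The points off the edges in `b` on the side `i` of `b`. -/
def pureSide (Γ : GraphFramework M) (b : {b : Set α // M.IsCocircuit b}) (i : ℤˣ) :
    Set Γ.space.Pts
  | Points.vertex v => v b = i
  | Points.inner _ e => (e : α) ∉ b.1 ∧ Γ.σ b e = i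

/-- An ultrafilter that contains no edge of the subspace chooses, by finiteness of `b ∩ P`, a side
of each cocircuit `b` away from the edges in `b`. These choices form a vertex, to which it
converges. -/
theorem isCompact_ptsOf
    (hA : ∀ x : FVertex M, (∀ B : Set {b : Set α // M.IsCocircuit b}, B.Finite →
      ∃ y ∈ A, ∀ b ∈ B, y b = x b) → x ∈ A)
    (hP : ∀ b, M.IsCocircuit b → (b ∩ P).Finite)
    (h : ∀ e : M.E, (e : α) ∈ P → Γ.srcVertex e ∈ A ∧ Γ.tgtVertex e ∈ A) :
    IsCompact (ptsOf Γ A P) := by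
  rw [isCompact_iff_ultrafilter_le_nhds]
  intro U hU
  rw [Filter.le_principal_iff] at hU
  by_cases hcase : ∃ e : M.E, (e : α) ∈ P ∧ range (Γ.space.ι e) ∈ U
  · obtain ⟨e, heP, he⟩ := hcase
    obtain ⟨p, hp, hUp⟩ := isCompact_iff_ultrafilter_le_nhds.1 (isCompact_range (continuous_ι e)) U
      (Filter.le_principal_iff.2 he)
    exact ⟨p, range_ι_subset_ptsOf heP (h e heP) hp, hUp⟩
  push Not at hcase
  have hz : ∀ b : {b : Set α // M.IsCocircuit b}, ∃ i, pureSide Γ b i ∈ U := by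
    intro b
    by_contra hcon
    push Not at hcon
    have hfin : {e : M.E | (e : α) ∈ b.1 ∩ P}.Finite :=
      (hP b b.2).preimage Subtype.val_injective.injOn
    have h1 : (⋃ e ∈ {e : M.E | (e : α) ∈ b.1 ∩ P}, range (Γ.space.ι e)) ∉ U := by
      rw [Ultrafilter.finite_biUnion_mem_iff hfin]
      rintro ⟨e, he, h⟩
      exact hcase e he.2 h
    have h2 := Ultrafilter.union_mem_iff.not.2 (not_or.2 ⟨h1, Ultrafilter.union_mem_iff.not.2
      (not_or.2 ⟨hcon 1, hcon (-1)⟩)⟩)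
    refine h2 (Filter.mem_of_superset hU ?_)
    intro p hp
    rcases p with v | ⟨r, e⟩
    · exact Or.inr (Int.units_eq_one_or (v b))
    · by_cases heb : (e : α) ∈ b.1
      · exact Or.inl (mem_biUnion (x := e) ⟨heb, hp⟩ (inner_mem_range_ι e r))
      · right
        rcases Int.units_eq_one_or (Γ.σ b e) with h | h
        exacts [Or.inl ⟨heb, h⟩, Or.inr ⟨heb, h⟩]
  choose z hz using hz
  refine ⟨Γ.space.vert z, ?_, ?_⟩
  · refine hA z fun B hB => ?_
    have hmem : (ptsOf Γ A P ∩ ⋂ b ∈ B, pureSide Γ b (z b)) ∈ U :=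
      Filter.inter_mem hU ((Filter.biInter_mem hB).2 fun b _ => hz b)
    obtain ⟨p, hp, hpB⟩ := U.nonempty_of_mem hmem
    rw [mem_iInter₂] at hpB
    rcases p with v | ⟨r, e⟩
    · exact ⟨v, hp, hpB⟩
    · refine ⟨_, (h e hp).1, fun b hb => ?_⟩
      have := hpB b hb
      rw [srcVertex, if_neg this.1, this.2]
  · have : 𝓝 (Γ.space.vert z) = ⨅ s ∈ {s | Γ.space.vert z ∈ s ∧ s ∈ Γ.subbasis},
        Filter.principal s := TopologicalSpace.nhds_generateFrom
    rw [this]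
    refine le_iInf₂ fun S hS => Filter.le_principal_iff.2 ?_
    obtain ⟨hzS, ⟨e, U', -, rfl⟩ | ⟨b, i, ε, rfl⟩⟩ := hS
    · obtain ⟨r, -, hr⟩ := hzS
      exact absurd hr (by simp [GraphLikeSpace.vert])
    · have hzi : z b = i := hzS
      refine Filter.mem_of_superset (hz b) ?_
      rw [hzi]
      intro p hp
      rcases p with v | ⟨r, e⟩
      exacts [hp, Or.inl hp]

/-- A separation into open sets induces a property `p` of vertices that is constant along edges and,
by compactness, depends on finitely many cocircuits only. `H` says that such a `p` is constant,
which reduces connectedness to combinatorics. -/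
theorem isPreconnected_ptsOf (hK : IsCompact (ptsOf Γ A P))
    (h : ∀ e : M.E, (e : α) ∈ P → Γ.srcVertex e ∈ A ∧ Γ.tgtVertex e ∈ A)
    (H : ∀ p : FVertex M → Prop, (∀ e : M.E, (e : α) ∈ P →
      (p (Γ.srcVertex e) ↔ p (Γ.tgtVertex e))) → ∀ B : Set {b : Set α // M.IsCocircuit b},
      B.Finite → (∀ x ∈ A, ∀ y ∈ A, (∀ b ∈ B, x b = y b) → (p x ↔ p y)) →
      ∀ x ∈ A, ∀ y ∈ A, (p x ↔ p y)) :
    IsPreconnected (ptsOf Γ A P) := by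
  intro u v hu hv huv hKu hKv
  by_contra hd
  have hor : ∀ p ∈ ptsOf Γ A P, p ∈ u ↔ p ∉ v := fun p hp =>
    ⟨fun h h' => hd ⟨p, hp, h, h'⟩, fun h => (huv hp).resolve_right h⟩
  have hedge : ∀ e : M.E, (e : α) ∈ P → ∀ p ∈ range (Γ.space.ι e), ∀ q ∈ range (Γ.space.ι e),
      p ∈ u → q ∈ u := by
    intro e he p hp q hq hpu
    by_contra hqu
    have hsub := range_ι_subset_ptsOf he (h e he)
    obtain ⟨t, ht, htu⟩ := isPreconnected_range_ι e u v hu hv (hsub.trans huv) ⟨p, hp, hpu⟩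
      ⟨q, hq, (huv (hsub hq)).resolve_left hqu⟩
    exact hd ⟨t, hsub ht, htu⟩
  set p : FVertex M → Prop := fun x => Γ.space.vert x ∈ u with hp
  have hc1 : IsCompact ((ptsOf Γ A P \ v) ∩ range Γ.space.vert) :=
    (hK.diff hv).inter_right isClosed_range_vert
  have hc2 : IsCompact ((ptsOf Γ A P \ u) ∩ range Γ.space.vert) :=
    (hK.diff hu).inter_right isClosed_range_vert
  set t : {b : Set α // M.IsCocircuit b} → Set (Γ.space.Pts × Γ.space.Pts) := fun b =>
    ((Γ.space.vert '' {v | v b = 1}) ×ˢ (Γ.space.vert '' {v | v b = 1})) ∪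
    ((Γ.space.vert '' {v | v b = -1}) ×ˢ (Γ.space.vert '' {v | v b = -1})) with htdef
  have htc : ∀ b, IsClosed (t b) := fun b =>
    ((isClosed_vert_eq b 1).prod (isClosed_vert_eq b 1)).union
      ((isClosed_vert_eq b (-1)).prod (isClosed_vert_eq b (-1)))
  have hvert : ∀ x y : FVertex M, Γ.space.vert x = Γ.space.vert y → x = y := fun x y h =>
    Points.vertex.inj h
  have htmem : ∀ b x y, (Γ.space.vert x, Γ.space.vert y) ∈ t b ↔ x b = y b := by
    intro b x y
    constructor
    · rintro (⟨⟨x', hx', hxx⟩, ⟨y', hy', hyy⟩⟩ | ⟨⟨x', hx', hxx⟩, ⟨y', hy', hyy⟩⟩) <;>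
        rw [← hvert _ _ hxx, ← hvert _ _ hyy, show x' b = _ from hx', show y' b = _ from hy']
    · intro hxy
      rcases Int.units_eq_one_or (x b) with h | h
      exacts [Or.inl ⟨⟨x, h, rfl⟩, ⟨y, hxy.symm.trans h, rfl⟩⟩,
        Or.inr ⟨⟨x, h, rfl⟩, ⟨y, hxy.symm.trans h, rfl⟩⟩]
  -- Pairs of vertices from the two classes never agree at all cocircuits; by compactness of the
  -- product, finitely many cocircuits already tell all such pairs apart.
  obtain ⟨B, hB⟩ := (hc1.prod hc2).elim_finite_subfamily_closed t htc (by
    rw [eq_empty_iff_forall_notMem]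
    rintro ⟨p, q⟩ ⟨⟨⟨hp, x, rfl⟩, ⟨hq, y, rfl⟩⟩, ht⟩
    have hxy : x = y := by
      funext b
      exact (htmem b x y).1 (mem_iInter.1 ht b)
    subst hxy
    exact hq.2 ((hor _ hq.1).2 hp.2))
  have hall := H p (fun e he => ⟨hedge e he _ (src_mem_range_ι e) _ (tgt_mem_range_ι e),
    hedge e he _ (tgt_mem_range_ι e) _ (src_mem_range_ι e)⟩) (B : Set _) B.finite_toSet (by
    have key : ∀ x ∈ A, ∀ y ∈ A, (∀ b ∈ (B : Set _), x b = y b) → p x → p y := by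
      intro x hx y hy hxy hpx
      by_contra hpy
      have : (Γ.space.vert x, Γ.space.vert y) ∈ (∅ : Set (Γ.space.Pts × Γ.space.Pts)) := by
        rw [← hB]
        refine ⟨⟨⟨⟨hx, (hor _ (show Γ.space.vert x ∈ ptsOf Γ A P from hx)).1 hpx⟩, x, rfl⟩,
          ⟨⟨hy, hpy⟩, y, rfl⟩⟩, ?_⟩
        rw [mem_iInter₂]
        exact fun b hb => (htmem b x y).2 (hxy b hb)
      exact this
    exact fun x hx y hy hxy => ⟨key x hx y hy hxy, key y hy x hx fun b hb => (hxy b hb).symm⟩)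
  have hend : ∀ q ∈ ptsOf Γ A P, ∃ x ∈ A, (q ∈ u ↔ p x) := by
    intro q hq
    rcases q with x | ⟨r, e⟩
    · exact ⟨x, hq, Iff.rfl⟩
    · exact ⟨_, (h e hq).1, hedge e hq _ (inner_mem_range_ι e r) _ (src_mem_range_ι e),
        hedge e hq _ (src_mem_range_ι e) _ (inner_mem_range_ι e r)⟩
  obtain ⟨q, hq, hqu⟩ := hKu
  obtain ⟨q', hq', hqv⟩ := hKv
  obtain ⟨x, hx, hqx⟩ := hend q hq
  obtain ⟨x', hx', hqx'⟩ := hend q' hq'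
  exact (hor q' hq').1 (hqx'.2 ((hall x hx x' hx').1 (hqx.1 hqu))) hqv

end GraphFramework

/-! ### Pseudo-lines from the paths of a base -/

namespace GraphFramework

variable {α : Type u} {M : Matroid α} (Γ : GraphFramework M)

/-- The vertices of the pseudo-line between `v` and `w`. -/
def lineVertices (s : Set α) (v w : Set α → ℤˣ) : Set (FVertex M) := {x | Γ.OnLine s v w (col x)}

/-- The inclusion of a graph-like subspace. -/
def subMap (A : Set (FVertex M)) (P : Set α)
    (h : ∀ e : M.E, (e : α) ∈ P → Γ.srcVertex e ∈ A ∧ Γ.tgtVertex e ∈ A) :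
    (Γ.sub A P h).Pts → Γ.space.Pts :=
  GraphLikeSpace.pointsMap Subtype.val Subtype.val

variable {Γ} {A : Set (FVertex M)} {P b s F : Set α} {v w x y : Set α → ℤˣ} {e : α}
  {h : ∀ e : M.E, (e : α) ∈ P → Γ.srcVertex e ∈ A ∧ Γ.tgtVertex e ∈ A}

theorem isInducing_subMap : IsInducing (Γ.subMap A P h) := ⟨rfl⟩

theorem image_subMap_minus : Γ.subMap A P h '' (Γ.sub A P h).minus {e | (e : α) ∈ F} =
    ptsOf Γ A (P \ F) := by
  ext p
  constructor
  · rintro ⟨q, hq, rfl⟩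
    rcases q with v | ⟨r, e⟩
    · exact v.2
    · exact ⟨e.2, fun he => hq e he r rfl⟩
  · intro hp
    rcases p with v | ⟨r, e⟩
    · refine ⟨Points.vertex ⟨v, hp⟩, fun e _ r h => ?_, rfl⟩
      cases h
    · refine ⟨Points.inner r ⟨e, hp.1⟩, fun e' he' r' h => ?_, rfl⟩
      cases h
      exact hp.2 he'

theorem range_subMap : range (Γ.subMap A P h) = ptsOf Γ A P := by
  have := image_subMap_minus (Γ := Γ) (A := A) (P := P) (h := h) (F := ∅)
  rw [sdiff_empty] at this
  rw [← this, ← image_univ]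
  congr 1
  ext p
  exact ⟨fun _ e he => absurd he (notMem_empty _), fun _ => mem_univ _⟩

theorem compactSpace_sub (hK : IsCompact (ptsOf Γ A P)) : CompactSpace (Γ.sub A P h).Pts := by
  rw [← range_subMap (h := h), ← image_univ] at hK
  exact ⟨isInducing_subMap.isCompact_iff.2 hK⟩

theorem isPreconnected_minus_iff : IsPreconnected ((Γ.sub A P h).minus {e | (e : α) ∈ F}) ↔
    IsPreconnected (ptsOf Γ A (P \ F)) := by
  rw [← image_subMap_minus (h := h), isInducing_subMap.isPreconnected_image]

theorem connectedSpace_sub (hK : IsPreconnected (ptsOf Γ A P)) (hA : A.Nonempty) :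
    ConnectedSpace (Γ.sub A P h).Pts := by
  rw [← range_subMap (h := h), ← image_univ, isInducing_subMap.isPreconnected_image] at hK
  have : PreconnectedSpace (Γ.sub A P h).Pts := ⟨hK⟩
  exact ⟨⟨(Γ.sub A P h).vert ⟨_, hA.some_mem⟩⟩⟩

theorem separatedBy_sub (hb : M.IsCocircuit b) (hF : P ∩ b ⊆ F) {v w : A}
    (hvw : col v.1 b ≠ col w.1 b) : (Γ.sub A P h).SeparatedBy {e | (e : α) ∈ F} v w := by
  intro hw
  have hv : (Γ.sub A P h).vert v ∈ (Γ.sub A P h).minus {e | (e : α) ∈ F} := by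
    intro e _ r h
    cases h
  have hpre := isPreconnected_connectedComponentIn (x := (Γ.sub A P h).vert v)
    (F := (Γ.sub A P h).minus {e | (e : α) ∈ F})
  rw [← isInducing_subMap.isPreconnected_image] at hpre
  refine hvw ?_
  rw [col_apply hb, col_apply hb]
  refine eq_of_isPreconnected hpre ⟨b, hb⟩ ?_ ⟨_, mem_connectedComponentIn hv, rfl⟩ ⟨_, hw, rfl⟩
  intro r e he heb
  have := image_mono (f := Γ.subMap A P h) (connectedComponentIn_subset _ _) he
  rw [image_subMap_minus] at this
  exact this.2 (hF ⟨this.1, heb⟩)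

theorem toVertex_mem_lineVertices (hs : M.IsBase s) (hvw : Sat M s v w) (hx : Γ.OnLine s v w x) :
    toVertex M x ∈ Γ.lineVertices s v w :=
  hx.congr hs hvw fun _ hb => (col_toVertex hb).symm

theorem line_ends (hT : IsTame M) (hM : IsConnectedMatroid M) (hs : M.IsBase s)
    (hv : Γ.Reg s v) (hw : Γ.Reg s w) (hvw : Sat M s v w) (e : M.E)
    (he : (e : α) ∈ diffSet M s v w) :
    Γ.srcVertex e ∈ Γ.lineVertices s v w ∧ Γ.tgtVertex e ∈ Γ.lineVertices s v w :=
  ⟨toVertex_mem_lineVertices hs hvw (onLine_end hT hM hs hv hw he (Or.inl rfl)),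
    toVertex_mem_lineVertices hs hvw (onLine_end hT hM hs hv hw he (Or.inr rfl))⟩

theorem isCompact_line (hT : IsTame M) (hM : IsConnectedMatroid M) (hs : M.IsBase s)
    (hv : Γ.Reg s v) (hw : Γ.Reg s w) (hvw : Sat M s v w) :
    IsCompact (ptsOf Γ (Γ.lineVertices s v w) (diffSet M s v w)) := by
  refine isCompact_ptsOf (fun x hx => OnLine.of_approx hs hvw fun B hB hBc => ?_)
    (fun b hb => (hvw b hb).1) (line_ends hT hM hs hv hw hvw)
  obtain ⟨y, hy, hyx⟩ := hx (Subtype.val ⁻¹' B) (hB.preimage Subtype.val_injective.injOn)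
  refine ⟨col y, hy, fun c hc => ?_⟩
  rw [col_apply (hBc c hc), col_apply (hBc c hc), hyx ⟨c, hBc c hc⟩ hc]

/-- If `x` and `y` differ at some `e` in `⋃₀ B`, pass from `x` to the nearer end of `e`, across `e`,
and on to `y`; both remaining stretches have fewer differences in `⋃₀ B`. Without such `e`, `x` and
`y` agree on `B`. -/
theorem OnLine.iff_of_forall {p : (Set α → ℤˣ) → Prop} {B : Set (Set α)} (hT : IsTame M)
    (hM : IsConnectedMatroid M) (hs : M.IsBase s) (hv : Γ.Reg s v) (hw : Γ.Reg s w)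
    (hB : B.Finite) (hBc : ∀ b ∈ B, M.IsCocircuit b)
    (hp : ∀ e ∈ diffSet M s v w, (p (Γ.src e) ↔ p (Γ.tgt e)))
    (hpB : ∀ x y, Γ.OnLine s v w x → Γ.OnLine s v w y → (∀ b ∈ B, x b = y b) → (p x ↔ p y))
    (hx : Γ.OnLine s v w x) (hy : Γ.OnLine s v w y) : p x ↔ p y := by
  induction hn : (⋃₀ B ∩ diffSet M s x y).ncard using Nat.strong_induction_on generalizing x y with
  | _ n ih =>
    have hxy : Sat M s x y := hx.2.1.symm.trans hy.2.1
    by_cases hd : (⋃₀ B ∩ diffSet M s x y).Nonempty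
    · obtain ⟨e, heB, he⟩ := hd
      have heD := hx.diffSet_subset hy he
      have he' : e ∈ diffSet M s y x := diffSet_comm ▸ he
      obtain ⟨z, hz, hze⟩ := exists_end_eq Γ (M.mem_fundCocircuit e s) (x (M.fundCocircuit e s))
      obtain ⟨z', hz', hze'⟩ := exists_end_eq Γ (M.mem_fundCocircuit e s) (y (M.fundCocircuit e s))
      have hsub := diffSet_end_subset hy.1 hx.1 he' hz hze
      have hsub' := diffSet_end_subset hx.1 hy.1 he hz' hze'
      rw [diffSet_comm, diffSet_comm (x := y)] at hsub
      have hlt : ∀ D, D ⊆ diffSet M s x y \ {e} → (⋃₀ B ∩ D).ncard < n := by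
        intro D hD
        rw [← hn]
        refine ncard_lt_ncard ⟨fun t ht => ⟨ht.1, (hD ht.2).1⟩, fun h => ?_⟩
          (finite_sUnion_inter hB hBc hxy)
        exact (hD (h ⟨heB, he⟩).2).2 rfl
      have hzL := onLine_end hT hM hs hv hw heD hz
      have hzL' := onLine_end hT hM hs hv hw heD hz'
      have h1 := ih _ (hlt _ hsub) hx hzL rfl
      have h2 := ih _ (hlt _ hsub') hzL' hy rfl
      have h3 : p z ↔ p z' := by
        have := hp e heD
        rcases hz with rfl | rfl <;> rcases hz' with rfl | rfl
        exacts [Iff.rfl, this, this.symm, Iff.rfl]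
      exact h1.trans (h3.trans h2)
    · refine hpB x y hx hy fun b hb => hxy.eq_of_disjoint (hBc b hb) ?_
      rw [disjoint_left]
      exact fun t htb ht => hd ⟨t, ⟨b, hb, htb⟩, ht⟩

theorem isPreconnected_line (hT : IsTame M) (hM : IsConnectedMatroid M) (hs : M.IsBase s)
    (hv : Γ.Reg s v) (hw : Γ.Reg s w) (hvw : Sat M s v w) :
    IsPreconnected (ptsOf Γ (Γ.lineVertices s v w) (diffSet M s v w)) := by
  refine isPreconnected_ptsOf (isCompact_line hT hM hs hv hw hvw)
    (line_ends hT hM hs hv hw hvw) ?_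
  intro p hp B hB hpB x hx y hy
  have := OnLine.iff_of_forall (p := fun c => p (toVertex M c)) hT hM hs hv hw
    (hB.image Subtype.val) (by
      rintro _ ⟨b, -, rfl⟩
      exact b.2) (fun e he => hp ⟨e, hs.subset_ground he.1⟩ he) (fun x y hx hy hxy =>
        hpB _ (toVertex_mem_lineVertices hs hvw hx) _ (toVertex_mem_lineVertices hs hvw hy)
          fun b hb => hxy _ (mem_image_of_mem _ hb)) hx hy
  simpa only [toVertex_col] using this

theorem exists_mem_diffSet_of_ne (hx : Γ.OnLine s v w x) (hy : Γ.OnLine s v w y)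
    (hne : ∃ b, M.IsCocircuit b ∧ x b ≠ y b) : (diffSet M s x y).Nonempty := by
  obtain ⟨b, hb, hne⟩ := hne
  by_contra hemp
  refine hne ((hx.2.1.symm.trans hy.2.1).eq_of_disjoint hb ?_)
  rw [not_nonempty_iff_eq_empty.1 hemp]
  exact disjoint_empty _

theorem exists_col_ne {v w : FVertex M} (h : v ≠ w) : ∃ b, M.IsCocircuit b ∧ col v b ≠ col w b := by
  obtain ⟨b, hb⟩ := Function.ne_iff.1 h
  exact ⟨b, b.2, by rwa [col_apply b.2, col_apply b.2]⟩

/-- The fundamental cocircuit of an edge `e` of the line contains no other edge of the line, so its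
two sides separate once `e` is removed. -/
theorem isPseudoLine_sub (hT : IsTame M) (hM : IsConnectedMatroid M) (hs : M.IsBase s)
    (hv : Γ.Reg s v) (hw : Γ.Reg s w) (hvw : Sat M s v w) :
    (Γ.sub (Γ.lineVertices s v w) (diffSet M s v w) (line_ends hT hM hs hv hw hvw)).IsPseudoLine
      ⟨toVertex M v, toVertex_mem_lineVertices hs hvw (onLine_left hv.1)⟩
      ⟨toVertex M w, toVertex_mem_lineVertices hs hvw (onLine_right hw.1 hvw)⟩ where
  compact := compactSpace_sub (isCompact_line hT hM hs hv hw hvw)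
  connected := connectedSpace_sub (isPreconnected_line hT hM hs hv hw hvw)
    ⟨_, toVertex_mem_lineVertices hs hvw (onLine_left hv.1)⟩
  separates_ends := by
    intro e
    have hb := M.fundCocircuit_isCocircuit e.2.1 hs
    have := separatedBy_sub (h := line_ends hT hM hs hv hw hvw) (F := {(e.1 : α)})
      (v := ⟨toVertex M v, toVertex_mem_lineVertices hs hvw (onLine_left hv.1)⟩)
      (w := ⟨toVertex M w, toVertex_mem_lineVertices hs hvw (onLine_right hw.1 hvw)⟩) hb ?_ ?_
    · convert this
      ext f
      simp [Subtype.ext_iff]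
    · rw [← M.fundCocircuit_inter_eq e.2.1]
      exact fun y hy => ⟨hy.2, hy.1.1⟩
    · rw [col_toVertex hb, col_toVertex hb]
      exact e.2.2
  separates_vertices := by
    intro x y hxy
    obtain ⟨e, he⟩ := exists_mem_diffSet_of_ne x.2 y.2
      (exists_col_ne fun h => hxy (Subtype.ext h))
    have hb := M.fundCocircuit_isCocircuit he.1 hs
    have heD := OnLine.diffSet_subset x.2 y.2 he
    refine ⟨⟨⟨e, hs.subset_ground he.1⟩, heD⟩, ?_⟩
    have := separatedBy_sub (h := line_ends hT hM hs hv hw hvw) (F := {e}) hb ?_ he.2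
    · convert this
      ext f
      simp [Subtype.ext_iff]
    · rw [← M.fundCocircuit_inter_eq he.1]
      exact fun y hy => ⟨hy.2, hy.1.1⟩

/-- The map of a graph-like subspace into another graph-like subspace. -/
def subHom {V' E' : Type u} (h : ∀ e : M.E, (e : α) ∈ P → Γ.srcVertex e ∈ A ∧ Γ.tgtVertex e ∈ A)
    (G : GraphLikeSpace V' E') (f : V' → FVertex M) (g : E' → M.E)
    (hG : G.top = Γ.space.top.induced (GraphLikeSpace.pointsMap f g)) (i : A → V')
    (j : (Subtype.val ⁻¹' P : Set M.E) → E') (hi : ∀ a, f (i a) = a) (hj : ∀ e, g (j e) = e) :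
    GraphLikeSpace.Hom (Γ.sub A P h) G where
  onV := i
  onE e := Sum.inl (j e, true)
  continuous_inducedFun := by
    rw [hG]
    refine continuous_induced_rng.2 ?_
    have : GraphLikeSpace.pointsMap f g ∘ GraphLikeSpace.inducedFun i
        (fun e => Sum.inl (j e, true)) = GraphLikeSpace.pointsMap Subtype.val Subtype.val := by
      funext p
      rcases p with v | ⟨r, e⟩
      · simp [GraphLikeSpace.pointsMap, GraphLikeSpace.inducedFun, hi]
      · simp [GraphLikeSpace.pointsMap, GraphLikeSpace.inducedFun, hj]
    rw [this]
    exact continuous_induced_dom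

theorem injective_subHom {V' E' : Type u} {G : GraphLikeSpace V' E'} {f : V' → FVertex M}
    {g : E' → M.E} {hG : G.top = Γ.space.top.induced (GraphLikeSpace.pointsMap f g)} {i : A → V'}
    {j : (Subtype.val ⁻¹' P : Set M.E) → E'} {hi : ∀ a, f (i a) = a} {hj : ∀ e, g (j e) = e} :
    Function.Injective (subHom h G f g hG i j hi hj).toFun := by
  have hi' : Function.Injective i := fun a b hab => Subtype.ext (by rw [← hi a, hab, hi b])
  have hj' : Function.Injective j := fun a b hab => Subtype.ext (by rw [← hj a, hab, hj b])
  intro p q hpq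
  rcases p with v | ⟨r, e⟩ <;> rcases q with w | ⟨r', e'⟩
  · exact congrArg _ (hi' (Points.vertex.inj hpq))
  · cases hpq
  · cases hpq
  · obtain ⟨h1, h2⟩ := Points.inner.inj hpq
    exact congrArg₂ _ h1 (hj' h2)

end GraphFramework

/-! ### Pseudo-circles from circuits -/

namespace GraphFramework

variable {α : Type u} {M : Matroid α} (Γ : GraphFramework M)

/-- The vertices of the pseudo-circle of the circuit `o`. -/
def circVertices (o : Set α) : Set (FVertex M) := {x | Γ.InCl o (col x)}

variable {Γ} {A : Set (FVertex M)} {P b s o F : Set α} {v w x y : Set α → ℤˣ} {e f : α}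

theorem circ_ends (Γ : GraphFramework M) (o : Set α) (e : M.E) (he : (e : α) ∈ o) :
    Γ.srcVertex e ∈ Γ.circVertices o ∧ Γ.tgtVertex e ∈ Γ.circVertices o :=
  ⟨InCl.of_end he (Or.inl rfl) fun _ hb => (col_srcVertex e hb).symm,
    InCl.of_end he (Or.inr rfl) fun _ hb => (col_tgtVertex e hb).symm⟩

theorem exists_isBase_of_isCircuit (ho : M.IsCircuit o) (he : e ∈ o) :
    ∃ s, M.IsBase s ∧ o \ {e} ⊆ s ∧ e ∉ s ∧ M.fundCircuit e s = o := by
  obtain ⟨s, hs, hos⟩ := (ho.sdiff_singleton_indep he).exists_isBase_superset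
  refine ⟨s, hs, hos, fun h => ho.not_indep (hs.indep.subset fun y hy => ?_),
    (ho.eq_fundCircuit_of_subset hs.indep fun y hy => ?_).symm⟩ <;> by_cases hye : y = e
  exacts [hye ▸ h, hos ⟨hy, hye⟩, Or.inl hye, Or.inr (hos ⟨hy, hye⟩)]

theorem lineVertices_eq_circVertices (hT : IsTame M) (hM : IsConnectedMatroid M)
    (hs : M.IsBase s) (ho : M.IsCircuit o) (he : e ∈ o) (hos : o \ {e} ⊆ s) :
    Γ.lineVertices s (Γ.src e) (Γ.tgt e) = Γ.circVertices o := by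
  ext x
  exact (inCl_iff_onLine hT hM hs ho he hos).symm

theorem circ_sdiff (hT : IsTame M) (hM : IsConnectedMatroid M) (ho : M.IsCircuit o) (he : e ∈ o) :
    IsCompact (ptsOf Γ (Γ.circVertices o) (o \ {e})) ∧
      IsPreconnected (ptsOf Γ (Γ.circVertices o) (o \ {e})) := by
  obtain ⟨s, hs, hos, -, -⟩ := exists_isBase_of_isCircuit ho he
  have heE := ho.subset_ground he
  have h1 := reg_end hT hM hs heE (Γ := Γ) (Or.inl rfl)
  have h2 := reg_end hT hM hs heE (Γ := Γ) (Or.inr rfl)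
  have h3 := isCompact_line hT hM hs h1 h2 (h1.sat h2 heE)
  have h4 := isPreconnected_line hT hM hs h1 h2 (h1.sat h2 heE)
  rw [lineVertices_eq_circVertices hT hM hs ho he hos, diffSet_src_tgt_eq hs ho hos] at h3 h4
  exact ⟨h3, h4⟩

theorem ptsOf_eq_union {e : M.E} (he : (e : α) ∈ P)
    (h : Γ.srcVertex e ∈ A ∧ Γ.tgtVertex e ∈ A) :
    ptsOf Γ A P = ptsOf Γ A (P \ {(e : α)}) ∪ range (Γ.space.ι e) := by
  refine subset_antisymm (fun p hp => ?_) (union_subset (fun p hp => ?_)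
    (range_ι_subset_ptsOf he h))
  · rcases p with v | ⟨r, f⟩
    · exact Or.inl hp
    · by_cases hfe : f = e
      · exact Or.inr (hfe ▸ inner_mem_range_ι f r)
      · exact Or.inl ⟨hp, fun h => hfe (Subtype.ext h)⟩
  · rcases p with v | ⟨r, f⟩
    exacts [hp, hp.1]

/-- Removing any one edge leaves a line, which is compact and connected. For two edges `e`, `f`
there is a fundamental cocircuit that meets `o` in `{e, f}` only, and it separates once both are
removed. -/
theorem isPseudoCircle_sub (hT : IsTame M) (hM : IsConnectedMatroid M) (ho : M.IsCircuit o) :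
    (Γ.sub (Γ.circVertices o) o (circ_ends Γ o)).IsPseudoCircle := by
  obtain ⟨e₀, he₀⟩ := ho.nonempty
  set e₁ : M.E := ⟨e₀, ho.subset_ground he₀⟩ with he₁
  have hends := circ_ends Γ o
  have hmem : (∀ e : M.E, (e : α) ∈ o → Γ.space.vert (Γ.srcVertex e) ∈
      ptsOf Γ (Γ.circVertices o) (o \ {(e : α)})) := fun e he => (hends e he).1
  have hunion := ptsOf_eq_union (e := e₁) he₀ (hends e₁ he₀)
  have hcoc : ∀ e ∈ o, ∀ s, M.IsBase s → M.fundCircuit e s = o → ∀ f ∈ s, f ∈ o →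
      o ∩ M.fundCocircuit f s ⊆ {e, f} ∧ e ∈ M.fundCocircuit f s := by
    intro e _ s hs hC f hf hfo
    rw [pair_comm, ← hC]
    exact ⟨fundCircuit_inter_fundCocircuit_subset hf,
      hs.mem_fundCocircuit_iff_mem_fundCircuit.2 (hC ▸ hfo)⟩
  refine ⟨compactSpace_sub ?_, connectedSpace_sub ?_ ⟨_, (hends e₁ he₀).1⟩, ⟨⟨e₁, he₀⟩⟩, ?_, ?_, ?_⟩
  · rw [hunion]
    exact (circ_sdiff hT hM ho he₀).1.union (isCompact_range (continuous_ι e₁))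
  · rw [hunion]
    exact (circ_sdiff hT hM ho he₀).2.union _ (hmem e₁ he₀) (src_mem_range_ι e₁)
      (isPreconnected_range_ι e₁)
  · intro e
    have hset : ({e} : Set (Subtype.val ⁻¹' o : Set M.E)) =
        {f : (Subtype.val ⁻¹' o : Set M.E) | (f.1 : α) ∈ ({(e : α)} : Set α)} := by
      ext f
      simp [Subtype.ext_iff]
    rw [hset]
    refine ⟨⟨(Γ.sub _ o hends).vert ⟨_, (hends e e.2).1⟩, fun _ _ _ h => by cases h⟩, ?_⟩
    rw [isPreconnected_minus_iff]
    exact (circ_sdiff hT hM ho e.2).2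
  · intro e f hef hcon
    have hset : ({e, f} : Set (Subtype.val ⁻¹' o : Set M.E)) =
        {g : (Subtype.val ⁻¹' o : Set M.E) | (g.1 : α) ∈ ({(e : α), (f : α)} : Set α)} := by
      ext g
      simp [Subtype.ext_iff]
    rw [hset] at hcon
    have hpre := isPreconnected_minus_iff.1 hcon.2
    obtain ⟨s, hs, hos, -, hC⟩ := exists_isBase_of_isCircuit ho e.2
    have hfs : (f : α) ∈ s := hos ⟨f.2, fun h => hef (Subtype.ext (Subtype.ext h.symm))⟩
    have hb := M.fundCocircuit_isCocircuit hfs hs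
    obtain ⟨h1, h2⟩ := hcoc e e.2 s hs hC f hfs f.2
    have := eq_of_isPreconnected hpre ⟨_, hb⟩ (fun r g hg hgb => hg.2 (h1 ⟨hg.1, hgb⟩))
      (v := Γ.srcVertex e) (w := Γ.tgtVertex e) (hends e e.2).1 (hends e e.2).2
    exact (src_eq_tgt_iff (Γ := Γ)).1 this h2
  · intro x y hxy
    obtain ⟨s, hs, hos, hes, hC⟩ := exists_isBase_of_isCircuit ho he₀
    have hx := (inCl_iff_onLine hT hM hs ho he₀ hos).1 x.2
    have hy := (inCl_iff_onLine hT hM hs ho he₀ hos).1 y.2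
    obtain ⟨f, hf⟩ := exists_mem_diffSet_of_ne hx hy (exists_col_ne fun h => hxy (Subtype.ext h))
    have hfo := hx.diffSet_subset hy hf
    rw [diffSet_src_tgt_eq hs ho hos] at hfo
    obtain ⟨h1, h2⟩ := hcoc e₀ he₀ s hs hC f hf.1 hfo.1
    refine ⟨⟨e₁, he₀⟩, ⟨⟨f, ho.subset_ground hfo.1⟩, hfo.1⟩, fun h => hfo.2 ?_, ?_⟩
    · exact (congrArg (fun e => (e.1 : α)) h).symm
    · have := separatedBy_sub (h := hends) (M.fundCocircuit_isCocircuit hf.1 hs) h1 hf.2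
      convert this
      ext g
      simp [Subtype.ext_iff, he₁]

/-- A limit of a circuit lies on a pseudo-circle. -/
theorem onPseudoCircle_of_inCl (hT : IsTame M) (hM : IsConnectedMatroid M) (ho : M.IsCircuit o)
    {v : FVertex M} (hv : Γ.InCl o (col v)) : Γ.space.OnPseudoCircle v := by
  refine ⟨_, _, Γ.sub _ o (circ_ends Γ o), subHom (circ_ends Γ o) Γ.space id id ?_ Subtype.val
    Subtype.val (fun _ => rfl) (fun _ => rfl), isPseudoCircle_sub hT hM ho, injective_subHom,
    Points.vertex ⟨v, hv⟩, rfl⟩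
  have : (GraphLikeSpace.pointsMap id id : Points (FVertex M) M.E → _) = id := by
    funext p
    rcases p with v | ⟨r, e⟩ <;> rfl
  rw [this]
  exact (@induced_id _ Γ.space.top).symm

end GraphFramework

/-! ### Vertices on pseudo-circles are limits of circuits -/

namespace GraphFramework

variable {α : Type u} {M : Matroid α} {Γ : GraphFramework M} {b s o : Set α} {e f : α}
  {K : Set Γ.space.Pts}

theorem exists_isOpen_vert_inner (v : FVertex M) (r : Ioo (0 : ℝ) 1) (e : M.E)
    (h : ∃ b, M.IsCocircuit b ∧ (e : α) ∈ b) : ∃ U U' : Set Γ.space.Pts, IsOpen U ∧ IsOpen U' ∧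
      Γ.space.vert v ∈ U ∧ Γ.space.inner r e ∈ U' ∧ Disjoint U U' := by
  obtain ⟨b, hb, heb⟩ := h
  have h0 := r.2.1
  have h1 := r.2.2
  obtain ⟨δ, hδ0, hδr, hδr'⟩ : ∃ δ : ℝ, 0 < δ ∧ δ < r ∧ δ < 1 - r := by
    obtain ⟨δ, h, h'⟩ := exists_between (show (0 : ℝ) < min (r : ℝ) (1 - r) from
      lt_min h0 (by linarith))
    exact ⟨δ, h, h'.trans_le (min_le_left _ _), h'.trans_le (min_le_right _ _)⟩
  refine ⟨Γ.side ⟨b, hb⟩ (v ⟨b, hb⟩) fun _ => ⟨δ, hδ0, by linarith⟩,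
    (fun r' => Γ.space.inner r' e) '' {r' | δ < (r' : ℝ) ∧ (r' : ℝ) < 1 - δ}, isOpen_side _ _ _,
    Γ.space.isOpen_inner e _ ?_, rfl, ⟨r, ⟨hδr, by linarith⟩, rfl⟩, ?_⟩
  · exact (isOpen_lt continuous_const continuous_subtype_val).inter
      (isOpen_lt continuous_subtype_val continuous_const)
  · refine disjoint_left.2 ?_
    rintro p hp ⟨r', ⟨h1, h2⟩, rfl⟩
    rcases hp with hp | hp | hp
    · exact hp.1 heb
    · exact absurd hp.2.2 (not_lt.2 h2.le)
    · exact absurd hp.2.2 (not_lt.2 h1.le)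

/-- A cocircuit through `e` is what allows a neighbourhood of a vertex to stay near the ends of `e`,
away from a given inner point. -/
theorem t2Space_space (h : ∀ e ∈ M.E, ∃ b, M.IsCocircuit b ∧ e ∈ b) : T2Space Γ.space.Pts := by
  refine ⟨fun p q hpq => ?_⟩
  rcases p with v | ⟨r, e⟩ <;> rcases q with w | ⟨r', e'⟩
  · obtain ⟨U, U', hU, hU', hd, -, hv, hw⟩ := Γ.space.separated v w fun h => hpq (h ▸ rfl)
    exact ⟨U, U', hU, hU', hv, hw, hd⟩
  · exact exists_isOpen_vert_inner v r' e' (h e' e'.2)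
  · obtain ⟨U, U', hU, hU', hv, hr, hd⟩ := exists_isOpen_vert_inner (Γ := Γ) w r e (h e e.2)
    exact ⟨U', U, hU', hU, hr, hv, hd.symm⟩
  · by_cases hee : e = e'
    · subst hee
      obtain ⟨U, U', hU, hU', hr, hr', hd⟩ := t2_separation (x := r) (y := r')
        fun h => hpq (h ▸ rfl)
      refine ⟨_, _, Γ.space.isOpen_inner e U hU, Γ.space.isOpen_inner e U' hU', ⟨r, hr, rfl⟩,
        ⟨r', hr', rfl⟩, ?_⟩
      refine disjoint_left.2 ?_
      rintro _ ⟨t, ht, rfl⟩ ⟨t', ht', htt⟩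
      cases htt
      exact disjoint_left.1 hd ht ht'
    · refine ⟨_, _, isOpen_innerPts e, isOpen_innerPts e', ⟨r, rfl⟩, ⟨r', rfl⟩, ?_⟩
      refine disjoint_left.2 ?_
      rintro _ ⟨t, rfl⟩ ⟨t', htt⟩
      cases htt
      exact hee rfl

/-- The inner points of an edge. -/
def innerPts (Γ : GraphFramework M) (e : M.E) : Set Γ.space.Pts := range fun r => Γ.space.inner r e

/-- The elements of `M` that are edges with inner points in `K`. -/
def edgesOf (K : Set Γ.space.Pts) : Set α := {f | ∃ h : f ∈ M.E, (innerPts Γ ⟨f, h⟩ ∩ K).Nonempty}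

/-- The properties of the image of a pseudo-circle that are used below. -/
structure IsCircleImage (K : Set Γ.space.Pts) : Prop where
  isCompact : IsCompact K
  isClosed : IsClosed K
  isPreconnected : IsPreconnected K
  nonempty : (edgesOf K).Nonempty
  subset : ∀ f : M.E, (f : α) ∈ edgesOf K → innerPts Γ f ⊆ K
  one : ∀ f : M.E, (f : α) ∈ edgesOf K → IsPreconnected (K \ innerPts Γ f)
  two : ∀ e f : M.E, (e : α) ∈ edgesOf K → (f : α) ∈ edgesOf K → e ≠ f →
    ¬ IsPreconnected (K \ (innerPts Γ e ∪ innerPts Γ f))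

theorem range_ι_eq_closure (e : M.E) : range (Γ.space.ι e) ⊆ closure (innerPts Γ e) := by
  have h1 : Γ.space.ι e '' {r | (r : ℝ) ∈ Ioo (0 : ℝ) 1} ⊆ innerPts Γ e := by
    rintro _ ⟨r, hr, rfl⟩
    have hr' : (r : ℝ) ∈ Ioo (0 : ℝ) 1 := hr
    refine ⟨⟨r, hr'⟩, ?_⟩
    rw [GraphLikeSpace.ι, edgeMap, dif_pos hr']
    rfl
  have h2 : closure {r : unitInterval | (r : ℝ) ∈ Ioo (0 : ℝ) 1} = univ := by
    have : {r : unitInterval | (r : ℝ) ∈ Ioo (0 : ℝ) 1} = Ioo 0 1 := by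
      ext r
      exact ⟨fun h => ⟨h.1, h.2⟩, fun h => ⟨h.1, h.2⟩⟩
    rw [this, closure_Ioo zero_ne_one]
    exact eq_univ_of_forall fun r => ⟨r.2.1, r.2.2⟩
  refine Subset.trans ?_ (closure_mono h1)
  rw [← image_univ, ← h2]
  exact image_closure_subset_closure_image (continuous_ι e)

theorem IsCircleImage.range_subset (hK : IsCircleImage K) (f : M.E) (hf : (f : α) ∈ edgesOf K) :
    range (Γ.space.ι f) ⊆ K :=
  (range_ι_eq_closure f).trans (closure_minimal (hK.subset f hf) hK.isClosed)

/-- If the edges were independent, then in a base containing them the fundamental cocircuit of an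
edge `e` would contain no other edge of `K`, and would separate the ends of `e` in `K` without `e`.
-/
theorem IsCircleImage.exists_isCircuit (hK : IsCircleImage K) :
    ∃ o, o ⊆ edgesOf K ∧ M.IsCircuit o := by
  have hE : edgesOf K ⊆ M.E := fun f hf => hf.1
  by_contra hcon
  have hi : M.Indep (edgesOf K) := by
    rw [Matroid.indep_iff_forall_subset_not_isCircuit hE]
    exact fun C hC hCc => hcon ⟨C, hC, hCc⟩
  obtain ⟨s, hs, hos⟩ := hi.exists_isBase_superset
  obtain ⟨e, he⟩ := hK.nonempty
  have hb := M.fundCocircuit_isCocircuit (hos he) hs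
  have hr := hK.range_subset ⟨e, hE he⟩ he
  have := eq_of_isPreconnected (hK.one ⟨e, hE he⟩ he) ⟨_, hb⟩
    (v := Γ.srcVertex ⟨e, hE he⟩) (w := Γ.tgtVertex ⟨e, hE he⟩) (fun r f hf hfb => ?_)
    ⟨hr (src_mem_range_ι _), fun ⟨_, h⟩ => by cases h⟩
    ⟨hr (tgt_mem_range_ι _), fun ⟨_, h⟩ => by cases h⟩
  · exact (src_eq_tgt_iff (Γ := Γ)).1 this (M.mem_fundCocircuit e s)
  · have hfK : (f : α) ∈ edgesOf K := ⟨f.2, _, ⟨r, rfl⟩, hf.1⟩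
    have hfe : (f : α) ∈ ({e} : Set α) := (M.fundCocircuit_inter_eq (hos he)) ▸ ⟨hfb, hos hfK⟩
    exact hf.2 ⟨r, by rw [show f = ⟨e, hE he⟩ from Subtype.ext hfe]⟩

/-- `K` contains the ends of its edges and is compact, so it contains their limits. -/
theorem IsCircleImage.circVertices_subset (hK : IsCircleImage K) (ho : o ⊆ edgesOf K)
    {v : FVertex M} (hv : v ∈ Γ.circVertices o) : Γ.space.vert v ∈ K := by
  by_contra hcon
  obtain ⟨B, hB⟩ := (hK.isCompact.inter_right (isClosed_range_vert (Γ := Γ))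
    ).elim_finite_subfamily_closed (fun b => Γ.space.vert '' {y : FVertex M | y b = v b})
    (fun b => isClosed_vert_eq b _) (by
      rw [eq_empty_iff_forall_notMem]
      rintro _ ⟨⟨hp, y, rfl⟩, ht⟩
      refine hcon ?_
      have : y = v := by
        funext b
        obtain ⟨z, hz, hzy⟩ := mem_iInter.1 ht b
        cases hzy
        exact hz
      rwa [← this])
  obtain ⟨e, heo, y, hy, hyv⟩ := hv (Subtype.val '' (B : Set _)) (B.finite_toSet.image _) (by
    rintro _ ⟨b, -, rfl⟩
    exact b.2)
  obtain ⟨heE, hne⟩ := ho heo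
  have hr := hK.range_subset ⟨e, heE⟩ (ho heo)
  have hyK : Γ.space.vert (toVertex M y) ∈ K := by
    rcases hy with rfl | rfl
    exacts [hr (src_mem_range_ι _), hr (tgt_mem_range_ι _)]
  have : Γ.space.vert (toVertex M y) ∈ (∅ : Set Γ.space.Pts) := by
    rw [← hB]
    refine ⟨⟨hyK, _, rfl⟩, mem_iInter₂.2 fun b hb => ⟨_, ?_, rfl⟩⟩
    have := hyv b (mem_image_of_mem _ hb)
    rwa [col_apply b.2] at this
  exact this

/-- Suppose that `f` is an edge of `K` outside `o`, and let `e ∈ o`. The line of `o` without `e` is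
a connected part of `K` containing both ends of `e`. So a separation of `K` without `e` and `f`
would extend over `e` to one of `K` without `f`; hence removing both edges would not disconnect `K`.
-/
theorem IsCircleImage.edgesOf_subset (hT : IsTame M) (hM : IsConnectedMatroid M)
    (hT2 : T2Space Γ.space.Pts) (hK : IsCircleImage K) (ho : M.IsCircuit o)
    (hoK : o ⊆ edgesOf K) : edgesOf K ⊆ o := by
  intro f hf
  by_contra hfo
  obtain ⟨e, heo⟩ := ho.nonempty
  obtain ⟨heE, -⟩ := hoK heo
  have hfE := hf.1
  have hends := circ_ends Γ o ⟨e, heE⟩ heo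
  have hef : (⟨e, heE⟩ : M.E) ≠ ⟨f, hfE⟩ := fun h => by
    have h' : e = f := congrArg Subtype.val h
    exact hfo (h' ▸ heo)
  have hrK := hK.range_subset ⟨e, heE⟩ (hoK heo)
  set S := ptsOf Γ (Γ.circVertices o) (o \ {e}) with hS
  set T := K \ (innerPts Γ ⟨e, heE⟩ ∪ innerPts Γ ⟨f, hfE⟩) with hTdef
  have hST : S ⊆ T := by
    intro p hp
    rcases p with v | ⟨r, g⟩
    · refine ⟨hK.circVertices_subset hoK hp, ?_⟩
      rintro (⟨r, h⟩ | ⟨r, h⟩) <;> cases h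
    · refine ⟨hK.subset g (hoK hp.1) ⟨r, rfl⟩, ?_⟩
      rintro (⟨r, h⟩ | ⟨r, h⟩) <;> cases h
      exacts [hp.2 rfl, hfo hp.1]
  have hSpre : IsPreconnected S := (circ_sdiff hT hM ho heo).2
  have hsrc : Γ.space.vert (Γ.srcVertex ⟨e, heE⟩) ∈ S := hends.1
  have htgt : Γ.space.vert (Γ.tgtVertex ⟨e, heE⟩) ∈ S := hends.2
  have hTc : IsClosed T := hK.isClosed.sdiff ((isOpen_innerPts _).union (isOpen_innerPts _))
  have hιc : IsClosed (range (Γ.space.ι ⟨e, heE⟩)) := (isCompact_range (continuous_ι _)).isClosed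
  have hιT : range (Γ.space.ι ⟨e, heE⟩) ∩ T ⊆ S := by
    rintro p ⟨hp, hpT⟩
    have := range_ι_subset _ hp
    rcases p with v | ⟨r, g⟩
    · rcases this with rfl | rfl
      exacts [hsrc, htgt]
    · refine absurd (Or.inl ⟨r, ?_⟩) hpT.2
      rw [show g = ⟨e, heE⟩ from Subtype.ext this]
      rfl
  have key : ∀ t t', IsClosed t → IsClosed t' → T ⊆ t ∪ t' → (T ∩ t').Nonempty →
      T ∩ (t ∩ t') = ∅ → S ∩ t' = ∅ → False := by
    intro t t' ht ht' hcov hne hemp hSt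
    obtain ⟨p, -, hp, hp'⟩ := isPreconnected_closed_iff.1 (hK.one ⟨f, hfE⟩ hf)
      ((T ∩ t) ∪ range (Γ.space.ι ⟨e, heE⟩)) (T ∩ t') ((hTc.inter ht).union hιc) (hTc.inter ht')
      (by
        rintro p ⟨hpK, hpf⟩
        by_cases hpe : p ∈ innerPts Γ ⟨e, heE⟩
        · obtain ⟨r, rfl⟩ := hpe
          exact Or.inl (Or.inr (inner_mem_range_ι _ r))
        · have hpT : p ∈ T := ⟨hpK, fun h => h.elim hpe hpf⟩
          rcases hcov hpT with h | h
          exacts [Or.inl (Or.inl ⟨hpT, h⟩), Or.inr ⟨hpT, h⟩])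
      ⟨_, ⟨hrK (src_mem_range_ι _), fun ⟨_, h⟩ => by cases h⟩, Or.inr (src_mem_range_ι _)⟩
      (by
        obtain ⟨p, hpT, hp⟩ := hne
        exact ⟨p, ⟨hpT.1, fun h => hpT.2 (Or.inr h)⟩, hpT, hp⟩)
    rcases hp with hp | hp
    · exact (eq_empty_iff_forall_notMem.1 hemp) p ⟨hp.1, hp.2, hp'.2⟩
    · exact (eq_empty_iff_forall_notMem.1 hSt) p ⟨hιT ⟨hp, hp'.1⟩, hp'.2⟩
  refine hK.two ⟨e, heE⟩ ⟨f, hfE⟩ (hoK heo) hf hef ?_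
  rw [isPreconnected_closed_iff]
  intro t t' ht ht' hcov hTt hTt'
  by_contra hemp
  rw [not_nonempty_iff_eq_empty] at hemp
  by_cases h1 : (S ∩ t').Nonempty
  · by_cases h2 : (S ∩ t).Nonempty
    · obtain ⟨p, hp, hpt⟩ := isPreconnected_closed_iff.1 hSpre t t' ht ht' (hST.trans hcov) h2 h1
      exact (eq_empty_iff_forall_notMem.1 hemp) p ⟨hST hp, hpt⟩
    · exact key t' t ht' ht (by rwa [union_comm]) hTt (by rwa [inter_comm t'])
        (not_nonempty_iff_eq_empty.1 h2)
  · exact key t t' ht ht' hcov hTt' hemp (not_nonempty_iff_eq_empty.1 h1)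

/-- Otherwise some neighbourhood of `v` meets `K` in vertices only: an inner point on all the chosen
sides would give an end-vertex on them, the choice of end depending on the half of the edge. Then
the vertices of `K` that agree with `v` on `B` form a proper nonempty clopen part of `K`. -/
theorem IsCircleImage.inCl (hK : IsCircleImage K) (hKo : edgesOf K ⊆ o) {v : FVertex M} (hv : Γ.space.vert v ∈ K) : Γ.InCl o (col v) := by
  intro B hB hBc
  by_contra hcon
  push Not at hcon
  set B' : Set {b : Set α // M.IsCocircuit b} := Subtype.val ⁻¹' B with hB'
  have hB'fin : B'.Finite := hB.preimage Subtype.val_injective.injOn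
  set U : Set Γ.space.Pts := ⋂ b ∈ B', Γ.half b (v b) with hU
  set V : Set Γ.space.Pts := range Γ.space.vert ∩ ⋂ b ∈ B', Γ.space.vert '' {y | y b = v b} with hV
  have hUo : IsOpen U := hB'fin.isOpen_biInter fun b _ => isOpen_half b _
  have hVc : IsClosed V := isClosed_range_vert.inter
    (isClosed_biInter fun b _ => isClosed_vert_eq b _)
  have hKU : ∀ p ∈ K, p ∈ U → p ∈ V := by
    intro p hp hpU
    rw [mem_iInter₂] at hpU
    rcases p with y | ⟨r, e⟩
    · exact ⟨⟨y, rfl⟩, mem_iInter₂.2 fun b hb => ⟨y, hpU b hb, rfl⟩⟩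
    · exfalso
      have heo := hKo ⟨e.2, _, ⟨r, rfl⟩, hp⟩
      have key : ∃ y, (y = Γ.src e ∨ y = Γ.tgt e) ∧ ∀ b ∈ B, y b = col v b := by
        by_cases hr : 1 / 2 < (r : ℝ)
        · refine ⟨_, Or.inr rfl, fun b hb => ?_⟩
          rw [col_apply (hBc b hb)]
          rcases hpU ⟨b, hBc b hb⟩ hb with h | h | h
          · rw [tgt_of_notMem h.1, h.2]
          · rw [tgt, if_pos h.1, h.2.1]
          · exact absurd h.2.2 (not_lt.2 hr.le)
        · refine ⟨_, Or.inl rfl, fun b hb => ?_⟩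
          rw [col_apply (hBc b hb)]
          rcases hpU ⟨b, hBc b hb⟩ hb with h | h | h
          · rw [src_of_notMem h.1, h.2]
          · have h3 : (1 : ℝ) - 1 / 2 < r := h.2.2
            norm_num at h3 hr
            exact absurd h3 (not_lt.2 hr)
          · rw [src, if_pos h.1, h.2.1, neg_neg]
      obtain ⟨y, hy, hyv⟩ := key
      obtain ⟨b, hb, hne⟩ := hcon e heo y hy
      exact hne (hyv b hb)
  obtain ⟨f, hfE, _, ⟨r, rfl⟩, hfK⟩ := hK.nonempty
  obtain ⟨p, hp, hpU, hpV⟩ := hK.isPreconnected U Vᶜ hUo hVc.isOpen_compl (by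
    intro p hp
    by_cases hpV : p ∈ V
    · left
      obtain ⟨⟨y, rfl⟩, hy⟩ := hpV
      refine mem_iInter₂.2 fun b hb => ?_
      obtain ⟨z, hz, hzy⟩ := mem_iInter₂.1 hy b hb
      cases hzy
      exact hz
    · exact Or.inr hpV)
    ⟨_, hv, mem_iInter₂.2 fun b _ => rfl⟩ ⟨_, hfK, fun h => by
      obtain ⟨⟨y, hy⟩, -⟩ := h
      cases hy⟩
  exact hpV (hKU p hp hpU)

/-- The reflection of the open unit interval. -/
def flip (r : Ioo (0 : ℝ) 1) : Ioo (0 : ℝ) 1 :=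
  ⟨1 - r, by linarith [r.2.2], by linarith [r.2.1]⟩

/-- An injective map cannot send an edge to a vertex, so edges go onto edges. As the target is
Hausdorff, the map is a closed embedding and transports the connectedness conditions. -/
theorem isCircleImage_range {CV CE : Type u} {C : GraphLikeSpace CV CE}
    (hT2 : T2Space Γ.space.Pts) (hC : C.IsPseudoCircle) (φ : GraphLikeSpace.Hom C Γ.space)
    (hφ : Function.Injective φ.toFun) : IsCircleImage (range φ.toFun) := by
  have hcont : Continuous φ.toFun := φ.continuous_inducedFun
  have hcompact := hC.compact
  have hconn := hC.connected
  have hemb : IsClosedEmbedding φ.toFun := hcont.isClosedEmbedding hφ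
  have hedge : ∀ e', ∃ f : M.E, φ.toFun '' (range fun r => C.inner r e') = innerPts Γ f := by
    intro e'
    rw [← range_comp]
    rcases hφe : φ.onE e' with ⟨f, β⟩ | v
    · refine ⟨f, ?_⟩
      cases β
      · have hval : ∀ r, φ.toFun (C.inner r e') = Γ.space.inner (flip r) f := fun r => by
          change GraphLikeSpace.inducedFun φ.onV φ.onE (Points.inner r e') = _
          rw [GraphLikeSpace.inducedFun, hφe]
          rfl
        refine subset_antisymm ?_ ?_
        · rintro _ ⟨r, rfl⟩
          exact ⟨flip r, (hval r).symm⟩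
        · rintro _ ⟨r, rfl⟩
          refine ⟨flip r, (hval _).trans ?_⟩
          rw [show flip (flip r) = r from Subtype.ext (by simp [flip])]
      · refine congrArg range (funext fun r => ?_)
        change GraphLikeSpace.inducedFun φ.onV φ.onE (Points.inner r e') = _
        rw [GraphLikeSpace.inducedFun, hφe]
        rfl
    · have hval : ∀ r, φ.toFun (C.inner r e') = Γ.space.vert v := fun r => by
        change GraphLikeSpace.inducedFun φ.onV φ.onE (Points.inner r e') = _
        rw [GraphLikeSpace.inducedFun, hφe]
        rfl
      have := hφ ((hval ⟨1 / 2, by norm_num, by norm_num⟩).trans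
        (hval ⟨1 / 3, by norm_num, by norm_num⟩).symm)
      have h := congrArg Subtype.val (Points.inner.inj this).1
      norm_num at h
  have hedge' : ∀ f : M.E, (f : α) ∈ edgesOf (range φ.toFun) →
      ∃ e', φ.toFun '' (range fun r => C.inner r e') = innerPts Γ f := by
    rintro f ⟨_, _, ⟨r, rfl⟩, ⟨q, hq⟩⟩
    rcases q with v | ⟨r', e'⟩
    · cases hq
    · obtain ⟨g, hg⟩ := hedge e'
      have hmem : Γ.space.inner r f ∈ innerPts Γ g := by
        rw [← hg]
        exact ⟨_, ⟨r', rfl⟩, hq⟩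
      obtain ⟨r'', h⟩ := hmem
      cases h
      exact ⟨e', hg⟩
  refine ⟨isCompact_range hcont, hemb.isClosed_range, isPreconnected_range hcont, ?_, ?_, ?_, ?_⟩
  · obtain ⟨e'⟩ := hC.nonempty_edges
    obtain ⟨f, hf⟩ := hedge e'
    refine ⟨f, f.2, ?_⟩
    rw [inter_eq_left.2 (hf.symm.subset.trans (image_subset_range _ _))]
    exact ⟨_, ⟨1 / 2, by norm_num, by norm_num⟩, rfl⟩
  · intro f hf
    obtain ⟨e', he'⟩ := hedge' f hf
    exact he'.symm.subset.trans (image_subset_range _ _)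
  · intro f hf
    obtain ⟨e', he'⟩ := hedge' f hf
    have hset : C.minus {e'} = univ \ range fun r => C.inner r e' := by
      ext p
      exact ⟨fun h => ⟨trivial, fun ⟨r, hr⟩ => h e' rfl r hr.symm⟩,
        fun h e he r hr => h.2 ⟨r, by rw [hr, show e = e' from he]⟩⟩
    rw [← he', ← image_univ, ← image_sdiff hφ, ← hset]
    exact (hC.minus_one e').isPreconnected.image _ hcont.continuousOn
  · intro e f he hf hef hpre
    obtain ⟨e', he'⟩ := hedge' e he
    obtain ⟨f', hf'⟩ := hedge' f hf
    have hef' : e' ≠ f' := by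
      rintro rfl
      have hmem : Γ.space.inner ⟨1 / 2, by norm_num, by norm_num⟩ e ∈ innerPts Γ f := by
        rw [← hf', he']
        exact ⟨_, rfl⟩
      obtain ⟨r, hr⟩ := hmem
      cases hr
      exact hef rfl
    have hset : C.minus {e', f'} =
        univ \ ((range fun r => C.inner r e') ∪ range fun r => C.inner r f') := by
      ext p
      constructor
      · refine fun h => ⟨trivial, ?_⟩
        rintro (⟨r, hr⟩ | ⟨r, hr⟩)
        exacts [h e' (Or.inl rfl) r hr.symm, h f' (Or.inr rfl) r hr.symm]
      · rintro h g (rfl | rfl) r hr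
        exacts [h.2 (Or.inl ⟨r, hr.symm⟩), h.2 (Or.inr ⟨r, hr.symm⟩)]
    rw [← he', ← hf', ← image_union, ← image_univ, ← image_sdiff hφ, ← hset,
      hemb.isInducing.isPreconnected_image] at hpre
    exact hC.minus_two e' f' hef' ⟨⟨C.vert (C.src e'), fun _ _ _ h => by cases h⟩, hpre⟩

/-- An element in no cocircuit is a loop and forms by itself a set closed under fundamental
circuits, so it would be the whole ground set. -/
theorem exists_isCocircuit_mem (hM : IsConnectedMatroid M) (hb : M.IsCocircuit b) (he : e ∈ M.E) :
    ∃ c, M.IsCocircuit c ∧ e ∈ c := by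
  by_contra hcon
  push Not at hcon
  obtain ⟨s, hs⟩ := M.exists_isBase
  have hes : e ∉ s := fun h =>
    hcon _ (M.fundCocircuit_isCocircuit h hs) (M.mem_fundCocircuit e s)
  have hsub := hM.ground_subset hs (K := {e}) (singleton_subset_iff.2 he) ⟨e, rfl⟩ (by
    rintro x hx hxs y hy rfl
    rcases M.fundCircuit_subset_insert _ _ hy with rfl | h
    · intro z hz
      rcases M.fundCircuit_subset_insert _ _ hz with h | h
      · exact h
      · exact absurd (hs.mem_fundCocircuit_iff_mem_fundCircuit.2 hz)
          (hcon _ (M.fundCocircuit_isCocircuit h hs))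
    · exact absurd h hes)
  obtain ⟨y, hy⟩ := hb.nonempty
  exact hcon b hb (mem_singleton_iff.1 (hsub (hb.subset_ground hy)) ▸ hy)

/-- A vertex on a pseudo-circle is an end-vertex of an edge or a limit of a circuit. -/
theorem exists_end_or_inCl_of_onPseudoCircle (hT : IsTame M) (hM : IsConnectedMatroid M)
    {v : FVertex M} (hv : Γ.space.OnPseudoCircle v) :
    (∃ e : M.E, v = Γ.srcVertex e ∨ v = Γ.tgtVertex e) ∨
      ∃ o, M.IsCircuit o ∧ Γ.InCl o (col v) := by
  obtain ⟨CV, CE, C, φ, hC, hφ, hvφ⟩ := hv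
  by_cases hne : ∃ b, M.IsCocircuit b
  · obtain ⟨b, hb⟩ := hne
    have hT2 := t2Space_space (Γ := Γ) fun e he => exists_isCocircuit_mem hM hb he
    have hK := isCircleImage_range hT2 hC φ hφ
    obtain ⟨o, hoK, ho⟩ := hK.exists_isCircuit
    exact Or.inr ⟨o, ho, hK.inCl (hK.edgesOf_subset hT hM hT2 ho hoK) hvφ⟩
  -- Without cocircuits there is only one vertex, and the pseudo-circle supplies an edge for it to
  -- be an end of.
  · left
    obtain ⟨e'⟩ := hC.nonempty_edges
    have hsub : ∀ v w : FVertex M, v = w := fun v w => funext fun b => (hne ⟨_, b.2⟩).elim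
    rcases hφe : φ.onE e' with ⟨f, β⟩ | w
    · exact ⟨f, Or.inl (hsub _ _)⟩
    · have hval : ∀ r, φ.toFun (C.inner r e') = Γ.space.vert w := fun r => by
        change GraphLikeSpace.inducedFun φ.onV φ.onE (Points.inner r e') = _
        rw [GraphLikeSpace.inducedFun, hφe]
        rfl
      have := hφ ((hval ⟨1 / 2, by norm_num, by norm_num⟩).trans
        (hval ⟨1 / 3, by norm_num, by norm_num⟩).symm)
      have h := congrArg Subtype.val (Points.inner.inj this).1
      norm_num at h

end GraphFramework

/-! ### Pseudo-arc connected spaces are connected -/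

namespace GraphLikeSpace

variable {V E : Type u} {G : GraphLikeSpace V E}

theorem ι_of_mem {e : E} {x : unitInterval} (h : (x : ℝ) ∈ Ioo (0 : ℝ) 1) :
    G.ι e x = G.inner ⟨x, h⟩ e := by
  rw [ι, edgeMap, dif_pos h]
  rfl

theorem ι_of_eq_zero {e : E} {x : unitInterval} (h : (x : ℝ) = 0) : G.ι e x = G.vert (G.src e) := by
  rw [ι, edgeMap, dif_neg (fun h' => h'.1.ne' h), if_pos h.le]
  rfl

/-- An inner point of an edge is joined to an end-vertex by an arc of the edge. -/
theorem exists_arc_to_src (G : GraphLikeSpace V E) (e : E) (r : Ioo (0 : ℝ) 1) :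
    ∃ γ : unitInterval → G.Pts, Continuous γ ∧ Function.Injective γ ∧ range γ ⊆ range (G.ι e) ∧
      γ 0 = G.inner r e ∧ γ 1 = G.vert (G.src e) := by
  have h0 := r.2.1
  have h1 := r.2.2
  have hmem : ∀ t : unitInterval, (r : ℝ) * (1 - t) ∈ unitInterval := fun t =>
    ⟨mul_nonneg h0.le (by linarith [t.2.2]), by nlinarith [t.2.1, t.2.2]⟩
  have hlt : ∀ t : unitInterval, (r : ℝ) * (1 - t) < 1 := fun t => by nlinarith [t.2.1, t.2.2]
  refine ⟨fun t => G.ι e ⟨r * (1 - t), hmem t⟩, ?_, ?_, ?_, ?_, ?_⟩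
  · have hc : Continuous (G.ι e) := G.continuous_edgeMap e
    exact hc.comp (Continuous.subtype_mk (by fun_prop) _)
  · intro t t' htt
    have key : (r : ℝ) * (1 - t) = r * (1 - t') := by
      rcases (hmem t).1.eq_or_lt with h | h <;> rcases (hmem t').1.eq_or_lt with h' | h'
      · exact h.symm.trans h'
      · have e1 := ι_of_eq_zero (G := G) (e := e) (x := ⟨_, hmem t⟩) h.symm
        have e2 := ι_of_mem (G := G) (e := e) (x := ⟨_, hmem t'⟩) ⟨h', hlt t'⟩
        cases e1.symm.trans (htt.trans e2)
      · have e1 := ι_of_mem (G := G) (e := e) (x := ⟨_, hmem t⟩) ⟨h, hlt t⟩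
        have e2 := ι_of_eq_zero (G := G) (e := e) (x := ⟨_, hmem t'⟩) h'.symm
        cases e1.symm.trans (htt.trans e2)
      · have e1 := ι_of_mem (G := G) (e := e) (x := ⟨_, hmem t⟩) ⟨h, hlt t⟩
        have e2 := ι_of_mem (G := G) (e := e) (x := ⟨_, hmem t'⟩) ⟨h', hlt t'⟩
        exact congrArg Subtype.val (Points.inner.inj (e1.symm.trans (htt.trans e2))).1
    have := mul_left_cancel₀ h0.ne' key
    exact Subtype.ext (by linarith)
  · rintro _ ⟨t, rfl⟩
    exact ⟨_, rfl⟩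
  · have h : ((⟨r * (1 - (0 : unitInterval)), hmem 0⟩ : unitInterval) : ℝ) = r := by simp
    refine (ι_of_mem (by rw [h]; exact r.2)).trans ?_
    congr 1
    exact Subtype.ext h
  · exact ι_of_eq_zero (by simp)

theorem PseudoArc.isPreconnected_image {v w : V} (P : PseudoArc G v w) : IsPreconnected P.image := by
  have hc : Continuous P.map.toFun := P.map.continuous_inducedFun
  have : ConnectedSpace P.line.Pts := P.isPseudoLine.connected
  exact isPreconnected_range hc

theorem PseudoArc.start_mem {v w : V} (P : PseudoArc G v w) : G.vert v ∈ P.image :=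
  ⟨P.line.vert P.s, congrArg Points.vertex P.map_start⟩

theorem PseudoArc.end_mem {v w : V} (P : PseudoArc G v w) : G.vert w ∈ P.image :=
  ⟨P.line.vert P.t, congrArg Points.vertex P.map_end⟩

theorem IsPseudoArcConnected.preconnectedSpace (h : G.IsPseudoArcConnected univ) :
    PreconnectedSpace G.Pts := by
  refine ⟨?_⟩
  rcases h with ⟨e, -, h⟩ | ⟨hv, he⟩
  · exact h.isPreconnected
  have hp : ∀ p : G.Pts, ∃ v T, p ∈ T ∧ G.vert v ∈ T ∧ IsPreconnected T := by
    intro p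
    rcases p with v | ⟨r, e⟩
    · exact ⟨v, {G.vert v}, rfl, rfl, isPreconnected_singleton⟩
    · obtain ⟨γ, hγ, -, -, h0, h1⟩ := he e r trivial
      rcases h1 with h1 | h1
      exacts [⟨_, range γ, ⟨0, h0⟩, ⟨1, h1⟩, isPreconnected_range hγ⟩,
        ⟨_, range γ, ⟨0, h0⟩, ⟨1, h1⟩, isPreconnected_range hγ⟩]
  refine isPreconnected_of_forall_pair fun p _ q _ => ?_
  obtain ⟨v, T, hpT, hvT, hT⟩ := hp p
  obtain ⟨w, T', hqT, hwT, hT'⟩ := hp q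
  obtain ⟨P, -⟩ := hv v w trivial trivial
  exact ⟨T ∪ P.image ∪ T', subset_univ _, Or.inl (Or.inl hpT), Or.inr hqT,
    (hT.union _ hvT P.start_mem P.isPreconnected_image).union _ (Or.inr P.end_mem) hwT hT'⟩

end GraphLikeSpace

/-! ### The hat space and spanning sets -/

namespace GraphFramework

variable {α : Type u} {M : Matroid α} {Γ : GraphFramework M} {s t : Set α} {x y : Set α → ℤˣ}

theorem Reg.congr (hs : M.IsBase s) (hx : Γ.Reg s x) (h : ∀ b, M.IsCocircuit b → x b = y b) :
    Γ.Reg s y :=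
  ⟨Quad.of_approx hs fun _ _ hBc => ⟨x, hx.1, fun c hc => h c (hBc c hc)⟩,
    fun e he => (hx.2 e he).trans (Sat.of_eq hs h)⟩

theorem mem_hatVertices_iff (hT : IsTame M) (hM : IsConnectedMatroid M) {v : FVertex M} :
    v ∈ Γ.space.hatVertices ↔ (∃ e : M.E, v = Γ.srcVertex e ∨ v = Γ.tgtVertex e) ∨
      ∃ o, M.IsCircuit o ∧ Γ.InCl o (col v) := by
  constructor
  · rintro (h | h)
    exacts [Or.inl h, exists_end_or_inCl_of_onPseudoCircle hT hM h]
  · rintro (h | ⟨o, ho, h⟩)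
    exacts [Or.inl h, Or.inr (onPseudoCircle_of_inCl hT hM ho h)]

theorem reg_of_mem_hatVertices (hT : IsTame M) (hM : IsConnectedMatroid M) (hs : M.IsBase s)
    {v : FVertex M} (hv : v ∈ Γ.space.hatVertices) : Γ.Reg s (col v) ∧ M.E.Nonempty := by
  rcases (mem_hatVertices_iff hT hM).1 hv with ⟨e, rfl | rfl⟩ | ⟨o, ho, h⟩
  · exact ⟨(reg_end hT hM hs e.2 (Or.inl rfl)).congr hs fun b hb => (col_srcVertex e hb).symm,
      e, e.2⟩
  · exact ⟨(reg_end hT hM hs e.2 (Or.inr rfl)).congr hs fun b hb => (col_tgtVertex e hb).symm,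
      e, e.2⟩
  · exact ⟨reg_of_inCl hT hM hs ho h, ho.nonempty.mono ho.subset_ground⟩

theorem lineVertices_subset_hatVertices (hT : IsTame M) (hM : IsConnectedMatroid M)
    (hs : M.IsBase s) {v w : FVertex M} (hv : v ∈ Γ.space.hatVertices)
    (hw : w ∈ Γ.space.hatVertices) : Γ.lineVertices s (col v) (col w) ⊆ Γ.space.hatVertices := by
  intro x hx
  by_cases hvx : v = x
  · exact hvx ▸ hv
  by_cases hxw : x = w
  · exact hxw ▸ hw
  obtain ⟨hrv, e, he⟩ := reg_of_mem_hatVertices hT hM hs hv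
  obtain ⟨hrw, -⟩ := reg_of_mem_hatVertices hT hM hs hw
  rw [mem_hatVertices_iff hT hM]
  rcases OnLine.exists_end_or_inCl hT hM hs hrv hrw hx
    (exists_mem_diffSet_of_ne (onLine_left hrv.1) hx (exists_col_ne hvx))
    (exists_mem_diffSet_of_ne hx (onLine_right hrw.1 (hrv.sat hrw he)) (exists_col_ne hxw)) with
    ⟨e, he, y, hy, hyx⟩ | h
  · left
    have := toVertex_eq_iff.2 hyx
    refine ⟨⟨e, he⟩, ?_⟩
    rcases hy with rfl | rfl
    exacts [Or.inl this.symm, Or.inr this.symm]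
  · exact Or.inr h

/-- Stated for any space `G` on the hat vertices that contains the edges in `s`, so as to serve both
the whole hat space and its restrictions. -/
theorem exists_pseudoArc (hT : IsTame M) (hM : IsConnectedMatroid M) (hs : M.IsBase s)
    {E' : Type u} (G : GraphLikeSpace Γ.space.hatVertices E') (g : E' → M.E)
    (hG : G.top = Γ.space.top.induced (GraphLikeSpace.pointsMap Subtype.val g))
    (j : ∀ e : M.E, (e : α) ∈ s → E') (hj : ∀ e h, g (j e h) = e)
    (v w : Γ.space.hatVertices) :
    ∃ P : GraphLikeSpace.PseudoArc G v w, ∀ e ∈ P.edges, (g e : α) ∈ s := by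
  obtain ⟨hrv, e, he⟩ := reg_of_mem_hatVertices hT hM hs v.2
  obtain ⟨hrw, -⟩ := reg_of_mem_hatVertices hT hM hs w.2
  have hvw := hrv.sat hrw he
  have hsub := lineVertices_subset_hatVertices hT hM hs v.2 w.2
  refine ⟨⟨_, _, _, _, _, isPseudoLine_sub hT hM hs hrv hrw hvw,
    subHom (line_ends hT hM hs hrv hrw hvw) G Subtype.val g hG (fun a => ⟨a, hsub a.2⟩)
      (fun e => j e (diffSet_subset e.2)) (fun _ => rfl) (fun _ => hj _ _), injective_subHom,
      Subtype.ext toVertex_col, Subtype.ext toVertex_col⟩, ?_⟩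
  rintro e ⟨r, p, hp⟩
  rcases p with a | ⟨r', e'⟩
  · cases hp
  · cases hp
    rw [hj]
    exact diffSet_subset e'.2

theorem hatRestrict_top (t : Set α) : (Γ.hatRestrict t).top =
    Γ.space.top.induced (GraphLikeSpace.pointsMap Subtype.val Subtype.val) := by
  have : (GraphLikeSpace.pointsMap Subtype.val Subtype.val :
      Points Γ.space.hatVertices (Subtype.val ⁻¹' t : Set M.E) → Points (FVertex M) M.E) =
      GraphLikeSpace.pointsMap Subtype.val id ∘ GraphLikeSpace.pointsMap id Subtype.val := by
    funext p
    rcases p with v | ⟨r, e⟩ <;> rfl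
  rw [this]
  exact induced_compose

theorem isPseudoArcConnected_of_spanning (hT : IsTame M) (hM : IsConnectedMatroid M)
    (ht : M.Spanning t) : (Γ.hatRestrict t).IsPseudoArcConnected univ := by
  obtain ⟨s, hs, hst⟩ := ht.exists_isBase_subset
  refine Or.inr ⟨fun v w _ _ => ?_, fun e r _ => ?_⟩
  · obtain ⟨P, -⟩ := exists_pseudoArc hT hM hs (Γ.hatRestrict t) Subtype.val (hatRestrict_top t)
      (fun e he => ⟨e, hst he⟩) (fun _ _ => rfl) v w
    exact ⟨P, subset_univ _⟩
  · obtain ⟨γ, h1, h2, h3, h4, h5⟩ := (Γ.hatRestrict t).exists_arc_to_src e r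
    exact ⟨γ, h1, h2, by rwa [univ_inter], h4, Or.inl h5⟩

/-- A non-spanning set avoids a cocircuit through some `y`; the restriction then falls into the two
sides of that cocircuit, and both ends of `y`, which lie in the hat space, are on different sides.
-/
theorem spanning_of_preconnectedSpace (ht : t ⊆ M.E) (h : PreconnectedSpace (Γ.hatRestrict t).Pts) :
    M.Spanning t := by
  rw [Matroid.spanning_iff_ground_subset_closure ht]
  intro y hy
  by_contra hyt
  obtain ⟨b, hb, hyb, hd⟩ := exists_isCocircuit_mem_disjoint ht hy hyt
  have hcont : Continuous[(Γ.hatRestrict t).top, Γ.space.top]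
      (GraphLikeSpace.pointsMap Subtype.val Subtype.val) := by
    rw [hatRestrict_top]
    exact continuous_induced_dom
  have hpre := isPreconnected_range (α := (Γ.hatRestrict t).Pts) (β := Γ.space.Pts) hcont
  have := eq_of_isPreconnected hpre ⟨b, hb⟩ (v := Γ.srcVertex ⟨y, hy⟩) (w := Γ.tgtVertex ⟨y, hy⟩)
    ?_ ⟨Points.vertex ⟨_, Or.inl ⟨⟨y, hy⟩, Or.inl rfl⟩⟩, rfl⟩
    ⟨Points.vertex ⟨_, Or.inl ⟨⟨y, hy⟩, Or.inr rfl⟩⟩, rfl⟩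
  · exact (src_eq_tgt_iff (Γ := Γ)).1 this hyb
  · rintro r e ⟨p, hp⟩ heb
    rcases p with v | ⟨r', e'⟩
    · cases hp
    · cases hp
      exact disjoint_left.1 hd heb e'.2

theorem spanning_tfae (hT : IsTame M) (hM : IsConnectedMatroid M) (Γ : GraphFramework M)
    (ht : t ⊆ M.E) : List.TFAE [M.Spanning t, PreconnectedSpace (Γ.hatRestrict t).Pts,
      (Γ.hatRestrict t).IsPseudoArcConnected univ] := by
  tfae_have 1 → 3 := isPseudoArcConnected_of_spanning hT hM
  tfae_have 3 → 2 := fun h => h.preconnectedSpace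
  tfae_have 2 → 1 := spanning_of_preconnectedSpace ht
  tfae_finish

end GraphFramework
end GraphicMatroid

open GraphicMatroid in
theorem mainTheorem4 {α : Type*} (M : Matroid α) (hT : IsTame M) (hM : IsConnectedMatroid M)
    (Γ : GraphFramework M) :
    (∀ s : Set α, M.IsBase s → ∀ x y : Γ.space.hatVertices,
      ∃ P : GraphLikeSpace.PseudoArc Γ.hatSpace x y, ∀ e ∈ P.edges, (e : α) ∈ s) ∧
    (∀ s : Set α, s ⊆ M.E →
      List.TFAE [
        M.Spanning s,
        PreconnectedSpace (Γ.hatRestrict s).Pts,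
        (Γ.hatRestrict s).IsPseudoArcConnected Set.univ]) ∧
    (∀ s : Set α, s ⊆ M.E →
      List.TFAE [
        M.IsBase s,
        Minimal (fun t : Set α => t ⊆ M.E ∧ PreconnectedSpace (Γ.hatRestrict t).Pts) s,
        Minimal (fun t : Set α => t ⊆ M.E ∧
          (Γ.hatRestrict t).IsPseudoArcConnected Set.univ) s]) := by
  refine ⟨fun s hs x y => ?_, fun s hs => Γ.spanning_tfae hT hM hs, fun s _ => ?_⟩
  · exact GraphFramework.exists_pseudoArc hT hM hs Γ.hatSpace id rfl (fun e _ => e)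
      (fun _ _ => rfl) x y
  · have h2 : (fun t : Set α => t ⊆ M.E ∧ PreconnectedSpace (Γ.hatRestrict t).Pts) =
        M.Spanning := by
      funext t
      exact propext ⟨fun h => ((Γ.spanning_tfae hT hM h.1).out 0 1).2 h.2, fun h =>
        ⟨h.subset_ground, ((Γ.spanning_tfae hT hM h.subset_ground).out 0 1).1 h⟩⟩
    have h3 : (fun t : Set α => t ⊆ M.E ∧ (Γ.hatRestrict t).IsPseudoArcConnected Set.univ) =
        M.Spanning := by
      funext t
      exact propext ⟨fun h => ((Γ.spanning_tfae hT hM h.1).out 0 2).2 h.2, fun h =>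
        ⟨h.subset_ground, ((Γ.spanning_tfae hT hM h.subset_ground).out 0 2).1 h⟩⟩
    rw [h2, h3, Matroid.isBase_iff_minimal_spanning]
    tfae_finish
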